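/- **Setting.** Three servers $\mathcal P=\{P_0,P_1,P_2\}$ are connected by pairwise private authentic channels and a broadcast channel in a synchronous network; a static, malicious, rushing adversary corrupts at most one server $P^\star$. $\mathsf H$ is a polynomial-time computable keyed hash family $\{0,1\}^*\to\{0,1\}^{n(\kappa)}$, whose key is uniformly random and public. Let $\{P_i,P_j,P_k\}=\mathcal P$ ($i,j,k$ distinct). The senders $P_i,P_j$ hold common values $v_1,\dots,v_m\in\mathbb Z_{2^\ell}$, $m\ge 1$; write $v=v_1\|\cdots\|v_m$ ($m=1$ is a single invocation). **Protocol $\Pi_{\mathsf{jmp}}$** ($m$ send phases, followed by one common verify phase). 1. *Rounds $1,\dots,m$.* In round $t$, $P_i$ sends $v_t$ to $P_k$. In round $m$, $P_j$ also sends $\mathsf H(v)$ to $P_k$. 2. *Round $m+1$.* If $P_i$ (resp. $P_j$) was silent, $P_k$ broadcasts "(accuse, $P_i$)" (resp. "(accuse, $P_j$)"). The TTP is then $P_j$ if only $P_i$ is accused, and $P_i$ if $P_j$ or both are accused. Otherwise $P_k$, having received $\tilde v$, sends $b_k$ to $P_i,P_j$, where $b_k=0$ if $\mathsf H(\tilde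 v)$ equals the received digest and $b_k=1$ if not; with $b_k=0$, $P_k$ sends nothing further. 3. *Round $m+2$.* A sender that received no bit from $P_k$ broadcasts "(accuse, $P_k$)". The TTP is then $P_j$ if only $P_i$ accuses, and $P_i$ if $P_j$ or both accuse. A sender that received a bit from $P_k$ sends it to the other sender. 4. *Round $m+3$.* A sender that received no bit from the other sender broadcasts an accusation of it, and the TTP is $P_k$. Otherwise each sender replaces its bit by the OR of the two bits, and every server whose bit is $1$ broadcasts $\mathsf H_s$, the hash of its value ($v$ for senders, $\tilde v$ for $P_k$). If $P_k$ does not broadcast, or if neither sender does, no TTP is chosen. If $P_k$ and exactly one sender broadcast, the TTP is $P_k$. If all three broadcast, the TTP is $P_k$ if $\mathsf H_i\ne\mathsf H_j$, else $P_j$ if $\mathsf H_i\neq\mathsf H_k$, else $P_i$. An accusation ends the protocol for all servers with the TTP stated, and takes precedence over later messages and over digests of the same round. Malformed messages count as silence. A server outputs the TTP, if one is chosen. If none is chosen, $P_k$ outputs $\tilde v$ and $P_i,P_j$ output $\bot$. **Functionality $\mathcal F_{\mathsf{jmp}}$.** It receives $\mathsf v_i,\mathsf v_j$ from the senders and $\mathsf{ttp}\in\mathcal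 P\cup\{\bot\}$ from the simulator. If $\mathsf v_i=\mathsf v_j$ and $\mathsf{ttp}=\bot$, it outputs $\mathsf v_i$ to $P_k$ and $\bot$ to $P_i,P_j$. Else, if $\mathsf{ttp}\in\mathcal P\setminus\{P^\star\}$, it outputs $\mathsf{ttp}$ to all servers. Else it outputs the honest server with smallest index to all servers. **Theorem.** (a) *Security.* Let $\mathsf H$ be collision resistant against probabilistic polynomial-time (PPT) algorithms, and let $m(\kappa)\ge1$, $\ell(\kappa)$ be polynomially bounded and computable in time polynomial in $\kappa$ (in unary). Then $\Pi_{\mathsf{jmp}}$ securely realizes $\mathcal F_{\mathsf{jmp}}$: for every choice of at most one corrupt server and every PPT adversary $\mathcal A$ there is a PPT simulator $\mathcal S$, given the hash key, the auxiliary input of $\mathcal A$ and, if some server is corrupt, the common value $v$, such that every PPT environment (which sees the hash key, chooses $v$ and the auxiliary input, and sees the outputs of the honest servers and of $\mathcal A$ resp. $\mathcal S$) distinguishes the real from the ideal execution with negligible advantage only. In particular, in the real execution, except with negligible probability, either $P_k$ (if honest) outputs the common value and the honest senders output $\bot$, or all honest servers output the same honest server as TTP. (b) *Correctness.* If no server is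 corrupt, $P_k$ always outputs $v$, and $P_i,P_j$ output $\bot$. (c) *Cost.* The $t$-th value is sent in round $t$. For every (even unbounded) adversary corrupting at most one server, the $m$ invocations take $m+3$ rounds, and the honest servers communicate at most $m\ell+O(n(\kappa)+1)$ bits, with an absolute constant in the $O$. In an execution without corruption, for fixed $\kappa,\ell$ and $m\to\infty$, the number of rounds per message tends to $1$, the number of bits per message tends to $\ell$, and (for $\ell\ge1$) the ratio of message bits to communicated bits tends to $1$. -/

import Mathlib

/-! ## Machines with a step count -/

/-- Bit strings. -/
abbrev Str := List Bool

/-- The unary string `1^n`. -/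
def unary (n : ℕ) : Str := List.replicate n true

/-- Programs for a machine with countably many registers (of which a program uses finitely many),
each holding a stack of bits. -/
inductive Prog : Type
  | nop : Prog
  | push (r : ℕ) (b : Bool) : Prog
  | pop (r : ℕ) : Prog
  | seq (p q : Prog) : Prog
  /-- branch on the top bit of register `r` -/
  | branch (r : ℕ) (onTrue onFalse onEmpty : Prog) : Prog
  /-- repeat `body` as long as register `r` is non-empty -/
  | loop (r : ℕ) (body : Prog) : Prog

/-- `Run p s t s'`: started on the register contents `s`, the program `p` halts after exactly
`t` elementary steps, with register contents `s'`. -/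
inductive Run : Prog → (ℕ → Str) → ℕ → (ℕ → Str) → Prop
  | nop (s : ℕ → Str) : Run Prog.nop s 1 s
  | push (r : ℕ) (b : Bool) (s : ℕ → Str) :
      Run (Prog.push r b) s 1 (Function.update s r (b :: s r))
  | pop (r : ℕ) (s : ℕ → Str) : Run (Prog.pop r) s 1 (Function.update s r (s r).tail)
  | seq {p q : Prog} {s₁ s₂ s₃ : ℕ → Str} {t u : ℕ} :
      Run p s₁ t s₂ → Run q s₂ u s₃ → Run (Prog.seq p q) s₁ (t + u) s₃
  | branchTrue {r : ℕ} {p q e : Prog} {s s' : ℕ → Str} {t : ℕ} :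
      (s r).head? = some true → Run p s t s' → Run (Prog.branch r p q e) s (t + 1) s'
  | branchFalse {r : ℕ} {p q e : Prog} {s s' : ℕ → Str} {t : ℕ} :
      (s r).head? = some false → Run q s t s' → Run (Prog.branch r p q e) s (t + 1) s'
  | branchEmpty {r : ℕ} {p q e : Prog} {s s' : ℕ → Str} {t : ℕ} :
      s r = [] → Run e s t s' → Run (Prog.branch r p q e) s (t + 1) s'
  | loopDone {r : ℕ} {p : Prog} {s : ℕ → Str} : s r = [] → Run (Prog.loop r p) s 1 s
  | loopStep {r : ℕ} {p : Prog} {s₁ s₂ s₃ : ℕ → Str} {t u : ℕ} :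
      s₁ r ≠ [] → Run p s₁ t s₂ → Run (Prog.loop r p) s₂ u s₃ →
      Run (Prog.loop r p) s₁ (t + u + 1) s₃

/-- The inputs are placed in the first `a` registers, all other registers are empty. -/
def startStore {a : ℕ} (x : Fin a → Str) : ℕ → Str :=
  fun r => if h : r < a then x ⟨r, h⟩ else []

/-- `f` is computable in time polynomial in the total length of its inputs; its values are read
from the first `b` registers. -/
def PolyTime {a b : ℕ} (f : (Fin a → Str) → (Fin b → Str)) : Prop :=
  ∃ (p : Prog) (T : Polynomial ℕ), ∀ x : Fin a → Str, ∃ (t : ℕ) (s : ℕ → Str),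
    Run p (startStore x) t s ∧ t ≤ T.eval (∑ r, (x r).length) ∧ ∀ o : Fin b, s o = f x o

/-- A family indexed by the security parameter `κ`, computed by one polynomial-time program that
receives `1^κ` as an additional first input. -/
def PolyTimeFamily {a b : ℕ} (g : ℕ → (Fin a → Str) → (Fin b → Str)) : Prop :=
  ∃ f : (Fin (a + 1) → Str) → (Fin b → Str),
    PolyTime f ∧ ∀ (κ : ℕ) (x : Fin a → Str), f (Matrix.vecCons (unary κ) x) = g κ x

/-- A length (number of coins, of bits, ...) such that `1^κ ↦ 1^{n(κ)}` is polynomial time. -/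
def PolyLength (n : ℕ → ℕ) : Prop :=
  PolyTimeFamily (a := 0) (fun κ _ => ![unary (n κ)])

/-! ## Probability and negligible functions -/

/-- The uniformly random bit string of length `n`, as a function of the elementary outcome. -/
def str {n : ℕ} (ω : Fin n → Bool) : Str := List.ofFn ω

/-- The probability of an event under the uniform distribution on a finite space. -/
noncomputable def prob {Ω : Type} [Fintype Ω] (E : Ω → Prop) : ℝ :=
  (Nat.card {ω : Ω // E ω} : ℝ) / (Nat.card Ω : ℝ)

/-- Negligible functions of the security parameter. -/
def Negligible (f : ℕ → ℝ) : Prop :=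
  Asymptotics.SuperpolynomialDecay Filter.atTop (fun κ : ℕ => (κ : ℝ)) f

/-! ## Collision-resistant hash functions -/

/-- A family of hash functions `{0,1}^* → {0,1}^{outLen κ}` with keys in `{0,1}^{keyLen κ}`,
computable in polynomial time. -/
structure HashFamily where
  keyLen : ℕ → ℕ
  outLen : ℕ → ℕ
  hash : ℕ → Str → Str → Str
  keyLen_poly : ∃ T : Polynomial ℕ, ∀ κ, keyLen κ ≤ T.eval κ
  length_hash : ∀ (κ : ℕ) (key x : Str), key.length = keyLen κ →
    (hash κ key x).length = outLen κ
  polyTime : PolyTimeFamily (a := 2) (fun κ y => ![hash κ (y 0) (y 1)])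

/-- A probabilistic polynomial-time algorithm that, given `1^κ`, a key and its coins, outputs
a pair of strings. -/
structure CollisionFinder where
  coinLen : ℕ → ℕ
  coinLen_poly : PolyLength coinLen
  /-- inputs: key, coins -/
  attempt : ℕ → (Fin 2 → Str) → Str × Str
  polyTime : PolyTimeFamily (fun κ y => ![(attempt κ y).1, (attempt κ y).2])

def HashFamily.CollisionResistant (H : HashFamily) : Prop :=
  ∀ B : CollisionFinder, Negligible (fun κ =>
    prob (fun ω : (Fin (H.keyLen κ) → Bool) × (Fin (B.coinLen κ) → Bool) =>
      (B.attempt κ ![str ω.1, str ω.2]).1 ≠ (B.attempt κ ![str ω.1, str ω.2]).2 ∧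
      H.hash κ (str ω.1) (B.attempt κ ![str ω.1, str ω.2]).1 =
        H.hash κ (str ω.1) (B.attempt κ ![str ω.1, str ω.2]).2))

/-! ## Synchronous network of three servers with private channels and broadcast -/

abbrev Server := Fin 3

/-- Everything a server emits in one round: a private message for each server, a set of publicly
accused servers, and another public message (both over the broadcast channel). -/
structure Packet where
  priv : Server → Option Str := fun _ => none
  accuse : Server → Bool := fun _ => false
  bcast : Option Str := none

/-- The part of a packet that one particular observer can see. -/
structure Seen where
  priv : Option Str := none
  accuse : Server → Bool := fun _ => false
  bcast : Option Str := none

/-- The packets emitted by the three servers in one round. -/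
abbrev Round := Server → Packet

/-- What an observer sees of each of the three packets of a round. -/
abbrev RoundView := Server → Seen

/-- What server `c` sees of a round. An observer that is no server (`none`) sees the
broadcasts only. -/
def see (c : Option Server) (ρ : Round) : RoundView :=
  fun p => { priv := c.bind (ρ p).priv, accuse := (ρ p).accuse, bcast := (ρ p).bcast }

/-- What the adversary corrupting `c` sees of the packets of the honest servers. -/
def advView (c : Option Server) (hist : List Round) : List RoundView :=
  hist.map fun ρ => see c (fun p => if some p = c then {} else ρ p)

/-- The first `r` rounds of an execution, in chronological order. `honest` gives the packet of an
honest server from its view of the previous rounds; the adversary, who controls `c`, is rushing: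
it sees the packets of the honest servers of the current round before it fixes its own. -/
def execution (c : Option Server) (honest : Server → List RoundView → Packet)
    (adv : List RoundView → Packet) : ℕ → List Round
  | 0 => []
  | r + 1 =>
    let past := execution c honest adv r
    let now : Round := fun p => honest p (past.map (see (some p)))
    past ++ [fun p => if some p = c then adv (advView c (past ++ [now])) else now p]

/-- The number of bits of a packet; an accusation is a two-bit name of a server. -/
def Packet.bits (q : Packet) : ℕ :=
  (∑ d, ((q.priv d).getD []).length) + (q.bcast.getD []).length +
    2 * (Finset.univ.filter fun d => q.accuse d = true).card

/-- The total number of bits communicated by the honest servers. -/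
def honestBits (c : Option Server) (hist : List Round) : ℕ :=
  (hist.map fun ρ => ∑ p, if some p = c then 0 else (ρ p).bits).sum

/-! ## The joint message passing protocol

The protocol for `m` successive invocations with the same roles: the send phases are executed on
the flow, one per round, and the verify phase is executed once, at the end. For `m = 1` this is
the protocol for one message. -/

/-- `m` values of `ℓ` bits each: elements of `ℤ/2^ℓ` in their binary representation. -/
abbrev Batch (m ℓ : ℕ) := Fin m → List.Vector Bool ℓ

/-- The combined message: the concatenation of the values. -/
def Batch.toStr {m ℓ : ℕ} (v : Batch m ℓ) : Str := (List.ofFn fun t => (v t).toList).flatten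

/-- What a server obtains in the end: nothing, the value(s), or the identity of the TTP. -/
inductive Output (α : Type)
  | bot : Output α
  | val (x : α) : Output α
  | ttp (s : Server) : Output α

/-- The parameters of the protocol: the senders `i`, `j`, the receiver `k`, the number `m` of
messages, their length `ℓ`, and the hash function `h` with digests of `n` bits. -/
structure JmpParams where
  i : Server
  j : Server
  k : Server
  m : ℕ
  ℓ : ℕ
  n : ℕ
  h : Str → Str

namespace JmpParams

/-- What was seen of the packet of server `p` in round `r` (rounds are counted from `0`). -/
def seenAt (w : List RoundView) (r : ℕ) (p : Server) : Seen := w.getD r (fun _ => {}) p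

/-- A message that is not an `n`-bit string is treated like silence. -/
def ofLength (n : ℕ) (x : Str) : Option (List.Vector Bool n) :=
  if hx : x.length = n then some ⟨x, hx⟩ else none

def recvValue (P : JmpParams) (w : List RoundView) (t : ℕ) : Option (List.Vector Bool P.ℓ) :=
  (seenAt w t P.i).priv.bind (ofLength P.ℓ)

/-- The values that `P_k` received from `P_i`, if `P_i` was never silent. -/
def recvBatch (P : JmpParams) (w : List RoundView) : Option (Batch P.m P.ℓ) :=
  if hw : ∀ t : Fin P.m, (P.recvValue w t).isSome = true then
    some fun t => (P.recvValue w t).get (hw t)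
  else none

/-- The digest that `P_k` received from `P_j`. -/
def recvHash (P : JmpParams) (w : List RoundView) : Option (List.Vector Bool P.n) :=
  (seenAt w (P.m - 1) P.j).priv.bind (ofLength P.n)

/-- The bit privately received from server `p` in round `r`. -/
def recvBit (w : List RoundView) (r : ℕ) (p : Server) : Option Bool :=
  match (seenAt w r p).priv with
  | some [b] => some b
  | _ => none

/-- The digest broadcast by server `p` in the last round. -/
def publicHash (P : JmpParams) (w : List RoundView) (p : Server) :
    Option (List.Vector Bool P.n) :=
  (seenAt w (P.m + 2) p).bcast.bind (ofLength P.n)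

/-- The TTP determined by the accusations of `P_k` in round `m`. -/
def ttpByReceiver (P : JmpParams) (w : List RoundView) : Option Server :=
  match (seenAt w P.m P.k).accuse P.i, (seenAt w P.m P.k).accuse P.j with
  | true, true => some P.i
  | true, false => some P.j
  | false, true => some P.i
  | false, false => none

/-- The TTP determined by the accusations of `P_k` by the senders in round `m + 1`. -/
def ttpBySenders (P : JmpParams) (w : List RoundView) : Option Server :=
  match (seenAt w (P.m + 1) P.i).accuse P.k, (seenAt w (P.m + 1) P.j).accuse P.k with
  | true, true => some P.i
  | true, false => some P.j
  | false, true => some P.i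
  | false, false => none

/-- The TTP, if any, determined by the accusations of rounds `m` and `m + 1`. -/
def ttpEarly (P : JmpParams) (w : List RoundView) : Option Server :=
  (P.ttpByReceiver w).or (P.ttpBySenders w)

/-- The TTP determined by an accusation of one sender by the other in round `m + 2`. -/
def ttpByExchange (P : JmpParams) (w : List RoundView) : Option Server :=
  if (seenAt w (P.m + 2) P.i).accuse P.j || (seenAt w (P.m + 2) P.j).accuse P.i then some P.k
  else none

/-- The TTP determined by the broadcast digests. If `P_k` is silent, or if `P_k` speaks although
no sender has its bit on (so that `P_k` has announced the bit `0` to an honest sender and is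
through), there is none. -/
def ttpByHashes (P : JmpParams) (w : List RoundView) : Option Server :=
  match P.publicHash w P.i, P.publicHash w P.j, P.publicHash w P.k with
  | _, _, none => none
  | none, none, some _ => none
  | some _, none, some _ => some P.k
  | none, some _, some _ => some P.k
  | some x, some y, some z => if x ≠ y then some P.k else if x ≠ z then some P.j else some P.i

/-- The TTP, if any, that the protocol identifies; it depends on broadcasts only. -/
def ttp (P : JmpParams) (w : List RoundView) : Option Server :=
  ((P.ttpEarly w).or (P.ttpByExchange w)).or (P.ttpByHashes w)

/-- The packet of a sender `me`, where `other` is the fellow sender and `v` the common input.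
The round number is the length of the view `w`. -/
def senderPacket (P : JmpParams) (v : Batch P.m P.ℓ) (me other : Server)
    (w : List RoundView) : Packet :=
  if hr : w.length < P.m then
    -- send phase; in its last round, `P_j` sends the digest
    { priv := fun d =>
        if d ≠ P.k then none
        else if me = P.i then some (v ⟨w.length, hr⟩).toList
        else if w.length + 1 = P.m then some (P.h v.toStr)
        else none }
  else if w.length = P.m + 1 ∧ P.ttpByReceiver w = none then
    -- exchange of the bits received from `P_k`, or accusation of `P_k`
    match recvBit w P.m P.k with
    | some b => { priv := fun d => if d = other then some [b] else none }
    | none => { accuse := fun d => d = P.k }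
  else if w.length = P.m + 2 ∧ P.ttpEarly w = none then
    -- accusation of the fellow sender, or broadcast of the digest
    match recvBit w P.m P.k, recvBit w (P.m + 1) other with
    | _, none => { accuse := fun d => d = other }
    | some b, some b' => { bcast := if b || b' then some (P.h v.toStr) else none }
    | none, some _ => {}
  else {}

/-- The inconsistency bit of `P_k`. -/
def inconsistent (P : JmpParams) (x : Batch P.m P.ℓ) (y : List.Vector Bool P.n) : Bool :=
  decide (P.h x.toStr ≠ y.toList)

/-- The packet of the receiver. -/
def receiverPacket (P : JmpParams) (w : List RoundView) : Packet :=
  if w.length = P.m then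
    match P.recvBatch w, P.recvHash w with
    | some x, some y =>
      { priv := fun d => if d = P.i ∨ d = P.j then some [P.inconsistent x y] else none }
    | none, some _ => { accuse := fun d => d = P.i }
    | some _, none => { accuse := fun d => d = P.j }
    | none, none => { accuse := fun d => d = P.i ∨ d = P.j }
  else if w.length = P.m + 2 ∧ P.ttpEarly w = none then
    match P.recvBatch w, P.recvHash w with
    | some x, some y => { bcast := if P.inconsistent x y then some (P.h x.toStr) else none }
    | _, _ => {}
  else {}

/-- The honest servers; `v` is the common input of `P_i` and `P_j`. -/
def packet (P : JmpParams) (v : Batch P.m P.ℓ) (s : Server) (w : List RoundView) : Packet :=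
  if s = P.i then P.senderPacket v P.i P.j w
  else if s = P.j then P.senderPacket v P.j P.i w
  else if s = P.k then P.receiverPacket w
  else {}

/-- The number of rounds: one per message, and three more for the verification. -/
def rounds (P : JmpParams) : ℕ := P.m + 3

/-- The output of an honest server at the end of the protocol. -/
def output (P : JmpParams) (s : Server) (w : List RoundView) : Output (Batch P.m P.ℓ) :=
  match P.ttp w with
  | some t => Output.ttp t
  | none =>
    if s = P.k then
      match P.recvBatch w with
      | some x => Output.val x
      | none => Output.bot
    else Output.bot

/-- The execution of the protocol on the common input `v` with the server `c` corrupted. -/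
def transcript (P : JmpParams) (c : Option Server) (v : Batch P.m P.ℓ)
    (adv : List RoundView → Packet) : List Round :=
  execution c (P.packet v) adv P.rounds

/-- The output of the server `s` in that execution. -/
def result (P : JmpParams) (c : Option Server) (v : Batch P.m P.ℓ)
    (adv : List RoundView → Packet) (s : Server) : Output (Batch P.m P.ℓ) :=
  P.output s ((P.transcript c v adv).map (see (some s)))

end JmpParams

/-! ## The ideal functionality -/

/-- The honest server with smallest index. -/
def firstHonest (c : Option Server) : Server := if c = some 0 then 1 else 0

/-- The (corruption-aware) ideal functionality for joint message passing: `vi`, `vj` are the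
inputs of the senders, `sel` is the selection of the adversary, `c` the corrupt server. -/
def idealJmp {α : Type} [DecidableEq α] (k : Server) (c : Option Server)
    (vi vj : Option α) (sel : Option Server) : Server → Output α :=
  match vi, vj, sel with
  | some x, some y, none =>
    if x = y then fun s => if s = k then Output.val x else Output.bot
    else fun _ => Output.ttp (firstHonest c)
  | _, _, some t =>
    if some t ≠ c then fun _ => Output.ttp t else fun _ => Output.ttp (firstHonest c)
  | _, _, none => fun _ => Output.ttp (firstHonest c)

/-! ## Encodings -/

def encOption : Option Str → Str
  | none => []
  | some x => true :: x

def encServer : Option Server → Str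
  | none => []
  | some s => true :: List.replicate s false

def encOutput {m ℓ : ℕ} : Output (Batch m ℓ) → Str
  | Output.bot => []
  | Output.val v => true :: v.toStr
  | Output.ttp s => false :: List.replicate s true

/-- A self-delimiting encoding of a string. -/
def encDelim (x : Str) : Str := x.flatMap (fun b => [true, b]) ++ [false]

def encSeen (q : Seen) : Str :=
  encDelim (encOption q.priv) ++ encDelim (List.ofFn q.accuse) ++ encDelim (encOption q.bcast)

def encRound (v : RoundView) : Str := encSeen (v 0) ++ encSeen (v 1) ++ encSeen (v 2)

/-- The encoding of a view, the most recent round first. -/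
def encView (w : List RoundView) : Str := w.reverse.flatMap encRound

def encPacket (q : Packet) : Fin 5 → Str :=
  ![encOption (q.priv 0), encOption (q.priv 1), encOption (q.priv 2), List.ofFn q.accuse,
    encOption q.bcast]

/-! ## Real and ideal executions -/

/-- A probabilistic polynomial-time adversary, given by its next-message function (of its inputs,
its coins, and what it has seen so far) and by its final output. -/
structure Adversary where
  coinLen : ℕ → ℕ
  coinLen_poly : PolyLength coinLen
  /-- inputs: hash key, auxiliary input, input of the corrupt server, coins, view -/
  next : ℕ → (Fin 5 → Str) → Packet
  next_polyTime : PolyTimeFamily (fun κ y => encPacket (next κ y))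
  final : ℕ → (Fin 5 → Str) → Str
  final_polyTime : PolyTimeFamily (fun κ y => ![final κ y])

/-- A probabilistic polynomial-time environment: it sees the hash key, chooses the common input
of the senders and an auxiliary input for the adversary, and in the end outputs a bit. -/
structure Environment (m ℓ : ℕ → ℕ) where
  coinLen : ℕ → ℕ
  coinLen_poly : PolyLength coinLen
  /-- inputs: hash key, coins -/
  input : (κ : ℕ) → (Fin 2 → Str) → Batch (m κ) (ℓ κ)
  /-- inputs: hash key, coins -/
  aux : ℕ → (Fin 2 → Str) → Str
  input_polyTime : PolyTimeFamily (fun κ y => ![(input κ y).toStr, aux κ y])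
  /-- inputs: hash key, coins, outputs of the three servers (empty for the corrupt one), output
  of the adversary -/
  guess : ℕ → (Fin 6 → Str) → Bool
  guess_polyTime : PolyTimeFamily (fun κ y => ![[guess κ y]])

/-- A probabilistic polynomial-time simulator. -/
structure Simulator (m ℓ : ℕ → ℕ) where
  coinLen : ℕ → ℕ
  coinLen_poly : PolyLength coinLen
  /-- The input to the functionality in the name of a corrupt sender.
  Inputs: hash key, auxiliary input, common value, coins. -/
  input : (κ : ℕ) → (Fin 4 → Str) → Option (Batch (m κ) (ℓ κ))
  /-- the server selected as TTP -/
  select : ℕ → (Fin 4 → Str) → Option Server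
  message_polyTime : PolyTimeFamily (fun κ y =>
    ![encOption ((input κ y).map Batch.toStr), encServer (select κ y)])
  /-- inputs: as before, and the message of the functionality to the corrupt server -/
  final : ℕ → (Fin 5 → Str) → Str
  final_polyTime : PolyTimeFamily (fun κ y => ![final κ y])

/-- The senders, the receiver, the hash family, and the number and length of the messages. -/
structure JmpSetting where
  H : HashFamily
  i : Server
  j : Server
  k : Server
  m : ℕ → ℕ
  ℓ : ℕ → ℕ

namespace JmpSetting

def params (E : JmpSetting) (κ : ℕ) (key : Str) : JmpParams where
  i := E.i
  j := E.j
  k := E.k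
  m := E.m κ
  ℓ := E.ℓ κ
  n := E.H.outLen κ
  h := E.H.hash κ key

/-- The input of the corrupt server: the common value for a sender, nothing for the receiver. -/
def corruptInput (E : JmpSetting) (c : Option Server) {κ : ℕ} (v : Batch (E.m κ) (E.ℓ κ)) : Str :=
  if c = some E.i ∨ c = some E.j then v.toStr else []

/-- The strategy in the protocol that results from an adversary on its inputs and coins. -/
def strategy (E : JmpSetting) (c : Option Server) (A : Adversary) (Z : Environment E.m E.ℓ)
    (κ : ℕ) (key rZ rA : Str) : List RoundView → Packet :=
  fun w => A.next κ ![key, Z.aux κ ![key, rZ], E.corruptInput c (Z.input κ ![key, rZ]), rA,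
    encView w]

/-- The outputs of the servers in the real execution. -/
def realOutput (E : JmpSetting) (c : Option Server) (A : Adversary) (Z : Environment E.m E.ℓ)
    (κ : ℕ) (key rZ rA : Str) : Server → Output (Batch (E.m κ) (E.ℓ κ)) :=
  (E.params κ key).result c (Z.input κ ![key, rZ]) (E.strategy c A Z κ key rZ rA)

/-- The output of the adversary in the real execution. -/
def realFinal (E : JmpSetting) (c : Option Server) (A : Adversary) (Z : Environment E.m E.ℓ)
    (κ : ℕ) (key rZ rA : Str) : Str :=
  A.final κ ![key, Z.aux κ ![key, rZ], E.corruptInput c (Z.input κ ![key, rZ]), rA,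
    encView (advView c ((E.params κ key).transcript c (Z.input κ ![key, rZ])
      (E.strategy c A Z κ key rZ rA)))]

/-- The bit output by the environment on the outputs of the honest servers and of the
adversary. -/
def verdict (E : JmpSetting) (c : Option Server) (Z : Environment E.m E.ℓ) (κ : ℕ)
    (key rZ : Str) (out : Server → Output (Batch (E.m κ) (E.ℓ κ))) (fin : Str) : Bool :=
  Z.guess κ ![key, rZ,
    if some 0 = c then [] else encOutput (out 0),
    if some 1 = c then [] else encOutput (out 1),
    if some 2 = c then [] else encOutput (out 2), fin]

/-- The probability that the environment outputs `1` in the real world. -/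
noncomputable def realProb (E : JmpSetting) (c : Option Server) (A : Adversary)
    (Z : Environment E.m E.ℓ) (κ : ℕ) : ℝ :=
  prob (fun ω : (Fin (E.H.keyLen κ) → Bool) × (Fin (Z.coinLen κ) → Bool) ×
      (Fin (A.coinLen κ) → Bool) =>
    E.verdict c Z κ (str ω.1) (str ω.2.1)
      (E.realOutput c A Z κ (str ω.1) (str ω.2.1) (str ω.2.2))
      (E.realFinal c A Z κ (str ω.1) (str ω.2.1) (str ω.2.2)) = true)

/-- The inputs of the simulator: hash key, auxiliary input, the common value (if some server is
corrupt), coins. -/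
def simInput (E : JmpSetting) (c : Option Server) (Z : Environment E.m E.ℓ)
    (κ : ℕ) (key rZ rS : Str) : Fin 4 → Str :=
  ![key, Z.aux κ ![key, rZ], if c = none then [] else (Z.input κ ![key, rZ]).toStr, rS]

/-- The outputs of the functionality in the ideal execution: honest senders hand in the common
value, the simulator acts for the corrupt server. -/
def idealOutput (E : JmpSetting) (c : Option Server) (S : Simulator E.m E.ℓ)
    (Z : Environment E.m E.ℓ) (κ : ℕ) (key rZ rS : Str) :
    Server → Output (Batch (E.m κ) (E.ℓ κ)) :=
  idealJmp E.k c
    (if c = some E.i then S.input κ (E.simInput c Z κ key rZ rS)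
      else some (Z.input κ ![key, rZ]))
    (if c = some E.j then S.input κ (E.simInput c Z κ key rZ rS)
      else some (Z.input κ ![key, rZ]))
    (S.select κ (E.simInput c Z κ key rZ rS))

/-- The output of the simulator in the ideal execution. -/
def idealFinal (E : JmpSetting) (c : Option Server) (S : Simulator E.m E.ℓ)
    (Z : Environment E.m E.ℓ) (κ : ℕ) (key rZ rS : Str) : Str :=
  S.final κ ![key, Z.aux κ ![key, rZ],
    if c = none then [] else (Z.input κ ![key, rZ]).toStr, rS,
    match c with
    | none => []
    | some s => encOutput (E.idealOutput c S Z κ key rZ rS s)]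

/-- The probability that the environment outputs `1` in the ideal world. -/
noncomputable def idealProb (E : JmpSetting) (c : Option Server) (S : Simulator E.m E.ℓ)
    (Z : Environment E.m E.ℓ) (κ : ℕ) : ℝ :=
  prob (fun ω : (Fin (E.H.keyLen κ) → Bool) × (Fin (Z.coinLen κ) → Bool) ×
      (Fin (S.coinLen κ) → Bool) =>
    E.verdict c Z κ (str ω.1) (str ω.2.1)
      (E.idealOutput c S Z κ (str ω.1) (str ω.2.1) (str ω.2.2))
      (E.idealFinal c S Z κ (str ω.1) (str ω.2.1) (str ω.2.2)) = true)

/-- The protocol securely realizes the ideal functionality in the presence of a static malicious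
adversary corrupting at most one server. -/
def SecurelyRealizes (E : JmpSetting) : Prop :=
  ∀ (c : Option Server) (A : Adversary), ∃ S : Simulator E.m E.ℓ,
    ∀ Z : Environment E.m E.ℓ, Negligible (fun κ => |E.realProb c A Z κ - E.idealProb c S Z κ|)

/-- Either the receiver obtains the common value `v` (and the senders nothing), or all servers
agree on an honest TTP; this concerns the outputs of the honest servers only. -/
def Successful (E : JmpSetting) (c : Option Server) {κ : ℕ} (v : Batch (E.m κ) (E.ℓ κ))
    (out : Server → Output (Batch (E.m κ) (E.ℓ κ))) : Prop :=
  (∀ s, some s ≠ c → out s = if s = E.k then Output.val v else Output.bot) ∨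
  ∃ t, some t ≠ c ∧ ∀ s, some s ≠ c → out s = Output.ttp t

/-- The probability that neither happens in the real world. -/
noncomputable def failureProb (E : JmpSetting) (c : Option Server) (A : Adversary)
    (Z : Environment E.m E.ℓ) (κ : ℕ) : ℝ :=
  prob (fun ω : (Fin (E.H.keyLen κ) → Bool) × (Fin (Z.coinLen κ) → Bool) ×
      (Fin (A.coinLen κ) → Bool) =>
    ¬ E.Successful c (Z.input κ ![str ω.1, str ω.2.1])
      (E.realOutput c A Z κ (str ω.1) (str ω.2.1) (str ω.2.2)))

end JmpSetting

/-! ## Programs: renaming of registers, frame and cost -/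

/-! Security rests on a deterministic dichotomy, `JmpParams.outcome`, which holds for every strategy
of a single corrupt server: either the broadcasts determine an honest TTP, or they determine none
and an honest `P_k` holds a string with the same digest as the common value. The TTP is a function
of broadcasts alone, so all honest servers agree on it. A lone accusation is a dispute between two
servers, one of them corrupt, and the TTP is the third one. A double accusation occurs only if `P_k`
is corrupt, and then a sender is chosen. If no accusation is made, the digests decide. With `P_k`
corrupt, the honest senders have exchanged their bits and broadcast the same digest, so `P_k` is not
selected. With a sender corrupt and a mismatch noticed by `P_k`, the two honest servers both
broadcast, and the order of the comparisons of the digests avoids the corrupt sender.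

Hence the real execution can leave the ideal behaviour only if `P_k` accepts some `x ≠ v` with the
digest of `v` (`JmpSetting.Collides`). The simulator knows the key, the auxiliary input and `v`, so
it needs no cleverness: it runs the whole protocol with the adversary in its head, hands `v` and the
resulting TTP to the functionality, and outputs what the adversary outputs. It uses as many coins as
the adversary; on the common sample space the two worlds give the same verdict outside the collision
event, and the advantage is at most the probability of that event. An algorithm that runs
environment, adversary and protocol outputs the colliding pair, so this probability is negligible.
Without corruption the simulator is not given `v`, but then nothing is broadcast and the view is
independent of `v`.

The bulk of the work is to show that simulator and collision finder are polynomial-time programs of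
the concrete stack machine. `Transforms` and `Computes` form a calculus of polynomial-time maps
between register contexts, closed under composition, substitution, case distinction
(`Computes.pick`) and iteration with a state of bounded length (`Transforms.iterate`). Its result is
`ExecutionComputes.transcript`. The send phases are a loop of unbounded length; it stays polynomial
because the recorded view contains only packets of honest servers and because `P_k` discards
messages of the wrong length, so the adversary cannot inflate the state from round to round.

The cost is a count of the bits of each honest packet, and the limits follow by squeezing. -/

/-- The program `p` halts within `T` steps, taking the register contents `s` to `s'`. -/
def RunWithin (p : Prog) (s : ℕ → Str) (T : ℕ) (s' : ℕ → Str) : Prop :=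
  ∃ t ≤ T, Run p s t s'

namespace RunWithin

theorem mono {p : Prog} {s s' : ℕ → Str} {T U : ℕ} (h : RunWithin p s T s') (hTU : T ≤ U) :
    RunWithin p s U s' :=
  let ⟨t, ht, hr⟩ := h
  ⟨t, ht.trans hTU, hr⟩

theorem seq {p q : Prog} {s₁ s₂ s₃ : ℕ → Str} {T U : ℕ} (h₁ : RunWithin p s₁ T s₂)
    (h₂ : RunWithin q s₂ U s₃) : RunWithin (Prog.seq p q) s₁ (T + U) s₃ :=
  let ⟨t, ht, hr⟩ := h₁
  let ⟨u, hu, hq⟩ := h₂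
  ⟨t + u, add_le_add ht hu, Run.seq hr hq⟩

theorem push (r : ℕ) (b : Bool) (s : ℕ → Str) :
    RunWithin (Prog.push r b) s 1 (Function.update s r (b :: s r)) :=
  ⟨1, le_rfl, Run.push r b s⟩

theorem pop (r : ℕ) (s : ℕ → Str) :
    RunWithin (Prog.pop r) s 1 (Function.update s r (s r).tail) :=
  ⟨1, le_rfl, Run.pop r s⟩

theorem loopStep {r : ℕ} {p : Prog} {s₁ s₂ s₃ : ℕ → Str} {T U : ℕ} (hs : s₁ r ≠ [])
    (h₁ : RunWithin p s₁ T s₂) (h₂ : RunWithin (Prog.loop r p) s₂ U s₃) :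
    RunWithin (Prog.loop r p) s₁ (T + U + 1) s₃ :=
  let ⟨t, ht, hr⟩ := h₁
  let ⟨u, hu, hq⟩ := h₂
  ⟨t + u + 1, by omega, Run.loopStep hs hr hq⟩

theorem loopDone {r : ℕ} {p : Prog} {s : ℕ → Str} (hs : s r = []) :
    RunWithin (Prog.loop r p) s 1 s :=
  ⟨1, le_rfl, Run.loopDone hs⟩

end RunWithin

namespace Prog

/-- The program with all its registers moved up by `k`. -/
def shift (k : ℕ) : Prog → Prog
  | nop => nop
  | push r b => push (r + k) b
  | pop r => pop (r + k)
  | seq p q => seq (p.shift k) (q.shift k)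
  | branch r p q e => branch (r + k) (p.shift k) (q.shift k) (e.shift k)
  | loop r p => loop (r + k) (p.shift k)

/-- A bound on the registers that occur in a program. -/
def regBound : Prog → ℕ
  | nop => 0
  | push r _ => r + 1
  | pop r => r + 1
  | seq p q => max p.regBound q.regBound
  | branch r p q e => max (r + 1) (max p.regBound (max q.regBound e.regBound))
  | loop r p => max (r + 1) p.regBound

/-- Empty the registers `b, …, b + n - 1`. -/
def clearRange (b : ℕ) : ℕ → Prog
  | 0 => nop
  | n + 1 => seq (loop (b + n) (pop (b + n))) (clearRange b n)

/-- Reverse register `r` onto register `d`. -/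
def move (r d : ℕ) : Prog :=
  loop r (seq (branch r (push d true) (push d false) nop) (pop r))

/-- Reverse register `r` onto both registers `d` and `d'`. -/
def moveTwo (r d d' : ℕ) : Prog :=
  loop r (seq (branch r (seq (push d true) (push d' true)) (seq (push d false) (push d' false)) nop)
    (pop r))

end Prog

theorem Function.update_shift {s u : ℕ → Str} {k : ℕ} (hs : ∀ r, s (r + k) = u r) (a : ℕ)
    (x : Str) :
    (∀ r, Function.update s (a + k) x (r + k) = Function.update u a x r) ∧
      ∀ r < k, Function.update s (a + k) x r = s r := by
  refine ⟨fun r => ?_, fun r hr => ?_⟩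
  · by_cases h : r = a
    · simp [h]
    · rw [Function.update_of_ne (by omega), Function.update_of_ne h, hs]
  · rw [Function.update_of_ne (by omega)]

/-- A program addresses registers by number only, so renaming commutes with execution. This lets a
program run above `k` registers whose contents have to be preserved. -/
theorem Run.shift (k : ℕ) {p : Prog} {u u' : ℕ → Str} {t : ℕ} (h : Run p u t u') :
    ∀ s : ℕ → Str, (∀ r, s (r + k) = u r) →
      ∃ s', Run (p.shift k) s t s' ∧ (∀ r, s' (r + k) = u' r) ∧ ∀ r < k, s' r = s r := by
  induction h with
  | nop u => exact fun s hs => ⟨s, Run.nop s, hs, fun _ _ => rfl⟩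
  | push r b u =>
    intro s hs
    refine ⟨_, Run.push (r + k) b s, ?_⟩
    rw [hs r]
    exact Function.update_shift hs _ _
  | pop r u =>
    intro s hs
    refine ⟨_, Run.pop (r + k) s, ?_⟩
    rw [hs r]
    exact Function.update_shift hs _ _
  | seq _ _ ih₁ ih₂ =>
    intro s hs
    obtain ⟨s₁, h₁, e₁, f₁⟩ := ih₁ s hs
    obtain ⟨s₂, h₂, e₂, f₂⟩ := ih₂ s₁ e₁
    exact ⟨s₂, Run.seq h₁ h₂, e₂, fun r hr => (f₂ r hr).trans (f₁ r hr)⟩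
  | branchTrue hb _ ih =>
    intro s hs
    obtain ⟨s₁, h₁, e₁⟩ := ih s hs
    exact ⟨s₁, Run.branchTrue (by rw [hs, hb]) h₁, e₁⟩
  | branchFalse hb _ ih =>
    intro s hs
    obtain ⟨s₁, h₁, e₁⟩ := ih s hs
    exact ⟨s₁, Run.branchFalse (by rw [hs, hb]) h₁, e₁⟩
  | branchEmpty hb _ ih =>
    intro s hs
    obtain ⟨s₁, h₁, e₁⟩ := ih s hs
    exact ⟨s₁, Run.branchEmpty (by rw [hs, hb]) h₁, e₁⟩
  | loopDone hb => exact fun s hs => ⟨s, Run.loopDone (by rw [hs, hb]), hs, fun _ _ => rfl⟩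
  | loopStep hb _ _ ih₁ ih₂ =>
    intro s hs
    obtain ⟨s₁, h₁, e₁, f₁⟩ := ih₁ s hs
    obtain ⟨s₂, h₂, e₂, f₂⟩ := ih₂ s₁ e₁
    exact ⟨s₂, Run.loopStep (by rwa [hs]) h₁ h₂, e₂, fun r hr => (f₂ r hr).trans (f₁ r hr)⟩

/-- Only registers mentioned in the program can change, so finitely many registers have to be
emptied afterwards. -/
theorem Run.frame {p : Prog} {s s' : ℕ → Str} {t : ℕ} (h : Run p s t s') :
    ∀ r, p.regBound ≤ r → s' r = s r := by
  induction h with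
  | nop _ => exact fun _ _ => rfl
  | push a b u =>
    intro r hr
    exact Function.update_of_ne (by simp only [Prog.regBound] at hr; omega) _ _
  | pop a u =>
    intro r hr
    exact Function.update_of_ne (by simp only [Prog.regBound] at hr; omega) _ _
  | seq _ _ ih₁ ih₂ =>
    intro r hr
    simp only [Prog.regBound, max_le_iff] at hr
    rw [ih₂ r hr.2, ih₁ r hr.1]
  | branchTrue _ _ ih =>
    intro r hr
    simp only [Prog.regBound, max_le_iff] at hr
    exact ih r hr.2.1
  | branchFalse _ _ ih =>
    intro r hr
    simp only [Prog.regBound, max_le_iff] at hr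
    exact ih r hr.2.2.1
  | branchEmpty _ _ ih =>
    intro r hr
    simp only [Prog.regBound, max_le_iff] at hr
    exact ih r hr.2.2.2
  | loopDone _ => exact fun _ _ => rfl
  | loopStep _ _ _ ih₁ ih₂ =>
    intro r hr
    rw [ih₂ r hr]
    simp only [Prog.regBound, max_le_iff] at hr
    exact ih₁ r hr.2

/-- Each elementary step adds at most one bit. This is what makes polynomial time closed under
composition: a time bound is also a bound on the size of the output. -/
theorem Run.length_le {p : Prog} {s s' : ℕ → Str} {t : ℕ} (h : Run p s t s') :
    ∀ r, (s' r).length ≤ (s r).length + t := by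
  induction h with
  | nop _ => exact fun _ => Nat.le_add_right _ _
  | push a b u =>
    intro r
    by_cases h : r = a
    · subst h; simp
    · rw [Function.update_of_ne h]; omega
  | pop a u =>
    intro r
    by_cases h : r = a
    · subst h; simp; omega
    · rw [Function.update_of_ne h]; omega
  | seq _ _ ih₁ ih₂ => exact fun r => by have := ih₁ r; have := ih₂ r; omega
  | branchTrue _ _ ih => exact fun r => by have := ih r; omega
  | branchFalse _ _ ih => exact fun r => by have := ih r; omega
  | branchEmpty _ _ ih => exact fun r => by have := ih r; omega
  | loopDone _ => exact fun _ => Nat.le_add_right _ _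
  | loopStep _ _ _ ih₁ ih₂ => exact fun r => by have := ih₁ r; have := ih₂ r; omega

theorem RunWithin.clear (r : ℕ) (s : ℕ → Str) :
    RunWithin (Prog.loop r (Prog.pop r)) s (2 * (s r).length + 1) (Function.update s r []) := by
  generalize hx : s r = x
  induction x generalizing s with
  | nil =>
    have : Function.update s r [] = s := by rw [← hx, Function.update_eq_self]
    rw [this]
    exact RunWithin.loopDone hx
  | cons b x ih =>
    have h := ih (Function.update s r (s r).tail) (by simp [hx])
    rw [Function.update_idem] at h
    refine (RunWithin.loopStep (by simp [hx]) (RunWithin.pop r s) h).mono ?_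
    simp only [List.length_cons]; omega

theorem RunWithin.clearRange (b M : ℕ) : ∀ (n : ℕ) (s : ℕ → Str), (∀ r, (s r).length ≤ M) →
    RunWithin (Prog.clearRange b n) s (n * (2 * M + 1) + 1)
      (fun r => if b ≤ r ∧ r < b + n then [] else s r)
  | 0, s, _ => by
    have : (fun r => if b ≤ r ∧ r < b + 0 then [] else s r) = s := by
      funext r; rw [if_neg (by omega)]
    rw [this]
    exact ⟨1, by omega, Run.nop s⟩
  | n + 1, s, hs => by
    have h := RunWithin.clearRange b M n (Function.update s (b + n) []) (fun r => by
      by_cases hr : r = b + n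
      · simp [hr]
      · rw [Function.update_of_ne hr]; exact hs r)
    have e : (fun r => if b ≤ r ∧ r < b + (n + 1) then [] else s r) =
        fun r => if b ≤ r ∧ r < b + n then [] else Function.update s (b + n) [] r := by
      funext r
      by_cases hr : r = b + n
      · simp [hr]
      · rw [Function.update_of_ne hr]
        exact if_congr (by omega) rfl rfl
    rw [e]
    refine ((RunWithin.clear (b + n) s).seq h).mono ?_
    have := hs (b + n)
    have e : (n + 1) * (2 * M + 1) = n * (2 * M + 1) + (2 * M + 1) := by ring
    omega

/-- Popping one stack onto another reverses it; a faithful transfer therefore takes two moves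
through a scratch register. Each bit costs a branch, a push, a pop and a loop test. -/
theorem RunWithin.move {r d : ℕ} (hrd : r ≠ d) (s : ℕ → Str) :
    RunWithin (Prog.move r d) s (4 * (s r).length + 1)
      (Function.update (Function.update s r []) d ((s r).reverse ++ s d)) := by
  generalize hx : s r = x
  induction x generalizing s with
  | nil =>
    have : Function.update (Function.update s r []) d (([] : Str).reverse ++ s d) = s := by
      rw [← hx, Function.update_eq_self]; simp [hx]
    rw [this]
    exact RunWithin.loopDone hx
  | cons b x ih =>
    set s₁ := Function.update s d (b :: s d) with hs₁
    have h₁ : RunWithin (Prog.branch r (Prog.push d true) (Prog.push d false) Prog.nop) s 2 s₁ := by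
      refine ⟨2, le_rfl, ?_⟩
      cases b
      · exact Run.branchFalse (by simp [hx]) (Run.push d false s)
      · exact Run.branchTrue (by simp [hx]) (Run.push d true s)
    have hr₁ : s₁ r = b :: x := by rw [hs₁, Function.update_of_ne hrd, hx]
    have h := ih (Function.update s₁ r (s₁ r).tail) (by simp [hr₁])
    have e : Function.update (Function.update (Function.update s₁ r (s₁ r).tail) r []) d
        (x.reverse ++ Function.update s₁ r (s₁ r).tail d) =
        Function.update (Function.update s r []) d ((b :: x).reverse ++ s d) := by
      funext q
      by_cases hqd : q = d
      · subst hqd; simp [Function.update_of_ne hrd.symm, hs₁]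
      · by_cases hqr : q = r
        · subst hqr; simp [hqd]
        · simp [hqd, hqr, hs₁]
    rw [e] at h
    refine (RunWithin.loopStep (by simp [hx]) (h₁.seq (RunWithin.pop r s₁)) h).mono ?_
    simp only [List.length_cons]; omega

theorem RunWithin.moveTwo {r d d' : ℕ} (hrd : r ≠ d) (hrd' : r ≠ d') (hdd' : d ≠ d')
    (s : ℕ → Str) :
    RunWithin (Prog.moveTwo r d d') s (5 * (s r).length + 1)
      (Function.update (Function.update (Function.update s r []) d ((s r).reverse ++ s d)) d'
        ((s r).reverse ++ s d')) := by
  generalize hx : s r = x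
  induction x generalizing s with
  | nil =>
    have : Function.update (Function.update (Function.update s r []) d
        (([] : Str).reverse ++ s d)) d' (([] : Str).reverse ++ s d') = s := by
      rw [← hx, Function.update_eq_self]; simp [hx]
    rw [this]
    exact RunWithin.loopDone hx
  | cons b x ih =>
    set s₁ := Function.update (Function.update s d (b :: s d)) d' (b :: s d') with hs₁
    have hp : ∀ b, Run (Prog.seq (Prog.push d b) (Prog.push d' b)) s 2
        (Function.update (Function.update s d (b :: s d)) d' (b :: s d')) := fun b => by
      have h := Run.push d' b (Function.update s d (b :: s d))
      rw [Function.update_of_ne hdd'.symm] at h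
      exact Run.seq (Run.push d b s) h
    have h₁ : RunWithin (Prog.branch r (Prog.seq (Prog.push d true) (Prog.push d' true))
        (Prog.seq (Prog.push d false) (Prog.push d' false)) Prog.nop) s 3 s₁ := by
      refine ⟨3, le_rfl, ?_⟩
      cases b
      · exact Run.branchFalse (by simp [hx]) (hp false)
      · exact Run.branchTrue (by simp [hx]) (hp true)
    have hr₁ : s₁ r = b :: x := by
      rw [hs₁, Function.update_of_ne hrd', Function.update_of_ne hrd, hx]
    have h := ih (Function.update s₁ r (s₁ r).tail) (by simp [hr₁])
    have e : Function.update (Function.update (Function.update (Function.update s₁ r (s₁ r).tail)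
        r []) d (x.reverse ++ Function.update s₁ r (s₁ r).tail d)) d'
          (x.reverse ++ Function.update s₁ r (s₁ r).tail d') =
        Function.update (Function.update (Function.update s r []) d ((b :: x).reverse ++ s d)) d'
          ((b :: x).reverse ++ s d') := by
      funext q
      by_cases hqd' : q = d'
      · subst hqd'; simp [Function.update_of_ne hrd'.symm, hs₁]
      by_cases hqd : q = d
      · subst hqd; simp [Function.update_of_ne hrd.symm, hs₁, hdd']
      · by_cases hqr : q = r
        · subst hqr; simp [hqd, hqd']
        · simp [hqd, hqr, hs₁, hqd']
    rw [e] at h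
    refine (RunWithin.loopStep (by simp [hx]) (h₁.seq (RunWithin.pop r s₁)) h).mono ?_
    simp only [List.length_cons]; omega

/-! ## Polynomial bounds -/

/-- The coefficients are natural numbers, so every term is monotone. Time bounds can thus be
evaluated at upper bounds for the sizes. -/
theorem Polynomial.eval_nat_mono (T : Polynomial ℕ) {a b : ℕ} (h : a ≤ b) :
    T.eval a ≤ T.eval b := by
  rw [Polynomial.eval_eq_sum, Polynomial.eval_eq_sum]
  exact Finset.sum_le_sum fun i _ => Nat.mul_le_mul_left _ (Nat.pow_le_pow_left h i)

/-- `f` is bounded by a polynomial in `σ`. -/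
def PolyBounded {X : Type} (σ f : X → ℕ) : Prop := ∃ T : Polynomial ℕ, ∀ x, f x ≤ T.eval (σ x)

namespace PolyBounded

variable {X : Type} {σ τ f g : X → ℕ}

theorem const (n : ℕ) : PolyBounded σ fun _ => n :=
  ⟨Polynomial.C n, fun x => by simp⟩

theorem self : PolyBounded σ σ :=
  ⟨Polynomial.X, fun x => by simp⟩

theorem mono (hf : PolyBounded σ f) (h : ∀ x, g x ≤ f x) : PolyBounded σ g :=
  let ⟨T, hT⟩ := hf
  ⟨T, fun x => (h x).trans (hT x)⟩

theorem add (hf : PolyBounded σ f) (hg : PolyBounded σ g) : PolyBounded σ fun x => f x + g x :=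
  let ⟨T, hT⟩ := hf
  let ⟨U, hU⟩ := hg
  ⟨T + U, fun x => by rw [Polynomial.eval_add]; exact add_le_add (hT x) (hU x)⟩

theorem mul (hf : PolyBounded σ f) (hg : PolyBounded σ g) : PolyBounded σ fun x => f x * g x :=
  let ⟨T, hT⟩ := hf
  let ⟨U, hU⟩ := hg
  ⟨T * U, fun x => by rw [Polynomial.eval_mul]; exact Nat.mul_le_mul (hT x) (hU x)⟩

theorem trans (hf : PolyBounded τ f) (hτ : PolyBounded σ τ) : PolyBounded σ f :=
  let ⟨T, hT⟩ := hf
  let ⟨U, hU⟩ := hτ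
  ⟨T.comp U, fun x => by
    rw [Polynomial.eval_comp]
    exact (hT x).trans (T.eval_nat_mono (hU x))⟩

theorem comp {Y : Type} (hf : PolyBounded σ f) (φ : Y → X) :
    PolyBounded (fun y => σ (φ y)) fun y => f (φ y) :=
  let ⟨T, hT⟩ := hf
  ⟨T, fun y => hT (φ y)⟩

end PolyBounded

/-! ## Contexts and polynomial-time transformations -/

/-- The register contents that hold the values of the functions in a list. -/
def store {X : Type} : List (X → Str) → X → ℕ → Str
  | [], _, _ => []
  | f :: _, x, 0 => f x
  | _ :: Γ, x, r + 1 => store Γ x r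

/-- The total length of the values of the functions in a list. -/
def ctxSize {X : Type} (Γ : List (X → Str)) (x : X) : ℕ := (Γ.map fun f => (f x).length).sum

section Store

variable {X : Type}

@[simp] theorem store_nil (x : X) (r : ℕ) : store [] x r = [] := rfl

@[simp] theorem store_cons_zero (f : X → Str) (Γ : List (X → Str)) (x : X) :
    store (f :: Γ) x 0 = f x := rfl

@[simp] theorem store_cons_succ (f : X → Str) (Γ : List (X → Str)) (x : X) (r : ℕ) :
    store (f :: Γ) x (r + 1) = store Γ x r := rfl

theorem store_append_add (Θ Γ : List (X → Str)) (x : X) (r : ℕ) :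
    store (Θ ++ Γ) x (r + Θ.length) = store Γ x r := by
  induction Θ with
  | nil => rfl
  | cons f Θ ih => exact ih

theorem store_append_lt (Θ Γ : List (X → Str)) (x : X) {r : ℕ} (hr : r < Θ.length) :
    store (Θ ++ Γ) x r = store Θ x r := by
  induction Θ generalizing r with
  | nil => simp at hr
  | cons f Θ ih =>
    cases r with
    | zero => rfl
    | succ r => exact ih (by simpa using hr)

theorem store_of_le (Γ : List (X → Str)) (x : X) {r : ℕ} (hr : Γ.length ≤ r) :
    store Γ x r = [] := by
  induction Γ generalizing r with
  | nil => rfl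
  | cons f Γ ih =>
    cases r with
    | zero => simp at hr
    | succ r => exact ih (by simpa using hr)

theorem store_map {Y : Type} (Γ : List (X → Str)) (φ : Y → X) (y : Y) :
    store (Γ.map fun f y => f (φ y)) y = store Γ (φ y) := by
  funext r
  induction Γ generalizing r with
  | nil => rfl
  | cons f Γ ih => cases r with
    | zero => rfl
    | succ r => exact ih r

theorem length_store_le (Γ : List (X → Str)) (x : X) (r : ℕ) :
    (store Γ x r).length ≤ ctxSize Γ x := by
  induction Γ generalizing r with
  | nil => simp
  | cons f Γ ih =>
    simp only [ctxSize, List.map_cons, List.sum_cons]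
    cases r with
    | zero => exact Nat.le_add_right _ _
    | succ r => exact (ih r).trans (Nat.le_add_left _ _)

theorem ctxSize_le (Γ : List (X → Str)) (x : X) {M : ℕ} (h : ∀ f ∈ Γ, (f x).length ≤ M) :
    ctxSize Γ x ≤ Γ.length * M := by
  induction Γ with
  | nil => simp [ctxSize]
  | cons f Γ ih =>
    have h₁ := h f (by simp)
    have h₂ := ih fun g hg => h g (by simp [hg])
    simp only [ctxSize, List.map_cons, List.sum_cons, List.length_cons, Nat.add_one_mul] at h₂ ⊢
    omega

theorem exists_store_eq {Γ : List (X → Str)} {f : X → Str} (hf : f ∈ Γ) :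
    ∃ r < Γ.length, ∀ x, store Γ x r = f x := by
  induction Γ with
  | nil => simp at hf
  | cons g Γ ih =>
    by_cases h : f = g
    · exact ⟨0, by simp, fun x => by rw [h]; rfl⟩
    · obtain ⟨r, hr, e⟩ := ih (by simpa [h] using hf)
      exact ⟨r + 1, by simpa using hr, e⟩

theorem length_le_ctxSize {Γ : List (X → Str)} {f : X → Str} (hf : f ∈ Γ) (x : X) :
    (f x).length ≤ ctxSize Γ x := by
  obtain ⟨r, _, e⟩ := exists_store_eq hf
  rw [← e x]
  exact length_store_le Γ x r

theorem ctxSize_append (Θ Γ : List (X → Str)) (x : X) :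
    ctxSize (Θ ++ Γ) x = ctxSize Θ x + ctxSize Γ x := by
  simp [ctxSize]

theorem ctxSize_map {Y : Type} (Γ : List (X → Str)) (φ : Y → X) (y : Y) :
    ctxSize (Γ.map fun f y => f (φ y)) y = ctxSize Γ (φ y) := by
  simp [ctxSize, Function.comp_def]

end Store

/-- A program takes the values of the functions in `Γ` to those of the functions in `Δ`, in
polynomial time and leaving all other registers empty. -/
def Transforms {X : Type} (Γ Δ : List (X → Str)) : Prop :=
  ∃ (p : Prog) (τ : X → ℕ), PolyBounded (ctxSize Γ) τ ∧
    ∀ x, RunWithin p (store Γ x) (τ x) (store Δ x)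

namespace Transforms

variable {X : Type} {Γ Δ Θ : List (X → Str)}

theorem refl (Γ : List (X → Str)) : Transforms Γ Γ :=
  ⟨Prog.nop, fun _ => 1, .const 1, fun _ => ⟨1, le_rfl, Run.nop _⟩⟩

/-- An output register is at most as long as its initial content plus the running time. -/
theorem polyBounded (h : Transforms Γ Δ) {f : X → Str} (hf : f ∈ Δ) :
    PolyBounded (ctxSize Γ) fun x => (f x).length := by
  obtain ⟨p, τ, hτ, hp⟩ := h
  obtain ⟨r, _, hr⟩ := exists_store_eq hf
  refine (PolyBounded.self.add hτ).mono fun x => ?_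
  obtain ⟨t, ht, hrun⟩ := hp x
  have h₁ := hrun.length_le r
  have h₂ := length_store_le Γ x r
  rw [hr] at h₁
  omega

theorem polyBounded_ctxSize (h : Transforms Γ Δ) : PolyBounded (ctxSize Γ) (ctxSize Δ) := by
  have : ∀ Δ' : List (X → Str), (∀ f ∈ Δ', f ∈ Δ) → PolyBounded (ctxSize Γ) (ctxSize Δ') := by
    intro Δ' hΔ'
    induction Δ' with
    | nil => exact .const 0
    | cons f Δ' ih =>
      exact (h.polyBounded (hΔ' f (by simp))).add (ih fun g hg => hΔ' g (by simp [hg]))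
  exact this Δ fun _ => id

theorem trans (h₁ : Transforms Γ Δ) (h₂ : Transforms Δ Θ) : Transforms Γ Θ := by
  have hs := h₁.polyBounded_ctxSize
  obtain ⟨p, τ, hτ, hp⟩ := h₁
  obtain ⟨q, υ, hυ, hq⟩ := h₂
  exact ⟨Prog.seq p q, fun x => τ x + υ x, hτ.add (hυ.trans hs), fun x => (hp x).seq (hq x)⟩

/-- The program is moved above the registers of `Θ`, which it then never touches. -/
theorem frame (Θ : List (X → Str)) (h : Transforms Γ Δ) : Transforms (Θ ++ Γ) (Θ ++ Δ) := by
  obtain ⟨p, τ, hτ, hp⟩ := h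
  refine ⟨p.shift Θ.length, τ, hτ.trans ?_, fun x => ?_⟩
  · refine PolyBounded.self.mono fun x => ?_
    rw [ctxSize_append]
    exact Nat.le_add_left _ _
  · obtain ⟨t, ht, hr⟩ := hp x
    obtain ⟨s', hs', e₁, e₂⟩ := hr.shift Θ.length (store (Θ ++ Γ) x) (store_append_add Θ Γ x)
    have : s' = store (Θ ++ Δ) x := by
      funext r
      by_cases hr : r < Θ.length
      · rw [e₂ r hr, store_append_lt _ _ _ hr, store_append_lt _ _ _ hr]
      · obtain ⟨q, rfl⟩ := Nat.exists_eq_add_of_le' (not_lt.1 hr)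
        rw [e₁, store_append_add]
    exact ⟨t, ht, this ▸ hs'⟩

/-- It is enough to produce the values in the first registers; the others can be emptied. -/
theorem of_run (p : Prog) {τ : X → ℕ} (hτ : PolyBounded (ctxSize Γ) τ)
    (hp : ∀ x, ∃ s', RunWithin p (store Γ x) (τ x) s' ∧
      ∀ r < Δ.length, s' r = store Δ x r) : Transforms Γ Δ := by
  -- From `N` on, registers are neither used by `p` nor filled initially, so emptying `N` registers
  -- after those of `Δ` removes all garbage.
  set N := max p.regBound Γ.length
  refine ⟨Prog.seq p (Prog.clearRange Δ.length N),
    fun x => τ x + (N * (2 * (ctxSize Γ x + τ x) + 1) + 1), ?_, fun x => ?_⟩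
  · exact hτ.add (((PolyBounded.const N).mul (((PolyBounded.const 2).mul
      (PolyBounded.self.add hτ)).add (.const 1))).add (.const 1))
  · obtain ⟨s', hr, hs'⟩ := hp x
    refine hr.seq ?_
    obtain ⟨t, ht, hrun⟩ := hr
    have h := RunWithin.clearRange Δ.length (ctxSize Γ x + τ x) N s' fun r => by
      have h₁ := hrun.length_le r
      have h₂ := length_store_le Γ x r
      omega
    convert h using 1
    funext r
    split_ifs with hc
    · exact store_of_le _ _ hc.1
    · by_cases hr : r < Δ.length
      · exact (hs' r hr).symm
      · rw [store_of_le _ _ (not_lt.1 hr), hrun.frame r (by omega), store_of_le _ _ (by omega)]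

/-- Reading a stack destroys it. The content is first reversed into the scratch register `Γ.length +
1` and then reversed back, at once into its old place and into the new register `Γ.length`. -/
theorem copyAppend {f : X → Str} (hf : f ∈ Γ) : Transforms Γ (Γ ++ [f]) := by
  obtain ⟨r, hr, e⟩ := exists_store_eq hf
  refine of_run (Prog.seq (Prog.move r (Γ.length + 1))
      (Prog.moveTwo (Γ.length + 1) r Γ.length))
    (τ := fun x => (4 * ctxSize Γ x + 1) + (5 * ctxSize Γ x + 1)) ?_ fun x => ?_
  · exact (((PolyBounded.const 4).mul .self).add (.const 1)).add
      (((PolyBounded.const 5).mul .self).add (.const 1))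
  · have hl : (store Γ x r).length ≤ ctxSize Γ x := length_store_le Γ x r
    have h₁ := RunWithin.move (r := r) (d := Γ.length + 1) (by omega) (store Γ x)
    rw [store_of_le Γ x (Nat.le_succ _), List.append_nil] at h₁
    have h₂ := RunWithin.moveTwo (r := Γ.length + 1) (d := r) (d' := Γ.length) (by omega) (by omega)
      (by omega) (Function.update (Function.update (store Γ x) r [])
        (Γ.length + 1) (store Γ x r).reverse)
    refine ⟨_, (h₁.mono (by omega)).seq (h₂.mono (by simp; omega)), fun q hq => ?_⟩
    simp only [List.length_append, List.length_singleton] at hq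
    by_cases hqa : q = Γ.length
    · subst hqa
      have h0 := store_append_add Γ [f] x 0
      rw [Nat.zero_add] at h0
      rw [h0, store_cons_zero, Function.update_self, Function.update_self, List.reverse_reverse,
        Function.update_of_ne (by omega), Function.update_of_ne (by omega),
        store_of_le _ _ le_rfl, e, List.append_nil]
    · rw [Function.update_of_ne hqa, store_append_lt _ _ _ (by omega)]
      by_cases hqr : q = r
      · subst hqr
        rw [Function.update_self, Function.update_self, List.reverse_reverse,
          Function.update_of_ne (by omega), Function.update_self, List.append_nil]
      · rw [Function.update_of_ne hqr, Function.update_of_ne (by omega),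
          Function.update_of_ne (by omega), Function.update_of_ne hqr]

theorem replaceFirst (f g : X → Str) : Transforms (f :: g :: Γ) (g :: (fun _ => []) :: Γ) := by
  -- The first free register; passing through it restores the order of the bits.
  set a := Γ.length + 2
  refine of_run (Prog.seq (Prog.loop 0 (Prog.pop 0)) (Prog.seq (Prog.move 1 a) (Prog.move a 0)))
    (τ := fun x => (2 * (f x).length + 1) + ((4 * (g x).length + 1) + (4 * (g x).length + 1)))
    ?_ fun x => ?_
  · refine ((((PolyBounded.const 8).mul .self).add ((PolyBounded.const 2).mul .self)).add
      (.const 3)).mono fun x => ?_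
    have h₁ := length_le_ctxSize (Γ := f :: g :: Γ) (f := f) (by simp) x
    have h₂ := length_le_ctxSize (Γ := f :: g :: Γ) (f := g) (by simp) x
    omega
  · have h₁ := RunWithin.clear 0 (store (f :: g :: Γ) x)
    have h₂ := RunWithin.move (r := 1) (d := a) (by omega)
      (Function.update (store (f :: g :: Γ) x) 0 [])
    have h₃ := RunWithin.move (r := a) (d := 0) (by omega) (Function.update (Function.update
      (Function.update (store (f :: g :: Γ) x) 0 []) 1 []) a
      ((Function.update (store (f :: g :: Γ) x) 0 [] 1).reverse ++
        Function.update (store (f :: g :: Γ) x) 0 [] a))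
    have ha : store (f :: g :: Γ) x a = [] := store_of_le _ _ (by simp [a])
    have h1 : store (f :: g :: Γ) x 1 = g x := rfl
    simp only [ne_eq, one_ne_zero, not_false_eq_true, Function.update_of_ne,
      show a ≠ 0 by omega, ha, Function.update_self, List.append_nil, List.reverse_reverse,
      show (0 : ℕ) ≠ a by omega, show (0 : ℕ) ≠ 1 by omega, List.length_reverse, h1] at h₁ h₂ h₃
    refine ⟨_, h₁.seq (h₂.seq h₃), fun q hq => ?_⟩
    simp only [List.length_cons] at hq
    match q with
    | 0 => simp
    | 1 => simp [show 1 ≠ a by omega]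
    | q + 2 =>
      rw [Function.update_of_ne (by omega), Function.update_of_ne (by omega),
        Function.update_of_ne (by omega), Function.update_of_ne (by omega),
        Function.update_of_ne (by omega)]
      rfl

/-- The contexts must be contiguous, so the hole left by the first register is pushed to the end,
one register at a time. -/
theorem dropFirst (f : X → Str) (Γ : List (X → Str)) : Transforms (f :: Γ) Γ := by
  induction Γ generalizing f with
  | nil => exact of_run Prog.nop (.const 1) fun x => ⟨_, ⟨1, le_rfl, Run.nop _⟩, by simp⟩
  | cons g Γ ih => exact (replaceFirst f g).trans ((ih fun _ => []).frame [g])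

theorem drop (Θ Γ : List (X → Str)) : Transforms (Θ ++ Γ) Γ := by
  induction Θ with
  | nil => exact refl _
  | cons f Θ ih => exact (dropFirst f _).trans ih

theorem copyAll (Θ : List (X → Str)) (hΓ : ∀ f ∈ Γ, f ∈ Θ) : Transforms Θ (Θ ++ Γ) := by
  induction Γ generalizing Θ with
  | nil => simpa using refl Θ
  | cons f Γ ih =>
    have h := ih (Θ ++ [f]) fun g hg => by simp [hΓ g (by simp [hg])]
    rw [List.append_assoc] at h
    exact (copyAppend (hΓ f (by simp))).trans h

theorem select (hΔ : ∀ f ∈ Δ, f ∈ Γ) : Transforms Γ Δ := (copyAll Γ hΔ).trans (drop Γ Δ)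

/-- The inputs are copied before each of the two programs, since a program consumes the registers it
reads. Each works on its own copy above the data already produced. -/
theorem append (h₁ : Transforms Γ Δ) (h₂ : Transforms Γ Θ) : Transforms Γ (Δ ++ Θ) := by
  have a : Transforms Γ (Γ ++ Δ) := (copyAll Γ (Γ := Γ) fun _ => id).trans (h₁.frame Γ)
  have b : Transforms (Γ ++ Δ) ((Γ ++ Δ) ++ Θ) :=
    (copyAll (Γ ++ Δ) (Γ := Γ) fun f hf => by simp [hf]).trans (h₂.frame (Γ ++ Δ))
  rw [List.append_assoc] at b
  exact (a.trans b).trans (drop _ _)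

theorem map {Y : Type} (h : Transforms Γ Δ) (φ : Y → X) :
    Transforms (Γ.map fun f y => f (φ y)) (Δ.map fun f y => f (φ y)) := by
  obtain ⟨p, τ, hτ, hp⟩ := h
  refine ⟨p, fun y => τ (φ y), ?_, fun y => ?_⟩
  · have : ctxSize (Γ.map fun f y => f (φ y)) = fun y => ctxSize Γ (φ y) := by
      funext y; exact ctxSize_map Γ φ y
    rw [this]
    exact hτ.comp φ
  · rw [store_map, store_map]
    exact hp (φ y)

end Transforms

/-! ## Polynomial-time functions of a context -/

/-- `f` is computable in polynomial time from the values of the functions in `Γ`. -/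
def Computes {X : Type} (Γ : List (X → Str)) (f : X → Str) : Prop := Transforms Γ [f]

theorem transforms_of_computes {X : Type} {Γ Δ : List (X → Str)} (h : ∀ f ∈ Δ, Computes Γ f) :
    Transforms Γ Δ := by
  induction Δ with
  | nil => exact .select (by simp)
  | cons f Δ ih => exact (h f (by simp)).append (ih fun g hg => h g (by simp [hg]))

theorem Transforms.computes {X : Type} {Γ Δ : List (X → Str)} (h : Transforms Γ Δ) {f : X → Str}
    (hf : f ∈ Δ) : Computes Γ f := h.trans (.select (by simpa using hf))

namespace Computes

variable {X : Type} {Γ Δ : List (X → Str)} {f g t e : X → Str}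

theorem of_mem (h : f ∈ Γ) : Computes Γ f := Transforms.select (by simpa using h)

/-- Because of this, each basic operation has to be programmed only for a context consisting of
exactly its arguments. -/
theorem subst (h : Computes Δ f) (hΔ : ∀ g ∈ Δ, Computes Γ g) : Computes Γ f :=
  (transforms_of_computes hΔ).trans h

theorem map {Y : Type} (h : Computes Γ f) (φ : Y → X) :
    Computes (Γ.map fun f y => f (φ y)) fun y => f (φ y) := Transforms.map h φ

theorem polyBounded (h : Computes Γ f) : PolyBounded (ctxSize Γ) fun x => (f x).length :=
  Transforms.polyBounded h (by simp)

theorem congr (h : Computes Γ f) (e : ∀ x, g x = f x) : Computes Γ g := (funext e : g = f) ▸ h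

theorem nil : Computes Γ fun _ => [] := by
  refine subst (Δ := []) ?_ (by simp)
  exact .of_run Prog.nop (.const 1) fun x => ⟨_, ⟨1, le_rfl, Run.nop _⟩, by simp⟩

theorem cons (b : Bool) (h : Computes Γ f) : Computes Γ fun x => b :: f x := by
  refine subst (Δ := [f]) ?_ (by simpa using h)
  refine .of_run (Prog.push 0 b) (.const 1) fun x => ⟨_, RunWithin.push 0 b _, fun r hr => ?_⟩
  obtain rfl : r = 0 := by simpa using hr
  simp

theorem tail (h : Computes Γ f) : Computes Γ fun x => (f x).tail := by
  refine subst (Δ := [f]) ?_ (by simpa using h)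
  refine .of_run (Prog.pop 0) (.const 1) fun x => ⟨_, RunWithin.pop 0 _, fun r hr => ?_⟩
  obtain rfl : r = 0 := by simpa using hr
  simp

theorem revAppend (hf : Computes Γ f) (hg : Computes Γ g) :
    Computes Γ fun x => (f x).reverse ++ g x := by
  refine subst (Δ := [g, f]) ?_ (by simp [hf, hg])
  refine .of_run (Prog.move 1 0) (τ := fun x => 4 * (f x).length + 1) ?_ fun x =>
    ⟨_, RunWithin.move (by simp) _, fun r hr => ?_⟩
  · refine (((PolyBounded.const 4).mul .self).add (.const 1)).mono fun x => ?_
    have := length_le_ctxSize (Γ := [g, f]) (f := f) (by simp) x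
    omega
  · obtain rfl : r = 0 := by simpa using hr
    simp [store]

/-- The value chosen by the first bit of a string. -/
def _root_.pick (t f g e : Str) : Str :=
  match t with
  | true :: _ => f
  | false :: _ => g
  | [] => e

/-- The arguments occupy registers 0 to 3. The branch on register 0 selects which of the others is
moved into register 0, by way of the free register 4; the remaining ones are left to the cleaning in
`Transforms.of_run`. -/
theorem pick (ht : Computes Γ t) (hf : Computes Γ f) (hg : Computes Γ g) (he : Computes Γ e) :
    Computes Γ fun x => pick (t x) (f x) (g x) (e x) := by
  have H : ∀ u : X → Str, ∀ s r : ℕ, s ≠ r → ∀ x : X, ∀ S : ℕ → Str, S 0 = [] → S 4 = [] →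
      S r = u x → r ≠ 0 → r ≠ 4 →
      ∃ s', RunWithin (Prog.seq (Prog.move r 4) (Prog.move 4 0)) S
        ((4 * (u x).length + 1) + (4 * (u x).length + 1)) s' ∧ s' 0 = u x := by
    intro u s r _ x S h0 h4 hr hr0 hr4
    have h₁ := RunWithin.move hr4 S
    have h₂ := RunWithin.move (show 4 ≠ 0 by simp) (Function.update (Function.update S r []) 4
      ((S r).reverse ++ S 4))
    rw [Function.update_self, h4, hr, List.append_nil, List.reverse_reverse] at h₂
    rw [h4, hr, List.append_nil] at h₁
    refine ⟨_, h₁.seq (h₂.mono (by simp)), ?_⟩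
    simp [h0, hr0.symm]
  refine subst (Δ := [t, f, g, e]) ?_ (by simp [hf, hg, ht, he])
  set T : X → ℕ := fun x => ctxSize [t, f, g, e] x
  have hT : ∀ u ∈ [t, f, g, e], ∀ x, (u x).length ≤ T x := fun u hu x => length_le_ctxSize hu x
  have key : ∀ x : X, ∀ u ∈ [t, f, g, e], ∀ r, r ≠ 0 → r ≠ 4 →
      store [t, f, g, e] x r = u x → ∃ s',
      RunWithin (Prog.seq (Prog.loop 0 (Prog.pop 0))
        (Prog.seq (Prog.move r 4) (Prog.move 4 0))) (store [t, f, g, e] x)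
        ((2 * T x + 1) + ((4 * T x + 1) + (4 * T x + 1))) s' ∧ s' 0 = u x := by
    intro x u hu r hr0 hr4 hr
    obtain ⟨s', hs', e⟩ := H u 0 r hr0.symm x (Function.update (store [t, f, g, e] x) 0 [])
      (by simp) (by simp [store]) (by rw [Function.update_of_ne hr0, hr]) hr0 hr4
    have h₁ := hT t (by simp) x
    have h₂ := hT u hu x
    refine ⟨s', ((RunWithin.clear 0 _).mono ?_).seq (hs'.mono (by omega)), e⟩
    simp only [store_cons_zero]; omega
  refine .of_run (Prog.branch 0
    (Prog.seq (Prog.loop 0 (Prog.pop 0)) (Prog.seq (Prog.move 1 4) (Prog.move 4 0)))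
    (Prog.seq (Prog.loop 0 (Prog.pop 0)) (Prog.seq (Prog.move 2 4) (Prog.move 4 0)))
    (Prog.seq (Prog.loop 0 (Prog.pop 0)) (Prog.seq (Prog.move 3 4) (Prog.move 4 0))))
    (τ := fun x => ((2 * T x + 1) + ((4 * T x + 1) + (4 * T x + 1))) + 1) ?_ fun x => ?_
  · have h4 : PolyBounded (ctxSize [t, f, g, e]) fun x => 4 * T x + 1 :=
      ((PolyBounded.const 4).mul .self).add (.const 1)
    exact ((((PolyBounded.const 2).mul .self).add (.const 1)).add (h4.add h4)).add (.const 1)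
  · match ht : t x with
    | true :: _ =>
      obtain ⟨s', ⟨n, hn, hs'⟩, e⟩ := key x f (by simp) 1 (by simp) (by simp) rfl
      refine ⟨s', ⟨n + 1, by omega, Run.branchTrue (by simp [ht]) hs'⟩, fun r hr => ?_⟩
      obtain rfl : r = 0 := by simpa using hr
      simp [e, ht, _root_.pick]
    | false :: _ =>
      obtain ⟨s', ⟨n, hn, hs'⟩, e⟩ := key x g (by simp) 2 (by simp) (by simp) rfl
      refine ⟨s', ⟨n + 1, by omega, Run.branchFalse (by simp [ht]) hs'⟩, fun r hr => ?_⟩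
      obtain rfl : r = 0 := by simpa using hr
      simp [e, ht, _root_.pick]
    | [] =>
      obtain ⟨s', ⟨n, hn, hs'⟩, e⟩ := key x e (by simp) 3 (by simp) (by simp) rfl
      refine ⟨s', ⟨n + 1, by omega, Run.branchEmpty (by simp [ht]) hs'⟩, fun r hr => ?_⟩
      obtain rfl : r = 0 := by simpa using hr
      simp [e, ht, _root_.pick]

end Computes

/-- The functions in `Γ`, in the `t`-th pass of a loop with `N x` passes. -/
abbrev inLoop {X : Type} (N : X → ℕ) (Γ : List (X → Str)) :
    List ({q : ℕ × X // q.1 < N q.2} → Str) :=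
  Γ.map fun f q => f q.1.2

/-- Iteration of a polynomial-time step, with a state of polynomially bounded length. -/
theorem Transforms.iterate {X : Type} {Γ : List (X → Str)} {n : X → Str}
    {S : List (ℕ → X → Str)} {B : X → ℕ}
    (hB : PolyBounded (ctxSize Γ) B)
    (hS : ∀ f ∈ S, ∀ x, ∀ t ≤ (n x).length, (f t x).length ≤ B x)
    (hn : Computes Γ n) (hinit : ∀ f ∈ S, Computes Γ (f 0))
    (hstep : ∀ f ∈ S, Computes
      ((S.map fun f (q : {q : ℕ × X // q.1 < (n q.2).length}) => f q.1.1 q.1.2) ++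
        inLoop (fun x => (n x).length) Γ) fun q => f (q.1.1 + 1) q.1.2) :
    ∀ f ∈ S, Computes Γ fun x => f (n x).length x := by
  set Y := {q : ℕ × X // q.1 < (n q.2).length}
  have step : Transforms
      ((S.map fun f (q : Y) => f q.1.1 q.1.2) ++ inLoop (fun x => (n x).length) Γ)
      ((S.map fun f (q : Y) => f (q.1.1 + 1) q.1.2) ++ inLoop (fun x => (n x).length) Γ) := by
    refine transforms_of_computes fun g hg => ?_
    rw [List.mem_append] at hg
    rcases hg with hg | hg
    · obtain ⟨f, hf, rfl⟩ := List.mem_map.1 hg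
      exact hstep f hf
    · exact .of_mem (by simp only [List.mem_append]; exact Or.inr hg)
  obtain ⟨p, τ, ⟨T, hT⟩, hp⟩ := step
  -- A time bound for one pass that is uniform in `t`. This is where the a priori bound `B` on the
  -- state is indispensable: a polynomial-time step may double its state, and iterating it could
  -- then take exponential time.
  set C : X → ℕ := fun x => T.eval (S.length * B x + ctxSize Γ x)
  have hC : PolyBounded (ctxSize Γ) C := by
    have : PolyBounded (fun x => S.length * B x + ctxSize Γ x) C := ⟨T, fun x => le_rfl⟩
    exact this.trans (((PolyBounded.const _).mul hB).add .self)
  have hτ : ∀ q : Y, τ q ≤ C q.1.2 := fun q => by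
    refine (hT q).trans (T.eval_nat_mono ?_)
    rw [ctxSize_append, ctxSize_map Γ (fun q : Y => q.1.2) q]
    refine Nat.add_le_add_right ?_ _
    have h := ctxSize_le (S.map fun f (q : Y) => f q.1.1 q.1.2) q (M := B q.1.2) fun g hg => by
      obtain ⟨f, hf, rfl⟩ := List.mem_map.1 hg
      exact hS f hf _ _ q.2.le
    simpa using h
  -- Induction on the number `d` of passes still to be made. Register 0 holds the unread rest of `n
  -- x` and serves only as a counter.
  have main : ∀ x, ∀ d ≤ (n x).length, RunWithin (Prog.loop 0 (Prog.seq (Prog.pop 0) (p.shift 1)))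
      (store ((fun x => (n x).drop ((n x).length - d)) ::
        ((S.map fun f => f ((n x).length - d)) ++ Γ)) x) (d * (C x + 2) + 1)
      (store ((fun _ => []) :: ((S.map fun f => f (n x).length) ++ Γ)) x) := by
    intro x d
    induction d with
    | zero =>
      intro _
      have e : store ((fun x => (n x).drop ((n x).length - 0)) ::
          ((S.map fun f => f ((n x).length - 0)) ++ Γ)) x =
          store ((fun _ => []) :: ((S.map fun f => f (n x).length) ++ Γ)) x := by
        funext r
        cases r with
        | zero => simp
        | succ r => simp
      rw [e]
      exact (RunWithin.loopDone rfl).mono (by omega)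
    | succ d ih =>
      intro hd
      set t := (n x).length - (d + 1) with ht
      have ht1 : (n x).length - d = t + 1 := by omega
      have hlt : t < (n x).length := by omega
      obtain ⟨u, hu, hrun⟩ := hp ⟨(t, x), hlt⟩
      have e₀ : store ((S.map fun f (q : Y) => f q.1.1 q.1.2) ++
          inLoop (fun x => (n x).length) Γ) ⟨(t, x), hlt⟩ =
          store ((S.map fun f => f t) ++ Γ) x := by
        -- The two contexts live on different index types; pulled back to a single point, they
        -- become the same list of functions on `Unit`.
        rw [← store_map ((S.map fun f => f t) ++ Γ) (fun _ : Unit => x) (),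
          ← store_map _ (fun _ : Unit => (⟨(t, x), hlt⟩ : Y)) ()]
        simp [inLoop, Function.comp_def]
      have e₁ : store ((S.map fun f (q : Y) => f (q.1.1 + 1) q.1.2) ++
          inLoop (fun x => (n x).length) Γ) ⟨(t, x), hlt⟩ =
          store ((S.map fun f => f (t + 1)) ++ Γ) x := by
        rw [← store_map ((S.map fun f => f (t + 1)) ++ Γ) (fun _ : Unit => x) (),
          ← store_map _ (fun _ : Unit => (⟨(t, x), hlt⟩ : Y)) ()]
        simp [inLoop, Function.comp_def]
      rw [e₀, e₁] at hrun
      -- The counter occupies register 0, so the body is executed one register higher.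
      obtain ⟨s', hs', h₁, h₂⟩ := hrun.shift 1 (Function.update
        (store ((fun x => (n x).drop t) :: ((S.map fun f => f t) ++ Γ)) x) 0
        ((n x).drop t).tail) fun r => by
          rw [Function.update_of_ne (by omega)]; rfl
      have e₂ : s' = store ((fun x => (n x).drop (t + 1)) ::
          ((S.map fun f => f (t + 1)) ++ Γ)) x := by
        funext r
        cases r with
        | zero => rw [h₂ 0 one_pos, Function.update_self]; simp
        | succ r => exact h₁ r
      have hI := ih (by omega)
      have e₃ : store ((fun x => (n x).drop ((n x).length - d)) ::
          ((S.map fun f => f ((n x).length - d)) ++ Γ)) x = s' := by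
        rw [e₂]
        funext r
        cases r with
        | zero => simp only [store_cons_zero]; rw [ht1]
        | succ r => simp only [store_cons_succ]; rw [ht1]
      have e₄ : store ((fun x => (n x).drop ((n x).length - (d + 1))) ::
          ((S.map fun f => f t) ++ Γ)) x =
          store ((fun x => (n x).drop t) :: ((S.map fun f => f t) ++ Γ)) x := by
        funext r
        cases r with
        | zero => rfl
        | succ r => rfl
      rw [e₃] at hI
      rw [e₄]
      refine (RunWithin.loopStep ?_ ((RunWithin.pop 0 _).seq ⟨u, hu, hs'⟩) hI).mono ?_
      · rw [store_cons_zero]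
        intro h
        rw [List.drop_eq_nil_iff] at h
        omega
      · have := hτ ⟨(t, x), hlt⟩
        simp only at this
        rw [Nat.add_one_mul]; omega
  have init : Transforms Γ (n :: ((S.map fun f => f 0) ++ Γ)) := by
    refine transforms_of_computes fun g hg => ?_
    simp only [List.mem_cons, List.mem_append, List.mem_map] at hg
    rcases hg with rfl | ⟨f, hf, rfl⟩ | hg
    · exact hn
    · exact hinit f hf
    · exact .of_mem hg
  have loop : Transforms (n :: ((S.map fun f => f 0) ++ Γ))
      ((fun _ => []) :: ((S.map fun f x => f (n x).length x) ++ Γ)) := by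
    refine ⟨Prog.loop 0 (Prog.seq (Prog.pop 0) (p.shift 1)),
      fun x => (n x).length * (C x + 2) + 1, ?_, fun x => ?_⟩
    · refine PolyBounded.add (.mul ?_ (.add (hC.trans ?_) (.const 2))) (.const 1)
      · exact PolyBounded.self.mono fun x => length_le_ctxSize (by simp) x
      · refine PolyBounded.self.mono fun x => ?_
        rw [← List.cons_append, ctxSize_append]
        exact Nat.le_add_left _ _
    · have h := main x (n x).length le_rfl
      have e₁ : store ((fun y => (n y).drop ((n y).length - (n x).length)) ::
          ((S.map fun f => f ((n x).length - (n x).length)) ++ Γ)) x =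
          store (n :: ((S.map fun f => f 0) ++ Γ)) x := by
        funext r
        cases r with
        | zero => simp
        | succ r => simp
      have e₂ : store ((fun _ => []) :: ((S.map fun f => f (n x).length) ++ Γ)) x =
          store ((fun _ => []) :: ((S.map fun f x => f (n x).length x) ++ Γ)) x := by
        rw [← store_map ((fun _ => []) :: ((S.map fun f => f (n x).length) ++ Γ))
            (fun _ : Unit => x) (), ← store_map ((fun _ => []) ::
              ((S.map fun f x => f (n x).length x) ++ Γ)) (fun _ : Unit => x) ()]
        simp [Function.comp_def]
      rw [e₁, e₂] at h
      exact h
  intro f hf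
  refine (init.trans loop).computes ?_
  simp only [List.mem_cons, List.mem_append, List.mem_map]
  exact Or.inr (Or.inl ⟨f, hf, rfl⟩)

/-! ## Polynomial-time string functions -/

@[simp] theorem length_unary (n : ℕ) : (unary n).length = n := List.length_replicate

theorem unary_add (m n : ℕ) : unary (m + n) = unary m ++ unary n := List.replicate_add ..

namespace Computes

variable {X : Type} {Γ : List (X → Str)} {f g n t e : X → Str}

theorem weaken_append (h : Computes Γ f) (Δ : List (X → Str)) : Computes (Δ ++ Γ) f :=
  h.subst fun _ hg => .of_mem (by simp [hg])

/-- Iteration of a polynomial-time step with several state variables, whose lengths stay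
polynomially bounded. -/
theorem iterateList {N : X → ℕ} {S : List (ℕ → X → Str)} {B : X → ℕ} (hn : Computes Γ n)
    (hN : ∀ x, (n x).length = N x) (hB : PolyBounded (ctxSize Γ) B)
    (hS : ∀ s ∈ S, ∀ x, ∀ t ≤ N x, (s t x).length ≤ B x)
    (hinit : ∀ s ∈ S, Computes Γ (s 0))
    (hstep : ∀ Δ : List ({q : ℕ × X // q.1 < N q.2} → Str),
      (∀ s ∈ S, Computes Δ fun q => s q.1.1 q.1.2) →
      (∀ g, Computes Γ g → Computes Δ fun q => g q.1.2) →
      ∀ s ∈ S, Computes Δ fun q => s (q.1.1 + 1) q.1.2) :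
    ∀ s ∈ S, Computes Γ fun x => s (N x) x := by
  obtain rfl : (fun x => (n x).length) = N := funext hN
  refine Transforms.iterate hB hS hn hinit (hstep _ (fun s hs => .of_mem ?_) fun g hg => ?_)
  · rw [List.mem_append, List.mem_map]; exact Or.inl ⟨s, hs, rfl⟩
  · exact (hg.map fun q : {q : ℕ × X // q.1 < (n q.2).length} => q.1.2).weaken_append _

theorem iterate {N : X → ℕ} {s : ℕ → X → Str} {B : X → ℕ} (hn : Computes Γ n)
    (hN : ∀ x, (n x).length = N x) (hB : PolyBounded (ctxSize Γ) B)
    (hs : ∀ x, ∀ t ≤ N x, (s t x).length ≤ B x) (hinit : Computes Γ (s 0))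
    (hstep : ∀ Δ : List ({q : ℕ × X // q.1 < N q.2} → Str),
      (Computes Δ fun q => s q.1.1 q.1.2) →
      (∀ g, Computes Γ g → Computes Δ fun q => g q.1.2) →
      Computes Δ fun q => s (q.1.1 + 1) q.1.2) :
    Computes Γ fun x => s (N x) x :=
  iterateList (S := [s]) hn hN hB (by simpa using hs) (by simpa using hinit)
    (by simpa using hstep) s (by simp)

theorem const (w : Str) : Computes Γ fun _ => w := by
  induction w with
  | nil => exact nil
  | cons b w ih => exact ih.cons b

theorem reverse (hf : Computes Γ f) : Computes Γ fun x => (f x).reverse :=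
  (hf.revAppend nil).congr fun x => by simp

theorem append (hf : Computes Γ f) (hg : Computes Γ g) : Computes Γ fun x => f x ++ g x :=
  (hf.reverse.revAppend hg).congr fun x => by simp

theorem dropLength (hn : Computes Γ n) (hf : Computes Γ f) :
    Computes Γ fun x => (f x).drop (n x).length :=
  iterate (s := fun t x => (f x).drop t) hn (fun _ => rfl) hf.polyBounded (fun x t _ => by simp)
    (hf.congr fun x => by simp) fun _ h _ => h.tail.congr fun q => by simp

/-- Taking a prefix is dropping from the reversed string. The number of bits to be dropped is
available in unary as the length of what remains of `f` after dropping the prefix. -/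
theorem takeLength (hn : Computes Γ n) (hf : Computes Γ f) :
    Computes Γ fun x => (f x).take (n x).length :=
  (dropLength (dropLength hn hf) hf.reverse).reverse.congr fun x => by
    rw [List.drop_reverse, List.reverse_reverse, List.length_drop]
    rcases le_total (n x).length (f x).length with h | h
    · rw [Nat.sub_sub_self h]
    · rw [Nat.sub_eq_zero_of_le h, Nat.sub_zero, List.take_of_length_le h, List.take_length]

theorem unaryLength (hf : Computes Γ f) : Computes Γ fun x => unary (f x).length :=
  iterate (s := fun t _ => unary t) hf (fun _ => rfl) hf.polyBounded (fun x t ht => by simpa using ht)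
    (const (unary 0)) fun _ h _ => (h.cons true).congr fun q => rfl

variable {a b : X → ℕ}

theorem unaryAdd (ha : Computes Γ fun x => unary (a x)) (hb : Computes Γ fun x => unary (b x)) :
    Computes Γ fun x => unary (a x + b x) := (ha.append hb).congr fun _ => unary_add _ _

theorem unaryMul (ha : Computes Γ fun x => unary (a x)) (hb : Computes Γ fun x => unary (b x)) :
    Computes Γ fun x => unary (a x * b x) :=
  iterate (s := fun t x => unary (t * b x)) ha (fun x => length_unary _)
    (ha.polyBounded.mul hb.polyBounded)
    (fun x t ht => by simpa using Nat.mul_le_mul_right _ ht)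
    ((const []).congr fun x => by simp [unary])
    fun _ h hΓ => (h.append (hΓ _ hb)).congr fun q => by rw [← unary_add, Nat.add_one_mul]

theorem drop (ha : Computes Γ fun x => unary (a x)) (hf : Computes Γ f) :
    Computes Γ fun x => (f x).drop (a x) :=
  (dropLength ha hf).congr fun x => by rw [length_unary]

theorem take (ha : Computes Γ fun x => unary (a x)) (hf : Computes Γ f) :
    Computes Γ fun x => (f x).take (a x) :=
  (takeLength ha hf).congr fun x => by rw [length_unary]

theorem zeros (ha : Computes Γ fun x => unary (a x)) :
    Computes Γ fun x => List.replicate (a x) false :=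
  iterate (s := fun t _ => List.replicate t false) ha (fun x => length_unary _) ha.polyBounded
    (fun x t ht => by simpa using ht) (const []) fun _ h _ => (h.cons false).congr fun q => rfl

theorem bool_ite {p : X → Bool} (hp : Computes Γ fun x => [p x]) (hf : Computes Γ f)
    (hg : Computes Γ g) : Computes Γ fun x => bif p x then f x else g x :=
  (hp.pick hf hg hg).congr fun x => by cases p x <;> rfl

theorem ite {p : X → Prop} [∀ x, Decidable (p x)] (hp : Computes Γ fun x => [decide (p x)])
    (hf : Computes Γ f) (hg : Computes Γ g) : Computes Γ fun x => if p x then f x else g x :=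
  (hp.bool_ite hf hg).congr fun x => by by_cases h : p x <;> simp [h]

theorem not {p : X → Bool} (hp : Computes Γ fun x => [p x]) : Computes Γ fun x => [!p x] :=
  (hp.bool_ite (const [false]) (const [true])).congr fun x => by cases p x <;> rfl

theorem and {p q : X → Bool} (hp : Computes Γ fun x => [p x]) (hq : Computes Γ fun x => [q x]) :
    Computes Γ fun x => [p x && q x] :=
  (hp.bool_ite hq (const [false])).congr fun x => by cases p x <;> rfl

theorem or {p q : X → Bool} (hp : Computes Γ fun x => [p x]) (hq : Computes Γ fun x => [q x]) :
    Computes Γ fun x => [p x || q x] :=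
  (hp.bool_ite (const [true]) hq).congr fun x => by cases p x <;> rfl

theorem take_one (hf : Computes Γ f) : Computes Γ fun x => (f x).take 1 :=
  (hf.pick (const [true]) (const [false]) (const [])).congr fun x => by
    match h : f x with
    | true :: _ => simp [_root_.pick]
    | false :: _ => simp [_root_.pick]
    | [] => simp [_root_.pick]

theorem take_one_eq (hf : Computes Γ f) (hg : Computes Γ g) :
    Computes Γ fun x => [decide ((f x).take 1 = (g x).take 1)] :=
  (hf.pick (hg.pick (const [true]) (const [false]) (const [false]))
    (hg.pick (const [false]) (const [true]) (const [false]))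
    (hg.pick (const [false]) (const [false]) (const [true]))).congr fun x => by
      rcases f x with _ | ⟨_ | _, l⟩ <;> rcases g x with _ | ⟨_ | _, l'⟩ <;>
        simp [_root_.pick]

/-- Both strings are consumed bit by bit, with a flag recording whether the prefixes read so far
agree. Comparing `take 1` of the remainders also detects that one string has ended before the other.
-/
theorem eq (hf : Computes Γ f) (hg : Computes Γ g) : Computes Γ fun x => [decide (f x = g x)] := by
  have key : ∀ (l l' : Str) (t : ℕ), decide (l.take (t + 1) = l'.take (t + 1)) =
      (decide (l.take t = l'.take t) && decide ((l.drop t).take 1 = (l'.drop t).take 1)) := by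
    intro l l' t
    rw [Bool.eq_iff_iff, Bool.and_eq_true, decide_eq_true_iff, decide_eq_true_iff,
      decide_eq_true_iff]
    induction t generalizing l l' with
    | zero => simp
    | succ t ih =>
      rcases l with _ | ⟨b, l⟩ <;> rcases l' with _ | ⟨b', l'⟩
      · simp
      · simp
      · simp
      · simp only [List.take_succ_cons, List.drop_succ_cons, List.cons.injEq]
        have := ih l l'
        rw [this, and_assoc]
  -- One pass more than the length of `f`, so that a longer `g` with prefix `f` is rejected.
  have h := iterateList (Γ := Γ) (n := fun x => true :: f x) (N := fun x => (f x).length + 1)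
    (S := [fun t x => (f x).drop t, fun t x => (g x).drop t,
      fun t x => [decide ((f x).take t = (g x).take t)]])
    (B := fun x => (f x).length + (g x).length + 1) (hf.cons true) (fun _ => rfl)
    ((hf.polyBounded.add hg.polyBounded).add (.const 1))
    (by
      intro s hs x t _
      simp only [List.mem_cons, List.not_mem_nil, or_false] at hs
      rcases hs with rfl | rfl | rfl <;> simp <;> omega)
    (by simpa using ⟨hf, hg, const [true]⟩)
    (by
      intro Δ hΔ _
      simp only [List.mem_cons, List.not_mem_nil, or_false, forall_eq_or_imp, forall_eq] at hΔ ⊢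
      obtain ⟨h₁, h₂, h₃⟩ := hΔ
      exact ⟨h₁.tail.congr fun q => by simp, h₂.tail.congr fun q => by simp,
        (h₃.and (take_one_eq h₁ h₂)).congr fun q => by rw [key]⟩)
    (fun t x => [decide ((f x).take t = (g x).take t)]) (by simp)
  refine h.congr fun x => ?_
  simp only [List.cons.injEq, and_true, decide_eq_decide]
  rw [List.take_of_length_le (Nat.le_succ _)]
  refine ⟨fun h => ?_, fun h => ?_⟩
  · rw [← h, List.take_of_length_le (Nat.le_succ _)]
  · have hl : (f x).length = min ((f x).length + 1) (g x).length := by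
      conv_lhs => rw [h]
      simp
    rw [h, List.take_of_length_le (by omega)]

theorem length_eq (ha : Computes Γ fun x => unary (a x)) (hf : Computes Γ f) :
    Computes Γ fun x => [decide ((f x).length = a x)] :=
  (hf.unaryLength.eq ha).congr fun x => by
    simp [unary, List.replicate_inj]

theorem optionSome (hf : Computes Γ f) : Computes Γ fun x => encOption (some (f x)) := hf.cons true

theorem encDelim (hf : Computes Γ f) : Computes Γ fun x => encDelim (f x) := by
  have h := iterateList (Γ := Γ) (n := f) (N := fun x => (f x).length)
    (S := [fun t x => (f x).drop t, fun t x => ((f x).take t).flatMap fun b => [true, b]])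
    (B := fun x => 2 * (f x).length) hf (fun _ => rfl) (.mul (.const 2) hf.polyBounded)
    (by
      intro s hs x t _
      simp only [List.mem_cons, List.not_mem_nil, or_false] at hs
      rcases hs with rfl | rfl
      · simp only [List.length_drop]; omega
      · simp only [List.length_flatMap, List.length_cons, List.length_nil, List.map_const',
          List.sum_replicate, List.length_take, smul_eq_mul]
        omega)
    (by simpa using ⟨hf, nil⟩)
    (by
      intro Δ hΔ _
      simp only [List.mem_cons, List.not_mem_nil, or_false, forall_eq_or_imp, forall_eq] at hΔ ⊢
      refine ⟨hΔ.1.tail.congr fun q => by simp,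
        (hΔ.2.append (hΔ.1.take_one.cons true)).congr fun q => ?_⟩
      rw [List.take_add_one, List.flatMap_append, List.getElem?_eq_getElem q.2,
        List.drop_eq_getElem_cons q.2, List.take_succ_cons, List.take_zero]
      simp)
    (fun t x => ((f x).take t).flatMap fun b => [true, b]) (by simp)
  exact (h.append (const [false])).congr fun x => by simp [_root_.encDelim]

end Computes

/-! ## Polynomial-time families -/

theorem store_ofFn {X : Type} {a : ℕ} (args : Fin a → X → Str) (x : X) :
    store (List.ofFn args) x = startStore fun r => args r x := by
  induction a with
  | zero => funext r; simp [startStore]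
  | succ a ih =>
    rw [List.ofFn_succ]
    funext r
    cases r with
    | zero => simp [startStore]
    | succ r =>
      rw [store_cons_succ, ih]
      simp [startStore]

theorem ctxSize_ofFn {X : Type} {a : ℕ} (args : Fin a → X → Str) (x : X) :
    ctxSize (List.ofFn args) x = ∑ r, (args r x).length := by
  simp [ctxSize, List.map_ofFn, List.sum_ofFn]

theorem PolyTime.computes {X : Type} {Γ : List (X → Str)} {a b : ℕ}
    {f : (Fin a → Str) → Fin b → Str} (hf : PolyTime f) {args : Fin a → X → Str}
    (h : ∀ r, Computes Γ (args r)) (o : Fin b) : Computes Γ fun x => f (fun r => args r x) o := by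
  obtain ⟨p, T, hp⟩ := hf
  have key : Transforms (List.ofFn args) (List.ofFn fun o x => f (fun r => args r x) o) := by
    refine .of_run p (τ := fun x => T.eval (∑ r, (args r x).length))
      ⟨T, fun x => by rw [ctxSize_ofFn]⟩ fun x => ?_
    obtain ⟨t, s, hr, ht, ho⟩ := hp fun r => args r x
    rw [store_ofFn]
    refine ⟨s, ⟨t, ht, hr⟩, fun r hr => ?_⟩
    rw [List.length_ofFn] at hr
    rw [store_ofFn, startStore, dif_pos hr]
    exact ho ⟨r, hr⟩
  refine (key.computes (f := fun x => f (fun r => args r x) o) ?_).subst ?_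
  · rw [List.mem_ofFn]; exact ⟨o, rfl⟩
  · intro g hg
    obtain ⟨r, rfl⟩ := List.mem_ofFn.1 hg
    exact h r

theorem PolyTimeFamily.computes {X : Type} {Γ : List (X → Str)} {a b : ℕ}
    {g : ℕ → (Fin a → Str) → Fin b → Str} (hg : PolyTimeFamily g) {κ : X → ℕ}
    (hκ : Computes Γ fun x => unary (κ x)) {args : X → Fin a → Str}
    (h : ∀ r, Computes Γ fun x => args x r) (o : Fin b) : Computes Γ fun x => g (κ x) (args x) o := by
  obtain ⟨f, hf, hfg⟩ := hg
  refine (hf.computes (Γ := Γ)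
    (args := fun r x => Matrix.vecCons (unary (κ x)) (args x) r) (fun r => ?_) o).congr fun x => ?_
  · refine Fin.cases ?_ (fun r => ?_) r
    · exact hκ
    · exact h r
  · rw [hfg]

theorem PolyLength.computes {X : Type} {Γ : List (X → Str)} {n : ℕ → ℕ} (hn : PolyLength n)
    {κ : X → ℕ} (hκ : Computes Γ fun x => unary (κ x)) : Computes Γ fun x => unary (n (κ x)) :=
  PolyTimeFamily.computes hn hκ (args := fun _ => ![]) (fun r => r.elim0) 0

/-- The inputs of a polynomial-time family. -/
def familyInputs (a : ℕ) : List (ℕ × (Fin a → Str) → Str) :=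
  (fun q => unary q.1) :: List.ofFn fun r q => q.2 r

theorem computes_familyInputs_unary (a : ℕ) : Computes (familyInputs a) fun q => unary q.1 :=
  .of_mem (by simp [familyInputs])

theorem computes_familyInputs {a : ℕ} (r : Fin a) : Computes (familyInputs a) fun q => q.2 r :=
  .of_mem (by simp only [familyInputs, List.mem_cons, List.mem_ofFn]; exact Or.inr ⟨r, rfl⟩)

/-- A family requires a program on all inputs, including those whose first string is not of the form
`1^κ`. The security parameter is taken to be the length of that string, and its unary form can be
recomputed from it. -/
theorem polyTimeFamily_of_computes {a b : ℕ} {g : ℕ → (Fin a → Str) → Fin b → Str}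
    (h : ∀ o, Computes (familyInputs a) fun q => g q.1 q.2 o) : PolyTimeFamily g := by
  set φ : (Fin (a + 1) → Str) → ℕ × (Fin a → Str) := fun z => ((z 0).length, fun r => z r.succ)
  refine ⟨fun z => g (φ z).1 (φ z).2, ?_, fun κ x => by simp [φ]⟩
  have key : Transforms (List.ofFn fun (r : Fin (a + 1)) (z : Fin (a + 1) → Str) => z r)
      (List.ofFn fun o z => g (φ z).1 (φ z).2 o) := by
    refine transforms_of_computes fun f hf => ?_
    obtain ⟨o, rfl⟩ := List.mem_ofFn.1 hf
    have hm : ∀ r, Computes (List.ofFn fun (r : Fin (a + 1)) (z : Fin (a + 1) → Str) => z r)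
        fun z => z r := fun r => .of_mem (List.mem_ofFn.2 ⟨r, rfl⟩)
    refine ((h o).map φ).subst fun f hf => ?_
    obtain ⟨f', hf', rfl⟩ := List.mem_map.1 hf
    simp only [familyInputs, List.mem_cons, List.mem_ofFn] at hf'
    rcases hf' with rfl | ⟨r, rfl⟩
    · exact (hm 0).unaryLength
    · exact hm r.succ
  obtain ⟨p, τ, ⟨T, hT⟩, hp⟩ := key
  refine ⟨p, T, fun z => ?_⟩
  obtain ⟨t, ht, hr⟩ := hp z
  rw [store_ofFn] at hr
  refine ⟨t, _, hr, ?_, fun o => ?_⟩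
  · have := hT z
    rw [ctxSize_ofFn] at this
    exact ht.trans this
  · rw [store_ofFn, startStore, dif_pos o.2]

/-! ## Executions round by round -/

namespace JmpParams

variable (P : JmpParams) (c : Option Server) (v : Batch P.m P.ℓ) (adv : List RoundView → Packet)

/-- The first `T` rounds of an execution of the protocol. -/
abbrev run (T : ℕ) : List Round := execution c (P.packet v) adv T

/-- The packets of round `t`. -/
def roundAt (t : ℕ) : Round := fun p =>
  if some p = c then adv (advView c (P.run c v adv (t + 1)))
  else P.packet v p ((P.run c v adv t).map (see (some p)))

theorem advView_append (c : Option Server) (h₁ h₂ : List Round) :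
    advView c (h₁ ++ h₂) = advView c h₁ ++ advView c h₂ := List.map_append

/-- The definition of `roundAt` looks circular for the corrupt server, since it refers to the view
of the round being defined. `advView` blanks the corrupt server's own packet, so that view equals
the one of the honest packets alone, which is what a rushing adversary sees. -/
theorem run_succ (T : ℕ) : P.run c v adv (T + 1) = P.run c v adv T ++ [P.roundAt c v adv T] := by
  have h : advView c (P.run c v adv (T + 1)) = advView c (P.run c v adv T ++
      [fun p => P.packet v p ((P.run c v adv T).map (see (some p)))]) := by
    change advView c (P.run c v adv T ++ [_]) = _
    rw [advView_append, advView_append]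
    congr 1
    simp only [advView, List.map_cons, List.map_nil, List.cons.injEq, and_true]
    congr 1
    funext p
    split_ifs <;> rfl
  unfold roundAt
  rw [h]
  rfl

theorem length_run (T : ℕ) : (P.run c v adv T).length = T := by
  induction T with
  | zero => rfl
  | succ T ih => rw [run_succ, List.length_append, ih]; rfl

theorem run_getElem? {r T : ℕ} (h : r < T) :
    (P.run c v adv T)[r]? = some (P.roundAt c v adv r) := by
  induction T with
  | zero => omega
  | succ T ih =>
    rw [run_succ]
    rcases Nat.lt_succ_iff_lt_or_eq.1 h with h | rfl
    · rw [List.getElem?_append_left (by rwa [length_run]), ih h]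
    · rw [List.getElem?_append_right (by rw [length_run]), length_run]
      simp

/-- The view of an observer after `T` rounds. -/
abbrev viewAt (o : Option Server) (T : ℕ) : List RoundView := (P.run c v adv T).map (see o)

theorem length_viewAt (o : Option Server) (T : ℕ) : (P.viewAt c v adv o T).length = T := by
  rw [List.length_map, length_run]

variable {c v adv}

theorem seenAt_viewAt {o : Option Server} {r T : ℕ} (h : r < T) (p : Server) :
    seenAt (P.viewAt c v adv o T) r p = see o (P.roundAt c v adv r) p := by
  simp [seenAt, List.getD_eq_getElem?_getD, List.getElem?_map, P.run_getElem? c v adv h]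

theorem roundAt_honest {s : Server} (hs : some s ≠ c) (t : ℕ) :
    P.roundAt c v adv t s = P.packet v s (P.viewAt c v adv (some s) t) := if_neg hs

variable (c v adv)

/-- The bit encoded by a private message. -/
def bitOf : Option Str → Option Bool
  | some [b] => some b
  | _ => none

/-- The TTP that results from accusations of `P_i` resp. `P_j` by `P_k`, or of `P_k` by these. -/
def ttpOfPair (x y : Bool) : Option Server :=
  match x, y with
  | true, true => some P.i
  | true, false => some P.j
  | false, true => some P.i
  | false, false => none

/-- The TTP determined by round `m`. -/
def ttp₁ : Option Server :=
  P.ttpOfPair ((P.roundAt c v adv P.m P.k).accuse P.i) ((P.roundAt c v adv P.m P.k).accuse P.j)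

/-- The TTP determined by round `m + 1`. -/
def ttp₂ : Option Server :=
  P.ttpOfPair ((P.roundAt c v adv (P.m + 1) P.i).accuse P.k)
    ((P.roundAt c v adv (P.m + 1) P.j).accuse P.k)

/-- The TTP determined by the accusations of round `m + 2`. -/
def ttp₃ : Option Server :=
  if (P.roundAt c v adv (P.m + 2) P.i).accuse P.j || (P.roundAt c v adv (P.m + 2) P.j).accuse P.i
  then some P.k else none

/-- The digest broadcast by a server in round `m + 2`. -/
def digest (p : Server) : Option (List.Vector Bool P.n) :=
  (P.roundAt c v adv (P.m + 2) p).bcast.bind (ofLength P.n)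

/-- The TTP determined by three digests. -/
def ttpOfDigests {α : Type} [DecidableEq α] (x y z : Option α) : Option Server :=
  match x, y, z with
  | _, _, none => none
  | none, none, some _ => none
  | some _, none, some _ => some P.k
  | none, some _, some _ => some P.k
  | some x, some y, some z => if x ≠ y then some P.k else if x ≠ z then some P.j else some P.i

/-- The TTP determined by the digests of round `m + 2`. -/
def ttp₄ : Option Server :=
  P.ttpOfDigests (P.digest c v adv P.i) (P.digest c v adv P.j) (P.digest c v adv P.k)

/-- The TTP on which all honest servers decide. -/
def ttpAll : Option Server :=
  (((P.ttp₁ c v adv).or (P.ttp₂ c v adv)).or (P.ttp₃ c v adv)).or (P.ttp₄ c v adv)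

/-- The value received by `P_k`. -/
def received : Option (Batch P.m P.ℓ) := P.recvBatch (P.viewAt c v adv (some P.k) P.m)

/-- The digest received by `P_k`. -/
def receivedHash : Option (List.Vector Bool P.n) := P.recvHash (P.viewAt c v adv (some P.k) P.m)

variable {c v adv}

theorem ttpByReceiver_viewAt {o : Option Server} {T : ℕ} (h : P.m < T) :
    P.ttpByReceiver (P.viewAt c v adv o T) = P.ttp₁ c v adv := by
  unfold ttpByReceiver
  rw [P.seenAt_viewAt h]
  rfl

theorem ttpBySenders_viewAt {o : Option Server} {T : ℕ} (h : P.m + 1 < T) :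
    P.ttpBySenders (P.viewAt c v adv o T) = P.ttp₂ c v adv := by
  unfold ttpBySenders
  rw [P.seenAt_viewAt h, P.seenAt_viewAt h]
  rfl

theorem ttpEarly_viewAt {o : Option Server} {T : ℕ} (h : P.m + 1 < T) :
    P.ttpEarly (P.viewAt c v adv o T) = (P.ttp₁ c v adv).or (P.ttp₂ c v adv) := by
  rw [ttpEarly, P.ttpByReceiver_viewAt (by omega), P.ttpBySenders_viewAt h]

/-- Accusations and digests are broadcast, so the result does not depend on the observer `o`. This
is the agreement of the servers on the TTP. -/
theorem ttp_viewAt (o : Option Server) :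
    P.ttp (P.viewAt c v adv o P.rounds) = P.ttpAll c v adv := by
  have h : P.m + 2 < P.rounds := by unfold rounds; omega
  have hg : ∀ p, P.publicHash (P.viewAt c v adv o P.rounds) p = P.digest c v adv p := fun p => by
    unfold publicHash; rw [P.seenAt_viewAt h]; rfl
  unfold ttp
  rw [P.ttpEarly_viewAt (by omega), ttpByExchange, P.seenAt_viewAt h, P.seenAt_viewAt h,
    ttpByHashes, hg, hg, hg, ttpAll, ttp₃, ttp₄]
  congr 1
  cases P.digest c v adv P.i <;> cases P.digest c v adv P.j <;> cases P.digest c v adv P.k <;> rfl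

theorem recvValue_viewAt {o : Option Server} {t T : ℕ} (h : t < T) :
    P.recvValue (P.viewAt c v adv o T) t =
      (o.bind (P.roundAt c v adv t P.i).priv).bind (ofLength P.ℓ) := by
  rw [recvValue, P.seenAt_viewAt h]
  rfl

theorem recvBatch_congr {w w' : List RoundView}
    (h : ∀ t < P.m, P.recvValue w t = P.recvValue w' t) : P.recvBatch w = P.recvBatch w' := by
  unfold recvBatch
  by_cases hw : ∀ t : Fin P.m, (P.recvValue w t).isSome = true
  · have hw' : ∀ t : Fin P.m, (P.recvValue w' t).isSome = true := fun t => h t t.2 ▸ hw t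
    rw [dif_pos hw, dif_pos hw']
    congr 1
    funext t
    congr 1
    exact h t t.2
  · have hw' : ¬ ∀ t : Fin P.m, (P.recvValue w' t).isSome = true :=
      fun h' => hw fun t => (h t t.2).symm ▸ h' t
    rw [dif_neg hw, dif_neg hw']

theorem recvBatch_viewAt {T : ℕ} (h : P.m ≤ T) :
    P.recvBatch (P.viewAt c v adv (some P.k) T) = P.received c v adv :=
  P.recvBatch_congr fun t ht => by
    rw [P.recvValue_viewAt (ht.trans_le h), P.recvValue_viewAt ht]

/-- For `P.m = 0` the truncated index `P.m - 1` would point to round `0`, which lies after the send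
phases; hence the hypothesis `hm`. -/
theorem recvHash_viewAt {T : ℕ} (hm : 1 ≤ P.m) (h : P.m ≤ T) :
    P.recvHash (P.viewAt c v adv (some P.k) T) = P.receivedHash c v adv := by
  unfold receivedHash recvHash
  rw [P.seenAt_viewAt (by omega), P.seenAt_viewAt (by omega)]

theorem recvBit_viewAt {s p : Server} {r T : ℕ} (h : r < T) :
    recvBit (P.viewAt c v adv (some s) T) r p = bitOf ((P.roundAt c v adv r p).priv s) := by
  unfold recvBit
  rw [P.seenAt_viewAt h]
  rfl

theorem ofLength_eq_some {n : ℕ} {x : Str} (hx : x.length = n) :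
    ofLength n x = some ⟨x, hx⟩ := dif_pos hx

@[simp] theorem ofLength_toList {n : ℕ} (x : List.Vector Bool n) : ofLength n x.toList = some x :=
  dif_pos x.2

/-! ## The packets of the honest servers -/

section Honest

variable {P} (hij : P.i ≠ P.j) (hik : P.i ≠ P.k) (hjk : P.j ≠ P.k)

theorem senderPacket_send {me other : Server} {w : List RoundView} {t : ℕ} (hw : w.length = t)
    (ht : t < P.m) : P.senderPacket v me other w =
      { priv := fun d => if d ≠ P.k then none else if me = P.i then some (v ⟨t, ht⟩).toList
          else if t + 1 = P.m then some (P.h v.toStr) else none } := by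
  subst hw
  rw [senderPacket, dif_pos ht]

theorem senderPacket_silent {me other : Server} {w : List RoundView} (hw : w.length = P.m) :
    P.senderPacket v me other w = {} := by
  rw [senderPacket, dif_neg (by omega), if_neg (by omega), if_neg (by omega)]

theorem receiverPacket_silent {w : List RoundView} (hw : w.length ≠ P.m)
    (hw' : w.length ≠ P.m + 2) : P.receiverPacket w = {} := by
  rw [receiverPacket, if_neg hw, if_neg (by omega)]

theorem packet_i (w : List RoundView) : P.packet v P.i w = P.senderPacket v P.i P.j w :=
  if_pos rfl

include hij in
theorem packet_j (w : List RoundView) : P.packet v P.j w = P.senderPacket v P.j P.i w := by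
  rw [packet, if_neg hij.symm, if_pos rfl]

include hik hjk in
theorem packet_k (w : List RoundView) : P.packet v P.k w = P.receiverPacket w := by
  rw [packet, if_neg hik.symm, if_neg hjk.symm, if_pos rfl]

theorem roundAt_i_send (hi : some P.i ≠ c) {t : ℕ} (ht : t < P.m) :
    (P.roundAt c v adv t P.i).priv P.k = some (v ⟨t, ht⟩).toList := by
  rw [P.roundAt_honest hi, packet_i, senderPacket_send (P.length_viewAt c v adv _ t) ht]
  simp

include hij in
theorem roundAt_j_send (hj : some P.j ≠ c) (hm : 1 ≤ P.m) :
    (P.roundAt c v adv (P.m - 1) P.j).priv P.k = some (P.h v.toStr) := by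
  rw [P.roundAt_honest hj, packet_j hij,
    senderPacket_send (P.length_viewAt c v adv _ _) (show P.m - 1 < P.m by omega)]
  simp [hij.symm, Nat.sub_add_cancel hm]

theorem received_eq (hi : some P.i ≠ c) : P.received c v adv = some v := by
  have h : ∀ t (ht : t < P.m), P.recvValue (P.viewAt c v adv (some P.k) P.m) t =
      some (v ⟨t, ht⟩) := fun t ht => by
    rw [P.recvValue_viewAt ht, Option.bind_some, roundAt_i_send hi ht, Option.bind_some,
      ofLength_toList]
  rw [received, recvBatch, dif_pos fun t => by rw [h t t.2]; rfl]
  congr 1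
  funext t
  simp [h t t.2]

include hij in
theorem receivedHash_eq (hj : some P.j ≠ c) (hm : 1 ≤ P.m) {y : List.Vector Bool P.n}
    (hy : y.toList = P.h v.toStr) : P.receivedHash c v adv = some y := by
  rw [receivedHash, recvHash, P.seenAt_viewAt (by omega)]
  simp only [see, Option.bind_some]
  rw [roundAt_j_send hij hj hm, Option.bind_some, ← hy, ofLength_toList]

/-- The packet by which `P_k` reacts to the send phases. -/
def verifyPacket (P : JmpParams) (x : Option (Batch P.m P.ℓ)) (y : Option (List.Vector Bool P.n)) :
    Packet :=
  match x, y with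
  | some x, some y =>
    { priv := fun d => if d = P.i ∨ d = P.j then some [P.inconsistent x y] else none }
  | none, some _ => { accuse := fun d => d = P.i }
  | some _, none => { accuse := fun d => d = P.j }
  | none, none => { accuse := fun d => d = P.i ∨ d = P.j }

/-- The packet by which `P_k` finally announces its digest. -/
def announcePacket (P : JmpParams) (x : Option (Batch P.m P.ℓ))
    (y : Option (List.Vector Bool P.n)) : Packet :=
  match x, y with
  | some x, some y => { bcast := if P.inconsistent x y then some (P.h x.toStr) else none }
  | _, _ => {}

/-- The packet by which a sender reacts to the bit of `P_k`. -/
def exchangePacket (P : JmpParams) (other : Server) : Option Bool → Packet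
  | some b => { priv := fun d => if d = other then some [b] else none }
  | none => { accuse := fun d => d = P.k }

/-- The packet by which a sender reacts to the bits of `P_k` and of the fellow sender. -/
def digestPacket (P : JmpParams) (v : Batch P.m P.ℓ) (other : Server) :
    Option Bool → Option Bool → Packet
  | _, none => { accuse := fun d => d = other }
  | some b, some b' => { bcast := if b || b' then some (P.h v.toStr) else none }
  | none, some _ => {}

include hik hjk in
theorem roundAt_k_verify (hk : some P.k ≠ c) : P.roundAt c v adv P.m P.k =
    P.verifyPacket (P.received c v adv) (P.receivedHash c v adv) := by
  rw [P.roundAt_honest hk, packet_k hik hjk, receiverPacket, if_pos (P.length_viewAt c v adv _ _)]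
  rfl

include hik hjk in
theorem roundAt_k_announce (hk : some P.k ≠ c) (hm : 1 ≤ P.m) :
    P.roundAt c v adv (P.m + 2) P.k =
      if (P.ttp₁ c v adv).or (P.ttp₂ c v adv) = none then
        P.announcePacket (P.received c v adv) (P.receivedHash c v adv) else {} := by
  rw [P.roundAt_honest hk, packet_k hik hjk, receiverPacket, P.length_viewAt,
    if_neg (by omega), P.ttpEarly_viewAt (by omega), P.recvBatch_viewAt (by omega),
    P.recvHash_viewAt hm (by omega)]
  simp only [true_and]
  rfl

theorem senderPacket_exchange {s other : Server} :
    P.senderPacket v s other (P.viewAt c v adv (some s) (P.m + 1)) =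
      if P.ttp₁ c v adv = none then
        P.exchangePacket other (bitOf ((P.roundAt c v adv P.m P.k).priv s)) else {} := by
  rw [senderPacket, P.length_viewAt, dif_neg (by omega), P.ttpByReceiver_viewAt (by omega),
    P.recvBit_viewAt (by omega), if_neg (c := P.m + 1 = P.m + 2 ∧ _) (by omega)]
  simp only [true_and]
  rfl

theorem senderPacket_digest {s other : Server} :
    P.senderPacket v s other (P.viewAt c v adv (some s) (P.m + 2)) =
      if (P.ttp₁ c v adv).or (P.ttp₂ c v adv) = none then
        P.digestPacket v other (bitOf ((P.roundAt c v adv P.m P.k).priv s))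
          (bitOf ((P.roundAt c v adv (P.m + 1) other).priv s)) else {} := by
  rw [senderPacket, P.length_viewAt, dif_neg (by omega), if_neg (by omega),
    P.ttpEarly_viewAt (by omega), P.recvBit_viewAt (by omega), P.recvBit_viewAt (by omega)]
  simp only [true_and]
  rfl

end Honest

end JmpParams

/-! ## Batches as strings -/

namespace Batch

variable {m ℓ : ℕ}

theorem toStr_succ (v : Batch (m + 1) ℓ) :
    v.toStr = (v 0).toList ++ toStr (fun t : Fin m => v t.succ) := by
  simp [toStr, List.ofFn_succ]

theorem length_toStr (v : Batch m ℓ) : v.toStr.length = m * ℓ := by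
  induction m with
  | zero => simp [toStr]
  | succ m ih => rw [toStr_succ, List.length_append, ih, List.Vector.toList_length]; ring

theorem take_drop_toStr (v : Batch m ℓ) (t : Fin m) :
    (v.toStr.drop (t * ℓ)).take ℓ = (v t).toList := by
  induction m with
  | zero => exact t.elim0
  | succ m ih =>
    rw [toStr_succ]
    refine Fin.cases ?_ (fun t => ?_) t
    · rw [Fin.val_zero, Nat.zero_mul, List.drop_zero,
        List.take_append_of_le_length (by simp), List.take_of_length_le (by simp)]
    · have e : ((t.succ : Fin (m + 1)) : ℕ) * ℓ = (v 0).toList.length + t * ℓ := by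
        rw [Fin.val_succ, List.Vector.toList_length]; ring
      rw [e, List.drop_length_add_append, ih fun t => v t.succ]

/-- All blocks have the same length, so the concatenation can be cut into its blocks again. Thus
different batches with equal digests are a genuine collision of strings. -/
theorem toStr_injective : Function.Injective (toStr : Batch m ℓ → Str) := fun v w h => by
  funext t
  apply List.Vector.toList_injective
  rw [← take_drop_toStr, ← take_drop_toStr, h]

/-- The batch read from a string, which is padded with zeros or cut off. -/
def ofStr (m ℓ : ℕ) (s : Str) : Batch m ℓ := fun t =>
  ⟨(((s ++ List.replicate (m * ℓ) false).take (m * ℓ)).drop (t * ℓ)).take ℓ, by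
    have h : ((t : ℕ) + 1) * ℓ ≤ m * ℓ := Nat.mul_le_mul_right _ t.2
    rw [Nat.add_one_mul] at h
    simp only [List.length_take, List.length_drop, List.length_append, List.length_replicate]
    omega⟩

theorem toStr_take (v : Batch m ℓ) (s : Str)
    (h : ∀ t : Fin m, (v t).toList = (s.drop (t * ℓ)).take ℓ) (hs : s.length = m * ℓ) :
    v.toStr = s := by
  induction m generalizing s with
  | zero =>
    rw [Nat.zero_mul] at hs
    rw [List.eq_nil_of_length_eq_zero hs]
    rfl
  | succ m ih =>
    rw [toStr_succ, ih (fun t => v t.succ) (s.drop ℓ) (fun t => ?_) ?_, h 0]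
    · simp
    · rw [List.length_drop, hs, Nat.add_one_mul, Nat.add_sub_cancel]
    · rw [h, List.drop_drop, Fin.val_succ, Nat.add_one_mul, Nat.add_comm]

theorem toStr_ofStr (s : Str) :
    (ofStr m ℓ s).toStr = (s ++ List.replicate (m * ℓ) false).take (m * ℓ) :=
  toStr_take _ _ (fun _ => rfl) (by simp)

theorem ofStr_toStr (v : Batch m ℓ) : ofStr m ℓ v.toStr = v := toStr_injective <| by
  rw [toStr_ofStr, List.take_append_of_le_length (length_toStr v).ge,
    List.take_of_length_le (length_toStr v).le]

end Batch

/-! ## The outcome of the protocol -/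

theorem Server.eq_of_distinct {i j k : Server} (hij : i ≠ j) (hik : i ≠ k) (hjk : j ≠ k)
    (s : Server) : s = i ∨ s = j ∨ s = k := by
  revert i j k s; decide

namespace JmpParams

section Outcome

variable {P : JmpParams} {c : Option Server} {v : Batch P.m P.ℓ} {adv : List RoundView → Packet}
  (hij : P.i ≠ P.j) (hik : P.i ≠ P.k) (hjk : P.j ≠ P.k)

theorem roundAt_i_exchange (hi : some P.i ≠ c) : P.roundAt c v adv (P.m + 1) P.i =
    if P.ttp₁ c v adv = none then
      P.exchangePacket P.j (bitOf ((P.roundAt c v adv P.m P.k).priv P.i)) else {} := by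
  rw [P.roundAt_honest hi, packet_i, senderPacket_exchange]

include hij in
theorem roundAt_j_exchange (hj : some P.j ≠ c) : P.roundAt c v adv (P.m + 1) P.j =
    if P.ttp₁ c v adv = none then
      P.exchangePacket P.i (bitOf ((P.roundAt c v adv P.m P.k).priv P.j)) else {} := by
  rw [P.roundAt_honest hj, packet_j hij, senderPacket_exchange]

theorem roundAt_i_digest (hi : some P.i ≠ c) : P.roundAt c v adv (P.m + 2) P.i =
    if (P.ttp₁ c v adv).or (P.ttp₂ c v adv) = none then
      P.digestPacket v P.j (bitOf ((P.roundAt c v adv P.m P.k).priv P.i))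
        (bitOf ((P.roundAt c v adv (P.m + 1) P.j).priv P.i)) else {} := by
  rw [P.roundAt_honest hi, packet_i, senderPacket_digest]

include hij in
theorem roundAt_j_digest (hj : some P.j ≠ c) : P.roundAt c v adv (P.m + 2) P.j =
    if (P.ttp₁ c v adv).or (P.ttp₂ c v adv) = none then
      P.digestPacket v P.i (bitOf ((P.roundAt c v adv P.m P.k).priv P.j))
        (bitOf ((P.roundAt c v adv (P.m + 1) P.i).priv P.j)) else {} := by
  rw [P.roundAt_honest hj, packet_j hij, senderPacket_digest]

@[simp] theorem bitOf_singleton (b : Bool) : bitOf (some [b]) = some b := rfl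

theorem digest_eq_of_bcast {p : Server} {x : Option Str}
    (h : (P.roundAt c v adv (P.m + 2) p).bcast = x) :
    P.digest c v adv p = x.bind (ofLength P.n) := by rw [digest, h]

theorem ttpOfPair_eq_none {x y : Bool} (h : P.ttpOfPair x y = none) : x = false ∧ y = false := by
  cases x <;> cases y <;> simp_all [ttpOfPair]

variable (hm : 1 ≤ P.m) (hP : ∀ x, (P.h x).length = P.n)

include hij hik hjk hP

/-- An accusation made by or against `P_k` alone leads to a sender. If no honest sender accuses
`P_k`, both have received a bit, the exchange is honest, and both hold the same OR. They then
broadcast equal digests or none, and in neither case do the rules select `P_k`. -/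
theorem outcome_receiver :
    P.ttpAll (some P.k) v adv = none ∨ ∃ t, P.ttpAll (some P.k) v adv = some t ∧ t ≠ P.k := by
  have hi : some P.i ≠ some P.k := by simpa using hik
  have hj : some P.j ≠ some P.k := by simpa using hjk
  have hpair : ∀ x y t, P.ttpOfPair x y = some t → t ≠ P.k := by
    intro x y t h
    cases x <;> cases y <;> simp [ttpOfPair] at h <;> subst h <;> assumption
  unfold ttpAll
  cases h₁ : P.ttp₁ (some P.k) v adv with
  | some t => exact Or.inr ⟨t, rfl, hpair _ _ _ h₁⟩
  | none =>
  cases h₂ : P.ttp₂ (some P.k) v adv with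
  | some t => exact Or.inr ⟨t, rfl, hpair _ _ _ h₂⟩
  | none =>
  have hi₁ := roundAt_i_exchange (v := v) (adv := adv) hi
  have hj₁ := roundAt_j_exchange (v := v) (adv := adv) hij hj
  have hi₂ := roundAt_i_digest (v := v) (adv := adv) hi
  have hj₂ := roundAt_j_digest (v := v) (adv := adv) hij hj
  rw [h₁, if_pos rfl] at hi₁ hj₁
  rw [h₁, h₂, if_pos (by rfl)] at hi₂ hj₂
  obtain ⟨hai, haj⟩ := ttpOfPair_eq_none h₂
  rw [hi₁] at hai
  rw [hj₁] at haj
  -- A sender without a bit would have accused `P_k`, contrary to `hai`.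
  cases hbi : bitOf ((P.roundAt (some P.k) v adv P.m P.k).priv P.i) with
  | none => rw [hbi] at hai; simp [exchangePacket] at hai
  | some bi =>
  cases hbj : bitOf ((P.roundAt (some P.k) v adv P.m P.k).priv P.j) with
  | none => rw [hbj] at haj; simp [exchangePacket] at haj
  | some bj =>
  rw [hbi] at hi₁ hi₂
  rw [hbj] at hj₁ hj₂
  rw [hj₁] at hi₂
  rw [hi₁] at hj₂
  simp only [exchangePacket, if_true, bitOf_singleton, digestPacket] at hi₂ hj₂
  have h₃ : P.ttp₃ (some P.k) v adv = none := by
    rw [ttp₃, hi₂, hj₂]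
    rfl
  rw [h₃]
  simp only [Option.or]
  rw [ttp₄, digest, digest, hi₂, hj₂, Bool.or_comm bj bi]
  by_cases hb : (bi || bj) = true
  · rw [if_pos hb, Option.bind_some, ofLength_eq_some (hP _)]
    cases P.digest (some P.k) v adv P.k with
    | none => exact Or.inl rfl
    | some z =>
      right
      simp only [ttpOfDigests]
      split_ifs with h
      · exact absurd rfl h
      · exact ⟨_, rfl, hjk⟩
      · exact ⟨_, rfl, hik⟩
  · rw [if_neg hb]
    left
    cases P.digest (some P.k) v adv P.k <;> rfl

include hm

/-- The digest of the honest `P_j` always arrives, so `P_k` accuses at most `P_i`, and `P_j` becomes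
the TTP. An accusation of `P_k` can come only from `P_i`, again giving `P_j`, and a dispute between
the senders gives `P_k`. If all this fails to happen, the bit of `P_k` decides: with bit `0` it
stays silent and no TTP is chosen; with bit `1` both honest servers broadcast, and their digests
differ. -/
theorem outcome_i : (P.ttpAll (some P.i) v adv = none ∧
      ∃ x, P.received (some P.i) v adv = some x ∧ P.h x.toStr = P.h v.toStr) ∨
    ∃ t, P.ttpAll (some P.i) v adv = some t ∧ t ≠ P.i := by
  have hj : some P.j ≠ some P.i := by simpa using hij.symm
  have hk : some P.k ≠ some P.i := by simpa using hik.symm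
  have hY := receivedHash_eq (v := v) (adv := adv) hij hj hm (y := ⟨P.h v.toStr, hP _⟩) rfl
  have hk₀ := roundAt_k_verify (v := v) (adv := adv) hik hjk hk
  have hk₂ := roundAt_k_announce (v := v) (adv := adv) hik hjk hk hm
  have hj₁ := roundAt_j_exchange (v := v) (adv := adv) hij hj
  have hj₂ := roundAt_j_digest (v := v) (adv := adv) hij hj
  rw [hY] at hk₀ hk₂
  cases hX : P.received (some P.i) v adv with
  | none =>
    right
    refine ⟨P.j, ?_, hij.symm⟩
    have : P.ttp₁ (some P.i) v adv = some P.j := by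
      rw [ttp₁, hk₀, hX]
      simp [verifyPacket, ttpOfPair, hij.symm]
    rw [ttpAll, this]
    rfl
  | some x =>
  rw [hX] at hk₀ hk₂
  have h₁ : P.ttp₁ (some P.i) v adv = none := by
    rw [ttp₁, hk₀]
    rfl
  rw [h₁, if_pos rfl] at hj₁
  rw [hk₀] at hj₁ hj₂
  simp only [verifyPacket, or_true, if_true, bitOf_singleton, exchangePacket] at hj₁ hj₂
  have h₂ : P.ttp₂ (some P.i) v adv = none ∨ P.ttp₂ (some P.i) v adv = some P.j := by
    rw [ttp₂, hj₁]
    cases (P.roundAt (some P.i) v adv (P.m + 1) P.i).accuse P.k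
    · exact Or.inl rfl
    · exact Or.inr rfl
  unfold ttpAll
  rw [h₁]
  rcases h₂ with h₂ | h₂
  swap
  · right
    exact ⟨P.j, by rw [h₂]; rfl, hij.symm⟩
  rw [h₁, h₂, if_pos (by rfl)] at hj₂ hk₂
  rw [h₂]
  cases hb : bitOf ((P.roundAt (some P.i) v adv (P.m + 1) P.i).priv P.j) with
  | none =>
    right
    refine ⟨P.k, ?_, hik.symm⟩
    have : P.ttp₃ (some P.i) v adv = some P.k := by
      rw [ttp₃, hj₂, hb]
      simp [digestPacket]
    rw [this]
    rfl
  | some b =>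
  rw [hb] at hj₂
  simp only [digestPacket, announcePacket] at hj₂ hk₂
  by_cases h₃ : P.ttp₃ (some P.i) v adv = some P.k
  · right
    exact ⟨P.k, by rw [h₃]; rfl, hik.symm⟩
  have h₃' : P.ttp₃ (some P.i) v adv = none := by
    unfold ttp₃ at h₃ ⊢
    split_ifs at h₃ ⊢ with hc
    · exact absurd rfl h₃
    · rfl
  rw [h₃']
  simp only [Option.or]
  rw [ttp₄]
  have hdj := digest_eq_of_bcast (congrArg Packet.bcast hj₂)
  have hdk := digest_eq_of_bcast (congrArg Packet.bcast hk₂)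
  by_cases hinc : P.inconsistent x ⟨P.h v.toStr, hP _⟩ = true
  · right
    rw [hinc, Bool.true_or, if_pos rfl, Option.bind_some, ofLength_eq_some (hP _)] at hdj
    rw [hinc, if_pos rfl, Option.bind_some, ofLength_eq_some (hP _)] at hdk
    rw [hdj, hdk]
    have hne : P.h x.toStr ≠ P.h v.toStr := of_decide_eq_true hinc
    cases P.digest (some P.i) v adv P.i with
    | none => exact ⟨P.k, rfl, hik.symm⟩
    | some z =>
      simp only [ttpOfDigests]
      split_ifs with h h'
      · exact ⟨P.k, rfl, hik.symm⟩
      · exact ⟨P.j, rfl, hij.symm⟩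
      -- `P_i` would be chosen only if all three digests agreed, but those of `P_j` and `P_k`
      -- differ.
      · exfalso
        rw [not_not] at h h'
        rw [h] at h'
        exact hne (congrArg Subtype.val h').symm
  · left
    rw [if_neg hinc] at hdk
    rw [hdk]
    refine ⟨?_, x, rfl, ?_⟩
    · cases P.digest (some P.i) v adv P.i <;> cases P.digest (some P.i) v adv P.j <;> rfl
    · by_contra h
      exact hinc (decide_eq_true h)

/-- Here `P_k` certainly holds `v`, so only the choice of the TTP matters. If the digest sent by
`P_j` is wrong, `P_i` and `P_k` both broadcast the digest of `v`; the case that yields `P_j`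
requires these two to differ. -/
theorem outcome_j : P.ttpAll (some P.j) v adv = none ∨
    ∃ t, P.ttpAll (some P.j) v adv = some t ∧ t ≠ P.j := by
  have hi : some P.i ≠ some P.j := by simpa using hij
  have hk : some P.k ≠ some P.j := by simpa using hjk.symm
  have hX := received_eq (v := v) (adv := adv) hi
  have hk₀ := roundAt_k_verify (v := v) (adv := adv) hik hjk hk
  have hk₂ := roundAt_k_announce (v := v) (adv := adv) hik hjk hk hm
  have hi₁ := roundAt_i_exchange (v := v) (adv := adv) hi
  have hi₂ := roundAt_i_digest (v := v) (adv := adv) hi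
  rw [hX] at hk₀ hk₂
  cases hY : P.receivedHash (some P.j) v adv with
  | none =>
    right
    refine ⟨P.i, ?_, hij⟩
    have : P.ttp₁ (some P.j) v adv = some P.i := by
      rw [ttp₁, hk₀, hY]
      simp [verifyPacket, ttpOfPair, hij]
    rw [ttpAll, this]
    rfl
  | some y =>
  rw [hY] at hk₀ hk₂
  have h₁ : P.ttp₁ (some P.j) v adv = none := by
    rw [ttp₁, hk₀]
    rfl
  rw [h₁, if_pos rfl] at hi₁
  rw [hk₀] at hi₁ hi₂
  simp only [verifyPacket, true_or, if_true, bitOf_singleton, exchangePacket] at hi₁ hi₂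
  have h₂ : P.ttp₂ (some P.j) v adv = none ∨ P.ttp₂ (some P.j) v adv = some P.i := by
    rw [ttp₂, hi₁]
    cases (P.roundAt (some P.j) v adv (P.m + 1) P.j).accuse P.k
    · exact Or.inl rfl
    · exact Or.inr rfl
  unfold ttpAll
  rw [h₁]
  rcases h₂ with h₂ | h₂
  swap
  · right
    exact ⟨P.i, by rw [h₂]; rfl, hij⟩
  rw [h₁, h₂, if_pos (by rfl)] at hi₂ hk₂
  rw [h₂]
  cases hb : bitOf ((P.roundAt (some P.j) v adv (P.m + 1) P.j).priv P.i) with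
  | none =>
    right
    refine ⟨P.k, ?_, hjk.symm⟩
    have : P.ttp₃ (some P.j) v adv = some P.k := by
      rw [ttp₃, hi₂, hb]
      simp [digestPacket]
    rw [this]
    rfl
  | some b =>
  rw [hb] at hi₂
  simp only [digestPacket, announcePacket] at hi₂ hk₂
  by_cases h₃ : P.ttp₃ (some P.j) v adv = some P.k
  · right
    exact ⟨P.k, by rw [h₃]; rfl, hjk.symm⟩
  have h₃' : P.ttp₃ (some P.j) v adv = none := by
    unfold ttp₃ at h₃ ⊢
    split_ifs at h₃ ⊢ with hc
    · exact absurd rfl h₃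
    · rfl
  rw [h₃']
  simp only [Option.or]
  rw [ttp₄]
  have hdi := digest_eq_of_bcast (congrArg Packet.bcast hi₂)
  have hdk := digest_eq_of_bcast (congrArg Packet.bcast hk₂)
  by_cases hinc : P.inconsistent v y = true
  · right
    rw [hinc, Bool.true_or, if_pos rfl, Option.bind_some, ofLength_eq_some (hP _)] at hdi
    rw [hinc, if_pos rfl, Option.bind_some, ofLength_eq_some (hP _)] at hdk
    rw [hdi, hdk]
    cases P.digest (some P.j) v adv P.j with
    | none => exact ⟨P.k, rfl, hjk.symm⟩
    | some z =>
      simp only [ttpOfDigests]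
      split_ifs with h h'
      · exact ⟨P.k, rfl, hjk.symm⟩
      · exact absurd rfl h'
      · exact ⟨P.i, rfl, hij⟩
  · left
    rw [if_neg hinc] at hdk
    rw [hdk]
    cases P.digest (some P.j) v adv P.i <;> cases P.digest (some P.j) v adv P.j <;> rfl

/-- Without corruption, nobody broadcasts anything. -/
theorem honest_silent (t : ℕ) (ht : t < P.m + 3) (p : Server) :
    (P.roundAt none v adv t p).accuse = (fun _ => false) ∧
      (P.roundAt none v adv t p).bcast = none := by
  have hX := received_eq (P := P) (v := v) (adv := adv) (c := none) (by simp)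
  have hY := receivedHash_eq (P := P) (v := v) (adv := adv) (c := none) hij (by simp) hm
    (y := ⟨P.h v.toStr, hP _⟩) rfl
  have hinc : P.inconsistent v ⟨P.h v.toStr, hP _⟩ = false := by simp [inconsistent]
  have hk₀ := roundAt_k_verify (v := v) (adv := adv) (c := none) hik hjk (by simp)
  have hk₂ := roundAt_k_announce (v := v) (adv := adv) (c := none) hik hjk (by simp) hm
  have hi₁ := roundAt_i_exchange (P := P) (v := v) (adv := adv) (c := none) (by simp)
  have hj₁ := roundAt_j_exchange (v := v) (adv := adv) (c := none) hij (by simp)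
  have hi₂ := roundAt_i_digest (P := P) (v := v) (adv := adv) (c := none) (by simp)
  have hj₂ := roundAt_j_digest (v := v) (adv := adv) (c := none) hij (by simp)
  rw [hX, hY] at hk₀ hk₂
  have h₁ : P.ttp₁ none v adv = none := by
    rw [ttp₁, hk₀]
    rfl
  rw [h₁, if_pos rfl] at hi₁ hj₁
  rw [hk₀] at hi₁ hi₂ hj₁ hj₂
  simp only [verifyPacket, true_or, or_true, if_true, bitOf_singleton, exchangePacket, hinc]
    at hk₀ hi₁ hi₂ hj₁ hj₂
  have h₂ : P.ttp₂ none v adv = none := by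
    rw [ttp₂, hi₁, hj₁]
    rfl
  rw [h₁, h₂, if_pos (by rfl)] at hi₂ hj₂ hk₂
  rw [hj₁] at hi₂
  rw [hi₁] at hj₂
  simp only [if_true, bitOf_singleton, digestPacket, Bool.or_self, Bool.false_eq_true,
    if_false] at hi₂ hj₂
  simp only [announcePacket, hinc, Bool.false_eq_true, if_false] at hk₂
  have hp := Server.eq_of_distinct hij hik hjk p
  have hs : ∀ s, P.roundAt none v adv t s = P.packet v s (P.viewAt none v adv (some s) t) :=
    fun s => P.roundAt_honest (by simp) t
  rcases Nat.lt_or_ge t P.m with h | h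
  · rcases hp with rfl | rfl | rfl
    · rw [hs, packet_i, senderPacket_send (P.length_viewAt ..) h]
      exact ⟨rfl, rfl⟩
    · rw [hs, packet_j hij, senderPacket_send (P.length_viewAt ..) h]
      exact ⟨rfl, rfl⟩
    · rw [hs, packet_k hik hjk, receiverPacket_silent (by rw [P.length_viewAt]; omega)
        (by rw [P.length_viewAt]; omega)]
      exact ⟨rfl, rfl⟩
  · obtain rfl | rfl | rfl : t = P.m ∨ t = P.m + 1 ∨ t = P.m + 2 := by omega
    · rcases hp with rfl | rfl | rfl
      · rw [hs, packet_i, senderPacket_silent (P.length_viewAt ..)]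
        exact ⟨rfl, rfl⟩
      · rw [hs, packet_j hij, senderPacket_silent (P.length_viewAt ..)]
        exact ⟨rfl, rfl⟩
      · rw [hk₀]
        exact ⟨rfl, rfl⟩
    · rcases hp with rfl | rfl | rfl
      · rw [hi₁]
        exact ⟨rfl, rfl⟩
      · rw [hj₁]
        exact ⟨rfl, rfl⟩
      · rw [hs, packet_k hik hjk, receiverPacket_silent (by rw [P.length_viewAt]; omega)
          (by rw [P.length_viewAt]; omega)]
        exact ⟨rfl, rfl⟩
    · rcases hp with rfl | rfl | rfl
      · rw [hi₂]
        exact ⟨rfl, rfl⟩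
      · rw [hj₂]
        exact ⟨rfl, rfl⟩
      · rw [hk₂]
        exact ⟨rfl, rfl⟩

theorem outcome_none : P.ttpAll none v adv = none := by
  have h := honest_silent hij hik hjk hm hP (v := v) (adv := adv)
  have e₁ : P.ttp₁ none v adv = none := by rw [ttp₁, (h P.m (by omega) _).1]; rfl
  have e₂ : P.ttp₂ none v adv = none := by
    rw [ttp₂, (h (P.m + 1) (by omega) _).1, (h (P.m + 1) (by omega) _).1]; rfl
  have e₃ : P.ttp₃ none v adv = none := by
    rw [ttp₃, (h (P.m + 2) (by omega) _).1, (h (P.m + 2) (by omega) _).1]; rfl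
  have e₄ : ∀ p, P.digest none v adv p = none := fun p => by
    rw [digest, (h (P.m + 2) (by omega) p).2]; rfl
  rw [ttpAll, e₁, e₂, e₃, ttp₄, e₄, e₄, e₄]
  rfl

/-- Either no TTP is chosen and `P_k` has a value with the same digest as the common value, or the
TTP is honest. -/
theorem outcome (c : Option Server) : (P.ttpAll c v adv = none ∧ (c ≠ some P.k →
      ∃ x, P.received c v adv = some x ∧ P.h x.toStr = P.h v.toStr)) ∨
    ∃ t, P.ttpAll c v adv = some t ∧ some t ≠ c := by
  rcases c with _ | s
  · exact Or.inl ⟨outcome_none hij hik hjk hm hP, fun _ => ⟨v, received_eq (by simp), rfl⟩⟩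
  · simp only [ne_eq, Option.some.injEq]
    rcases Server.eq_of_distinct hij hik hjk s with rfl | rfl | rfl
    · exact (outcome_i hij hik hjk hm hP).imp_left fun h => ⟨h.1, fun _ => h.2⟩
    · exact (outcome_j hij hik hjk hm hP).imp_left fun h =>
        ⟨h, fun _ => ⟨v, received_eq (by simpa using hij), rfl⟩⟩
    · exact (outcome_receiver hij hik hjk hP).imp_left fun h => ⟨h, fun h' => absurd rfl h'⟩

end Outcome

end JmpParams

/-! ## Communication -/

theorem honestBits_append (c : Option Server) (h₁ h₂ : List Round) :
    honestBits c (h₁ ++ h₂) = honestBits c h₁ + honestBits c h₂ := by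
  simp [honestBits]

theorem honestBits_singleton (c : Option Server) (ρ : Round) :
    honestBits c [ρ] = ∑ p, if some p = c then 0 else (ρ p).bits := by
  simp [honestBits]

theorem Packet.bits_empty : ({} : Packet).bits = 0 := by simp [Packet.bits]

theorem sum_length_getD_ite (p : Server → Prop) [DecidablePred p] (x : Str) :
    ∑ d, ((if p d then some x else none : Option Str).getD []).length =
      (Finset.univ.filter p).card * x.length := by
  rw [← Finset.sum_filter_add_sum_filter_not Finset.univ p]
  rw [Finset.sum_congr rfl (g := fun _ => x.length) fun d hd => by
      rw [if_pos (Finset.mem_filter.1 hd).2]; rfl,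
    Finset.sum_congr (s₁ := Finset.univ.filter fun d => ¬ p d) rfl (g := fun _ => 0) fun d hd => by
      rw [if_neg (Finset.mem_filter.1 hd).2]; rfl]
  simp

namespace JmpParams

section Cost

variable {P : JmpParams} {c : Option Server} {v : Batch P.m P.ℓ} {adv : List RoundView → Packet}

theorem honestBits_run_succ (T : ℕ) : honestBits c (P.run c v adv (T + 1)) =
    honestBits c (P.run c v adv T) +
      ∑ p, if some p = c then 0 else (P.roundAt c v adv T p).bits := by
  rw [run_succ, honestBits_append, honestBits_singleton]

theorem bits_senderPacket_send {me other : Server} {w : List RoundView} {t : ℕ}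
    (hw : w.length = t) (ht : t < P.m) : (P.senderPacket v me other w).bits =
      if me = P.i then P.ℓ else if t + 1 = P.m then (P.h v.toStr).length else 0 := by
  rw [senderPacket_send hw ht, Packet.bits]
  simp only [ite_not]
  split_ifs with h₁ h₂
  · rw [sum_length_getD_ite]; simp [Finset.filter_eq']
  · rw [sum_length_getD_ite]; simp [Finset.filter_eq']
  · simp

theorem card_filter_eq_or_le (a b : Server) :
    (Finset.univ.filter fun d => d = a ∨ d = b).card ≤ 2 := by
  revert a b; decide

theorem bits_verifyPacket_le (x : Option (Batch P.m P.ℓ)) (y : Option (List.Vector Bool P.n)) :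
    (P.verifyPacket x y).bits ≤ 4 := by
  have h := card_filter_eq_or_le P.i P.j
  rcases x with _ | x <;> rcases y with _ | y
  · simp only [verifyPacket, Packet.bits, decide_eq_true_eq]
    simp only [Option.getD_none, List.length_nil, Finset.sum_const_zero]
    omega
  · simp [verifyPacket, Packet.bits, Finset.filter_eq']
  · simp [verifyPacket, Packet.bits, Finset.filter_eq']
  · simp only [verifyPacket, Packet.bits]
    rw [sum_length_getD_ite]
    simp
    omega

theorem bits_exchangePacket_le (other : Server) (b : Option Bool) :
    (P.exchangePacket other b).bits ≤ 2 := by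
  rcases b with _ | b
  · simp [exchangePacket, Packet.bits, Finset.filter_eq']
  · simp only [exchangePacket, Packet.bits]
    rw [sum_length_getD_ite]
    simp [Finset.filter_eq']

theorem bits_digestPacket_le (hP : ∀ x, (P.h x).length = P.n) (other : Server)
    (b b' : Option Bool) : (P.digestPacket v other b b').bits ≤ P.n + 2 := by
  rcases b with _ | b <;> rcases b' with _ | b' <;>
    simp only [digestPacket, Packet.bits, decide_eq_true_eq, Finset.filter_eq', Finset.mem_univ,
      if_true, Finset.card_singleton]
  · simp
  · simp
  · simp
  · split_ifs <;> simp [hP]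

theorem bits_announcePacket_le (hP : ∀ x, (P.h x).length = P.n) (x : Option (Batch P.m P.ℓ))
    (y : Option (List.Vector Bool P.n)) : (P.announcePacket x y).bits ≤ P.n + 2 := by
  rcases x with _ | x <;> rcases y with _ | y <;> simp only [announcePacket, Packet.bits]
  · simp
  · simp
  · simp
  · split_ifs <;> simp [hP]

theorem bits_ite_le {q : Prop} [Decidable q] {p : Packet} {n : ℕ} (h : p.bits ≤ n) :
    (if q then p else {}).bits ≤ n := by
  split_ifs
  · exact h
  · rw [Packet.bits_empty]; exact Nat.zero_le n

theorem sum_honest_le (c : Option Server) (f : Server → ℕ) {n : ℕ}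
    (h : ∀ p, some p ≠ c → f p ≤ n) : (∑ p, if some p = c then 0 else f p) ≤ 3 * n := by
  refine (Finset.sum_le_card_nsmul _ _ n fun p _ => ?_).trans (by simp)
  split_ifs with hp
  · exact Nat.zero_le n
  · exact h p hp

variable (hij : P.i ≠ P.j) (hik : P.i ≠ P.k) (hjk : P.j ≠ P.k)
include hij hik hjk

theorem bits_roundAt_send (hP : ∀ x, (P.h x).length = P.n) {t : ℕ} (ht : t < P.m) {p : Server}
    (hp : some p ≠ c) : (P.roundAt c v adv t p).bits =
      (if p = P.i then P.ℓ else 0) + if p = P.j ∧ t + 1 = P.m then P.n else 0 := by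
  rw [P.roundAt_honest hp]
  rcases Server.eq_of_distinct hij hik hjk p with rfl | rfl | rfl
  · rw [packet_i, bits_senderPacket_send (P.length_viewAt ..) ht]
    simp [hij]
  · rw [packet_j hij, bits_senderPacket_send (P.length_viewAt ..) ht]
    simp [hij.symm, hP]
  · rw [packet_k hik hjk, receiverPacket_silent (by rw [P.length_viewAt]; omega)
      (by rw [P.length_viewAt]; omega), Packet.bits_empty]
    simp [hik.symm, hjk.symm]

/-- Each send phase costs the `P.ℓ` bits of `P_i`; the digest of `P_j` is added in the last one
only, which is why the extra term depends on `t = P.m`. -/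
theorem honestBits_run_le (hP : ∀ x, (P.h x).length = P.n) :
    ∀ t ≤ P.m, honestBits c (P.run c v adv t) ≤ t * P.ℓ + if t = P.m then P.n else 0
  | 0, _ => by simp [honestBits, execution]
  | t + 1, ht => by
    have h := honestBits_run_le hP t (by omega)
    rw [if_neg (by omega)] at h
    rw [honestBits_run_succ]
    have hs : (∑ p, if some p = c then 0 else (P.roundAt c v adv t p).bits) ≤
        ∑ p, ((if p = P.i then P.ℓ else 0) + if p = P.j ∧ t + 1 = P.m then P.n else 0) := by
      refine Finset.sum_le_sum fun p _ => ?_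
      by_cases hp : some p = c
      · rw [if_pos hp]
        exact Nat.zero_le _
      · rw [if_neg hp, bits_roundAt_send hij hik hjk hP (by omega) hp]
    rw [Finset.sum_add_distrib, Finset.sum_ite_eq' Finset.univ P.i] at hs
    have hn : (∑ p, if p = P.j ∧ t + 1 = P.m then P.n else 0) = if t + 1 = P.m then P.n else 0 := by
      by_cases hc : t + 1 = P.m
      · simp [hc]
      · simp [hc]
    rw [hn, if_pos (Finset.mem_univ _)] at hs
    rw [Nat.add_one_mul]
    omega

/-- The messages of `P_i` alone account for this. -/
theorem le_honestBits_run (hP : ∀ x, (P.h x).length = P.n) :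
    ∀ t ≤ P.m, t * P.ℓ ≤ honestBits none (P.run none v adv t)
  | 0, _ => by simp
  | t + 1, ht => by
    have h := le_honestBits_run hP t (by omega)
    rw [honestBits_run_succ, Nat.add_one_mul]
    refine Nat.add_le_add h ?_
    have := Finset.single_le_sum (f := fun p => if some p = none then 0 else
      (P.roundAt none v adv t p).bits) (fun p _ => Nat.zero_le _) (Finset.mem_univ P.i)
    simp only [reduceCtorEq, if_false] at this ⊢
    refine le_trans ?_ this
    rw [bits_roundAt_send hij hik hjk hP (by omega) (by simp)]
    simp

/-- Besides the values and the one private digest, the verification rounds cost at most `3 * 4`, `3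
* 2` and `3 * (P.n + 2)` bits. The overhead `4 * P.n + 24` is at most `24 * (P.n + 1)`. -/
theorem honestBits_transcript_le (hP : ∀ x, (P.h x).length = P.n) (hm : 1 ≤ P.m) :
    honestBits c (P.transcript c v adv) ≤ P.m * P.ℓ + 24 * (P.n + 1) := by
  have h₀ := honestBits_run_le (c := c) (v := v) (adv := adv) hij hik hjk hP P.m le_rfl
  rw [if_pos rfl] at h₀
  have h₁ : (∑ p, if some p = c then 0 else (P.roundAt c v adv P.m p).bits) ≤ 3 * 4 := by
    refine sum_honest_le c _ fun p hp => ?_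
    rcases Server.eq_of_distinct hij hik hjk p with rfl | rfl | rfl
    · rw [P.roundAt_honest hp, packet_i, senderPacket_silent (P.length_viewAt ..),
        Packet.bits_empty]
      omega
    · rw [P.roundAt_honest hp, packet_j hij, senderPacket_silent (P.length_viewAt ..),
        Packet.bits_empty]
      omega
    · rw [roundAt_k_verify hik hjk hp]
      exact bits_verifyPacket_le _ _
  have h₂ : (∑ p, if some p = c then 0 else (P.roundAt c v adv (P.m + 1) p).bits) ≤ 3 * 2 := by
    refine sum_honest_le c _ fun p hp => ?_
    rcases Server.eq_of_distinct hij hik hjk p with rfl | rfl | rfl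
    · rw [roundAt_i_exchange hp]
      exact bits_ite_le (bits_exchangePacket_le _ _)
    · rw [roundAt_j_exchange hij hp]
      exact bits_ite_le (bits_exchangePacket_le _ _)
    · rw [P.roundAt_honest hp, packet_k hik hjk, receiverPacket_silent
        (by rw [P.length_viewAt]; omega) (by rw [P.length_viewAt]; omega), Packet.bits_empty]
      omega
  have h₃ : (∑ p, if some p = c then 0 else (P.roundAt c v adv (P.m + 2) p).bits) ≤
      3 * (P.n + 2) := by
    refine sum_honest_le c _ fun p hp => ?_
    rcases Server.eq_of_distinct hij hik hjk p with rfl | rfl | rfl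
    · rw [roundAt_i_digest hp]
      exact bits_ite_le (bits_digestPacket_le hP _ _ _)
    · rw [roundAt_j_digest hij hp]
      exact bits_ite_le (bits_digestPacket_le hP _ _ _)
    · rw [roundAt_k_announce hik hjk hp hm]
      exact bits_ite_le (bits_announcePacket_le hP _ _)
  have e : honestBits c (P.transcript c v adv) = honestBits c (P.run c v adv (P.m + 2 + 1)) := rfl
  rw [e, honestBits_run_succ, honestBits_run_succ, honestBits_run_succ]
  omega

theorem le_honestBits_transcript (hP : ∀ x, (P.h x).length = P.n) :
    P.m * P.ℓ ≤ honestBits none (P.transcript none v adv) := by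
  have e : honestBits none (P.transcript none v adv) =
    honestBits none (P.run none v adv (P.m + 2 + 1)) := rfl
  rw [e, honestBits_run_succ, honestBits_run_succ, honestBits_run_succ]
  have := le_honestBits_run (v := v) (adv := adv) hij hik hjk hP P.m le_rfl
  omega

/-! ### Outputs of the servers -/

omit hij hik hjk in
theorem output_eq (s : Server) : P.result c v adv s = match P.ttpAll c v adv with
    | some t => Output.ttp t
    | none => if s = P.k then
        match P.recvBatch (P.viewAt c v adv (some s) P.rounds) with
        | some x => Output.val x
        | none => Output.bot
      else Output.bot := by
  have h : P.result c v adv s = P.output s (P.viewAt c v adv (some s) P.rounds) := rfl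
  rw [h, output, P.ttp_viewAt]

omit hij hik hjk in
theorem result_eq_ttp {t : Server} (h : P.ttpAll c v adv = some t) (s : Server) :
    P.result c v adv s = Output.ttp t := by
  rw [output_eq, h]

omit hij hik hjk in
theorem result_of_ttpAll_eq_none (h : P.ttpAll c v adv = none) {s : Server}
    (hs : s = P.k → P.received c v adv = some v) :
    P.result c v adv s = if s = P.k then Output.val v else Output.bot := by
  rw [output_eq, h]
  by_cases hk : s = P.k
  · subst hk
    rw [P.recvBatch_viewAt (by unfold rounds; omega), hs rfl]
  · simp [hk]

theorem result_none (hP : ∀ x, (P.h x).length = P.n) (hm : 1 ≤ P.m) (s : Server) :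
    P.result none v adv s = if s = P.k then Output.val v else Output.bot :=
  result_of_ttpAll_eq_none (outcome_none hij hik hjk hm hP) fun _ => received_eq (by simp)

end Cost

end JmpParams

/-! ### Amortized limits -/

open Filter Topology in
theorem tendsto_add_const_div (a b : ℝ) :
    Tendsto (fun m : ℕ => ((m : ℝ) * a + b) / m) atTop (𝓝 a) := by
  have h : Tendsto (fun m : ℕ => a + b * (m : ℝ)⁻¹) atTop (𝓝 (a + b * 0)) :=
    tendsto_const_nhds.add (tendsto_const_nhds.mul tendsto_inv_atTop_nhds_zero_nat)
  rw [mul_zero, add_zero] at h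
  refine h.congr' ?_
  filter_upwards [eventually_ge_atTop 1] with m hm
  have : (m : ℝ) ≠ 0 := by positivity
  field_simp

open Filter Topology in
theorem tendsto_div_of_bounded {a : ℕ} {b : ℕ} {f : ℕ → ℕ} (h₁ : ∀ m, m * a ≤ f m)
    (h₂ : ∀ m, 1 ≤ m → f m ≤ m * a + b) :
    Tendsto (fun m : ℕ => (f m : ℝ) / m) atTop (𝓝 a) := by
  refine tendsto_of_tendsto_of_tendsto_of_le_of_le' (tendsto_add_const_div a 0)
    (tendsto_add_const_div a b) ?_ ?_
  · filter_upwards with m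
    have : (m : ℝ) * a + 0 ≤ f m := by rw [add_zero]; exact_mod_cast h₁ m
    gcongr
  · filter_upwards [eventually_ge_atTop 1] with m hm
    have : (f m : ℝ) ≤ m * a + b := by exact_mod_cast h₂ m hm
    gcongr

open Filter Topology in
theorem tendsto_mul_div_of_bounded {a : ℕ} {b : ℕ} {f : ℕ → ℕ} (ha : 1 ≤ a)
    (h₁ : ∀ m, m * a ≤ f m) (h₂ : ∀ m, 1 ≤ m → f m ≤ m * a + b) :
    Tendsto (fun m : ℕ => (m * a : ℝ) / f m) atTop (𝓝 1) := by
  have ha' : (a : ℝ) ≠ 0 := by positivity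
  have h := (tendsto_const_nhds (x := (a : ℝ))).div (tendsto_div_of_bounded h₁ h₂) ha'
  rw [div_self ha'] at h
  refine h.congr' ?_
  filter_upwards [eventually_ge_atTop 1] with m hm
  simp only [Pi.div_apply]
  rw [div_div_eq_mul_div, mul_comm]

/-! ## Computing packets and views -/

theorem length_encDelim (x : Str) : (encDelim x).length = 2 * x.length + 1 := by
  simp only [encDelim, List.length_append, List.length_flatMap, List.length_cons, List.length_nil,
    List.map_const', List.sum_replicate, smul_eq_mul]
  ring

/-- The components of a packet are computable in polynomial time. -/
structure PacketComputes {X : Type} (Γ : List (X → Str)) (q : X → Packet) : Prop where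
  priv : ∀ d, Computes Γ fun x => encOption ((q x).priv d)
  accuse : ∀ d, Computes Γ fun x => [(q x).accuse d]
  bcast : Computes Γ fun x => encOption (q x).bcast

namespace Computes

variable {X : Type} {Γ : List (X → Str)}

theorem isSome {o : X → Option Str} (ho : Computes Γ fun x => encOption (o x)) :
    Computes Γ fun x => [(o x).isSome] :=
  (ho.pick (const [true]) (const [false]) (const [false])).congr fun x => by
    cases o x <;> rfl

theorem getD {o : X → Option Str} (ho : Computes Γ fun x => encOption (o x)) :
    Computes Γ fun x => (o x).getD [] :=
  ho.tail.congr fun x => by cases o x <;> rfl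

theorem bind_ofLength {o : X → Option Str} {n : X → ℕ} (ho : Computes Γ fun x => encOption (o x))
    (hn : Computes Γ fun x => unary (n x)) : Computes Γ fun x =>
      encOption (((o x).bind (JmpParams.ofLength (n x))).map List.Vector.toList) :=
  ((hn.length_eq ho.getD).ite ho nil).congr fun x => by
    cases o x with
    | none => simp [encOption]
    | some y =>
      by_cases h : y.length = n x
      · simp only [Option.bind_some, JmpParams.ofLength_eq_some h,
          Option.getD_some, if_pos h]
        rfl
      · simp [JmpParams.ofLength, h, encOption]

/-- The encoding of a message consisting of one bit is the marker followed by that bit, so one-bit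
messages are exactly those with an encoding of length `2`. -/
theorem bitOf {o : X → Option Str} (ho : Computes Γ fun x => encOption (o x)) :
    Computes Γ fun x => encOption ((JmpParams.bitOf (o x)).map fun b => [b]) :=
  (((const (unary 2)).length_eq ho).ite ho nil).congr fun x => by
    match o x with
    | none => simp [JmpParams.bitOf, encOption]
    | some [] => simp [JmpParams.bitOf, encOption]
    | some [b] => simp [JmpParams.bitOf, encOption]
    | some (a :: b :: l) => simp [JmpParams.bitOf, encOption]

theorem eq_none {o : X → Option Server} (ho : Computes Γ fun x => encServer (o x)) :
    Computes Γ fun x => [decide (o x = none)] :=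
  (ho.pick (const [false]) (const [false]) (const [true])).congr fun x => by
    cases o x <;> simp [encServer, _root_.pick]

theorem option_or {o o' : X → Option Server} (ho : Computes Γ fun x => encServer (o x))
    (ho' : Computes Γ fun x => encServer (o' x)) : Computes Γ fun x => encServer ((o x).or (o' x)) :=
  (ho.pick ho ho ho').congr fun x => by cases h : o x <;> simp [encServer, _root_.pick]

theorem encOption_ite {p : X → Prop} [∀ x, Decidable (p x)]
    (hp : Computes Γ fun x => [decide (p x)]) {o o' : X → Option Str}
    (ho : Computes Γ fun x => encOption (o x)) (ho' : Computes Γ fun x => encOption (o' x)) :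
    Computes Γ fun x => encOption (if p x then o x else o' x) :=
  (hp.ite ho ho').congr fun x => by split_ifs <;> rfl

theorem ttpOfPair (P : X → JmpParams) (i j : Server) (hi : ∀ x, (P x).i = i)
    (hj : ∀ x, (P x).j = j) {a b : X → Bool} (ha : Computes Γ fun x => [a x])
    (hb : Computes Γ fun x => [b x]) :
    Computes Γ fun x => encServer ((P x).ttpOfPair (a x) (b x)) :=
  (ha.bool_ite (hb.bool_ite (const (encServer (some i))) (const (encServer (some j))))
    (hb.bool_ite (const (encServer (some i))) (const []))).congr fun x => by
    cases a x <;> cases b x <;> simp [JmpParams.ttpOfPair, encServer, hi, hj]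

theorem ttpOfDigests (P : X → JmpParams) (i j k : Server) (hi : ∀ x, (P x).i = i)
    (hj : ∀ x, (P x).j = j) (hk : ∀ x, (P x).k = k) {n : X → ℕ}
    {a b c : (x : X) → Option (List.Vector Bool (n x))}
    (ha : Computes Γ fun x => encOption ((a x).map List.Vector.toList))
    (hb : Computes Γ fun x => encOption ((b x).map List.Vector.toList))
    (hc : Computes Γ fun x => encOption ((c x).map List.Vector.toList)) :
    Computes Γ fun x => encServer ((P x).ttpOfDigests (a x) (b x) (c x)) := by
  have hI := const (Γ := Γ) (encServer (some i))
  have hJ := const (Γ := Γ) (encServer (some j))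
  have hK := const (Γ := Γ) (encServer (some k))
  refine (hc.isSome.bool_ite (ha.isSome.bool_ite (hb.isSome.bool_ite
    ((ha.eq hb).ite ((ha.eq hc).ite hI hJ) hK) hK) (hb.isSome.bool_ite hK nil))
    nil).congr fun x => ?_
  cases a x <;> cases b x <;> cases c x <;>
    simp [JmpParams.ttpOfDigests, encServer, hi, hj, hk, encOption]
  rename_i y z w
  have e₁ := List.Vector.toList_injective.eq_iff (a := y) (b := z)
  have e₂ := List.Vector.toList_injective.eq_iff (a := y) (b := w)
  simp only [e₁, e₂]
  split_ifs <;> rfl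

theorem encSeen {c : Option Server} {q : X → Packet} (hq : PacketComputes Γ q) :
    Computes Γ fun x => encSeen
      { priv := c.bind (q x).priv, accuse := (q x).accuse, bcast := (q x).bcast } := by
  refine .append (.append (.encDelim ?_) (.encDelim ?_)) (.encDelim hq.bcast)
  · cases c with
    | none => exact nil
    | some d => exact hq.priv d
  · exact ((hq.accuse 0).append ((hq.accuse 1).append (hq.accuse 2))).congr fun x => by
      simp [List.ofFn_succ]

theorem encRound {c : Option Server} {ρ : X → Round} (hρ : ∀ p, PacketComputes Γ fun x => ρ x p) :
    Computes Γ fun x => encRound (see c (ρ x)) :=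
  .append (.append (.encSeen (hρ 0)) (.encSeen (hρ 1))) (.encSeen (hρ 2))

end Computes

namespace PacketComputes

variable {X : Type} {Γ : List (X → Str)} {q q' : X → Packet}

theorem congr (h : PacketComputes Γ q) (e : ∀ x, q' x = q x) : PacketComputes Γ q' :=
  (funext e : q' = q) ▸ h

theorem empty : PacketComputes Γ fun _ => {} where
  priv _ := .nil
  accuse _ := .const [false]
  bcast := .nil

theorem ite {p : X → Prop} [∀ x, Decidable (p x)] (hp : Computes Γ fun x => [decide (p x)])
    (hq : PacketComputes Γ q) (hq' : PacketComputes Γ q') :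
    PacketComputes Γ fun x => if p x then q x else q' x where
  priv d := (hp.ite (hq.priv d) (hq'.priv d)).congr fun x => by split_ifs <;> rfl
  accuse d := (hp.ite (hq.accuse d) (hq'.accuse d)).congr fun x => by split_ifs <;> rfl
  bcast := (hp.ite hq.bcast hq'.bcast).congr fun x => by split_ifs <;> rfl

theorem of_encPacket (h : ∀ o, Computes Γ fun x => encPacket (q x) o) : PacketComputes Γ q where
  priv d := by
    fin_cases d
    · exact h 0
    · exact h 1
    · exact h 2
  accuse d := by
    have h₃ : Computes Γ fun x => List.ofFn (q x).accuse := h 3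
    fin_cases d
    · exact h₃.take_one.congr fun x => by simp [List.ofFn_succ]
    · exact h₃.tail.take_one.congr fun x => by simp [List.ofFn_succ]
    · exact h₃.tail.tail.take_one.congr fun x => by simp [List.ofFn_succ]
  bcast := h 4

variable (P : X → JmpParams) (i j k : Server) (hi : ∀ x, (P x).i = i) (hj : ∀ x, (P x).j = j)
  (hk : ∀ x, (P x).k = k)

section Receiver

variable {a : (x : X) → Option (Batch (P x).m (P x).ℓ)}
    {b : (x : X) → Option (List.Vector Bool (P x).n)}
    (ha : Computes Γ fun x => encOption ((a x).map Batch.toStr))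
    (hb : Computes Γ fun x => encOption ((b x).map List.Vector.toList))
    (hh : Computes Γ fun x => (P x).h (((a x).map Batch.toStr).getD []))

include hi hj ha hb hh

theorem verifyPacket : PacketComputes Γ fun x => (P x).verifyPacket (a x) (b x) where
  priv d := by
    by_cases hd : d = i ∨ d = j
    · refine ((ha.isSome.and hb.isSome).bool_ite
        (((hh.eq hb.getD).not.cons true)) .nil).congr fun x => ?_
      cases a x <;> cases b x <;>
        simp [JmpParams.verifyPacket, encOption, hi, hj, hd, JmpParams.inconsistent]
    · refine (Computes.nil (Γ := Γ)).congr fun x => ?_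
      cases a x <;> cases b x <;> simp [JmpParams.verifyPacket, encOption, hi, hj, hd]
  accuse d := by
    refine (((Computes.const [decide (d = i)]).and ha.isSome.not).or
      ((Computes.const [decide (d = j)]).and hb.isSome.not)).congr fun x => ?_
    cases a x <;> cases b x <;> simp [JmpParams.verifyPacket, hi, hj]
  bcast := (Computes.nil (Γ := Γ)).congr fun x => by
    cases a x <;> cases b x <;> rfl

omit hi hj in
theorem announcePacket : PacketComputes Γ fun x => (P x).announcePacket (a x) (b x) where
  priv d := (Computes.nil (Γ := Γ)).congr fun x => by cases a x <;> cases b x <;> rfl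
  accuse d := (Computes.const (Γ := Γ) [false]).congr fun x => by
    cases a x <;> cases b x <;> rfl
  bcast := by
    refine ((ha.isSome.and hb.isSome).bool_ite
        ((hh.eq hb.getD).bool_ite .nil hh.optionSome) .nil).congr fun x => ?_
    cases a x <;> cases b x <;>
      simp [JmpParams.announcePacket, encOption, JmpParams.inconsistent]
    rename_i y z
    by_cases h : (P x).h y.toStr = z.toList <;> simp [h]

end Receiver

variable {b b' : X → Option Bool} (hb : Computes Γ fun x => encOption ((b x).map fun b => [b]))

include hk hb in
theorem exchangePacket {other : Server} :
    PacketComputes Γ fun x => (P x).exchangePacket other (b x) where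
  priv d := by
    by_cases hd : d = other
    · exact hb.congr fun x => by cases b x <;> simp [JmpParams.exchangePacket, hd, encOption]
    · exact (Computes.nil (Γ := Γ)).congr fun x => by
        cases b x <;> simp [JmpParams.exchangePacket, hd, encOption]
  accuse d := ((Computes.const [decide (d = k)]).and hb.isSome.not).congr fun x => by
    cases b x <;> simp [JmpParams.exchangePacket, hk]
  bcast := (Computes.nil (Γ := Γ)).congr fun x => by cases b x <;> rfl

include hb in
theorem digestPacket {other : Server} (v : (x : X) → Batch (P x).m (P x).ℓ)
    (hb' : Computes Γ fun x => encOption ((b' x).map fun b => [b]))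
    (hv : Computes Γ fun x => (P x).h (v x).toStr) :
    PacketComputes Γ fun x => (P x).digestPacket (v x) other (b x) (b' x) where
  priv d := (Computes.nil (Γ := Γ)).congr fun x => by cases b x <;> cases b' x <;> rfl
  accuse d := ((Computes.const [decide (d = other)]).and hb'.isSome.not).congr fun x => by
    cases b x <;> cases b' x <;> simp [JmpParams.digestPacket]
  bcast := by
    have key : ∀ {b : X → Option Bool},
        (Computes Γ fun x => encOption ((b x).map fun b => [b])) →
        Computes Γ fun x => [(b x).getD false] := fun h =>
      (h.getD.pick (.const [true]) (.const [false]) (.const [false])).congr fun x => by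
        rename_i b
        rcases b x with _ | _ | _ <;> rfl
    refine ((hb.isSome.and hb'.isSome).bool_ite
      (((key hb).or (key hb')).bool_ite hv.optionSome .nil) .nil).congr fun x => ?_
    rcases b x with _ | _ | _ <;> rcases b' x with _ | _ | _ <;>
      simp [JmpParams.digestPacket, encOption]

end PacketComputes

/-! ## Computing a transcript -/

theorem encView_append_singleton (w : List RoundView) (ρ : RoundView) :
    encView (w ++ [ρ]) = encRound ρ ++ encView w := by
  simp [encView]

theorem length_encSeen_le {q : Seen} {a b : ℕ} (ha : (encOption q.priv).length ≤ a)
    (hb : (encOption q.bcast).length ≤ b) : (encSeen q).length ≤ 2 * a + 2 * b + 9 := by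
  simp only [encSeen, List.length_append, length_encDelim, List.length_ofFn]
  omega

theorem Batch.toStr_succ_last {m ℓ : ℕ} (v : Batch (m + 1) ℓ) :
    v.toStr = Batch.toStr (fun t : Fin m => v t.castSucc) ++ (v (Fin.last m)).toList := by
  rw [Batch.toStr, List.ofFn_succ_last]
  simp [Batch.toStr]

namespace JmpParams

variable (P : JmpParams) (c : Option Server) (v : Batch P.m P.ℓ) (adv : List RoundView → Packet)

/-- The packet of an honest server in a send phase. -/
def sendPacket (t : ℕ) (p : Server) : Packet where
  priv := fun d => if d = P.k then
      if p = P.i then some ((v.toStr.drop (t * P.ℓ)).take P.ℓ)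
      else if p = P.j then if t + 1 = P.m then some (P.h v.toStr) else none
      else none
    else none

/-- The part of a round that stems from the honest servers. -/
def honestPart (ρ : Round) : Round := fun p => if some p = c then {} else ρ p

/-- The string received from `P_i` in the first `t` rounds, if `P_i` was never silent. -/
def recvPrefix : ℕ → Option Str
  | 0 => some []
  | t + 1 => (recvPrefix t).bind fun s =>
      ((((P.roundAt c v adv t P.i).priv P.k).bind (ofLength P.ℓ)).map List.Vector.toList).map (s ++ ·)

/-- The digest received from `P_j` in the last one of the first `t` rounds. -/
def lastDigest : ℕ → Option (List.Vector Bool P.n)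
  | 0 => none
  | t + 1 => ((P.roundAt c v adv t P.j).priv P.k).bind (ofLength P.n)

variable {P c v adv}

/-- In the send phases an honest packet does not depend on the view at all. The loop therefore need
not carry the views of the honest servers. -/
theorem roundAt_send (hij : P.i ≠ P.j) (hik : P.i ≠ P.k) (hjk : P.j ≠ P.k) {p : Server}
    (hp : some p ≠ c) {t : ℕ} (ht : t < P.m) :
    P.roundAt c v adv t p = P.sendPacket v t p := by
  rw [P.roundAt_honest hp]
  rcases Server.eq_of_distinct hij hik hjk p with rfl | rfl | rfl
  · rw [packet_i, senderPacket_send (P.length_viewAt ..) ht]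
    simp [sendPacket, ← Batch.take_drop_toStr v ⟨t, ht⟩]
  · rw [packet_j hij, senderPacket_send (P.length_viewAt ..) ht]
    simp [sendPacket, hij.symm]
  · rw [packet_k hik hjk, receiverPacket_silent (by rw [P.length_viewAt]; omega)
      (by rw [P.length_viewAt]; omega)]
    simp [sendPacket, hik.symm, hjk.symm]

theorem advView_run_succ (T : ℕ) : advView c (P.run c v adv (T + 1)) =
    advView c (P.run c v adv T) ++ [see c (honestPart c (P.roundAt c v adv T))] := by
  rw [run_succ, advView_append]
  rfl

/-- The view of the adversary omits its own packets, so its growth per round is bounded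
independently of the adversary. Each of the three packets contributes at most twice the private
payload plus `9`, the cost of three delimiters and three doubled accusation bits. -/
theorem length_encRound_send_le (hij : P.i ≠ P.j) (hik : P.i ≠ P.k) (hjk : P.j ≠ P.k)
    {t : ℕ} (ht : t < P.m) :
    (encRound (see c (honestPart c (P.roundAt c v adv t)))).length ≤
      6 * (P.ℓ + (P.h v.toStr).length + 1) + 27 := by
  have key : ∀ p, (encSeen (see c (honestPart c (P.roundAt c v adv t)) p)).length ≤
      2 * (P.ℓ + (P.h v.toStr).length + 1) + 2 * 0 + 9 := by
    intro p
    by_cases hp : some p = c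
    · refine length_encSeen_le (a := P.ℓ + (P.h v.toStr).length + 1) (b := 0) ?_ ?_
      · simp only [see, honestPart, if_pos hp]
        cases c <;> simp [encOption]
      · simp [see, honestPart, hp, encOption]
    · refine length_encSeen_le (a := P.ℓ + (P.h v.toStr).length + 1) (b := 0) ?_ ?_
      · simp only [see, honestPart, if_neg hp, roundAt_send hij hik hjk hp ht, sendPacket]
        cases c with
        | none => simp [encOption]
        | some d =>
          simp only [Option.bind_some]
          split_ifs <;> simp [encOption]
      · simp [see, honestPart, hp, encOption, roundAt_send hij hik hjk hp ht, sendPacket]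
  have h₀ := key 0
  have h₁ := key 1
  have h₂ := key 2
  simp only [encRound, List.length_append]
  omega

theorem length_encView_send_le (hij : P.i ≠ P.j) (hik : P.i ≠ P.k) (hjk : P.j ≠ P.k) :
    ∀ t ≤ P.m, (encView (advView c (P.run c v adv t))).length ≤
      t * (6 * (P.ℓ + (P.h v.toStr).length + 1) + 27)
  | 0, _ => by simp [execution, advView, encView]
  | t + 1, ht => by
    have h := length_encView_send_le hij hik hjk t (by omega)
    have h' := length_encRound_send_le (c := c) (v := v) (adv := adv) hij hik hjk
      (show t < P.m by omega)
    rw [advView_run_succ, encView_append_singleton, List.length_append, Nat.add_one_mul]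
    omega

/-- A message that does not have exactly `P.ℓ` bits is discarded, so even a corrupt `P_i` cannot
make this state grow faster. -/
theorem length_recvPrefix_le (t : ℕ) : (encOption (P.recvPrefix c v adv t)).length ≤ t * P.ℓ + 1 := by
  induction t with
  | zero => simp [recvPrefix, encOption]
  | succ t ih =>
    simp only [recvPrefix]
    cases h : P.recvPrefix c v adv t with
    | none => simp [encOption]
    | some s =>
      rw [h] at ih
      cases ((P.roundAt c v adv t P.i).priv P.k).bind (ofLength P.ℓ) with
      | none => simp [encOption]
      | some y =>
        simp only [encOption, List.length_cons, Option.bind_some, Option.map_some,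
          List.length_append, List.Vector.toList_length] at ih ⊢
        rw [Nat.add_one_mul]
        omega

/-- Identifies the incremental description, which a loop can compute, with the all-or-nothing
definition of the received batch. Once a round has failed, both stay `none`. -/
theorem recvPrefix_eq {m ℓ : ℕ} {f : ℕ → Option (List.Vector Bool ℓ)} {g : ℕ → Option Str}
    (h₀ : g 0 = some [])
    (hs : ∀ t, g (t + 1) = (g t).bind fun s => ((f t).map List.Vector.toList).map (s ++ ·)) :
    g m = (if hw : ∀ t : Fin m, (f t).isSome = true then
      some (fun t : Fin m => (f t).get (hw t) : Batch m ℓ) else none).map Batch.toStr := by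
  induction m with
  | zero => simp [h₀, Batch.toStr]
  | succ m ih =>
    rw [hs, ih]
    by_cases hw : ∀ t : Fin m, (f t).isSome = true
    · rw [dif_pos hw]
      cases hm : f m with
      | none =>
        rw [dif_neg fun h => by simpa [hm] using h (Fin.last m)]
        rfl
      | some y =>
        rw [dif_pos fun t => Fin.lastCases (by simp [hm]) (fun t => by simpa using hw t) t]
        rw [Option.map_some, Option.map_some, Option.map_some, Option.bind_some, Option.map_some,
          Batch.toStr_succ_last]
        simp [hm]
    · rw [dif_neg hw, dif_neg fun h => hw fun t => h t.castSucc]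
      rfl

theorem recvPrefix_m : P.recvPrefix c v adv P.m = (P.received c v adv).map Batch.toStr := by
  rw [recvPrefix_eq (m := P.m) (f := fun t => ((P.roundAt c v adv t P.i).priv P.k).bind (ofLength P.ℓ))
    (g := P.recvPrefix c v adv) rfl fun t => rfl]
  congr 1
  unfold received recvBatch
  have h : ∀ t : Fin P.m, P.recvValue (P.viewAt c v adv (some P.k) P.m) t =
      ((P.roundAt c v adv t P.i).priv P.k).bind (ofLength P.ℓ) := fun t => by
    rw [P.recvValue_viewAt t.2]; rfl
  simp only [h]

theorem lastDigest_m (hm : 1 ≤ P.m) : P.lastDigest c v adv P.m = P.receivedHash c v adv := by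
  obtain ⟨m, hm'⟩ : ∃ m, P.m = m + 1 := ⟨P.m - 1, by omega⟩
  unfold receivedHash recvHash
  rw [P.seenAt_viewAt (by omega), hm']
  rfl

end JmpParams

/-- The new view needs only the honest packets of the round, not the corrupt one. It can therefore
be computed first and then fed to the rushing adversary, as `packetComputes_roundAt` does. -/
theorem computes_advView_succ {Y : Type} {Δ : List (Y → Str)} {P : Y → JmpParams}
    {v : (y : Y) → Batch (P y).m (P y).ℓ} {adv : Y → List RoundView → Packet} {T : Y → ℕ}
    {c : Option Server}
    (hpast : Computes Δ fun y => encView (advView c ((P y).run c (v y) (adv y) (T y))))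
    (hhon : ∀ p, some p ≠ c → PacketComputes Δ fun y => (P y).roundAt c (v y) (adv y) (T y) p) :
    Computes Δ fun y => encView (advView c ((P y).run c (v y) (adv y) (T y + 1))) := by
  have h : ∀ p, PacketComputes Δ fun y =>
      JmpParams.honestPart c ((P y).roundAt c (v y) (adv y) (T y)) p := fun p => by
    by_cases hp : some p = c
    · simp only [JmpParams.honestPart, if_pos hp]
      exact .empty
    · simp only [JmpParams.honestPart, if_neg hp]
      exact hhon p hp
  exact ((Computes.encRound (c := c) h).append hpast).congr fun y => by
    rw [JmpParams.advView_run_succ, encView_append_singleton]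

theorem packetComputes_roundAt {Y : Type} {Δ : List (Y → Str)} {P : Y → JmpParams}
    {v : (y : Y) → Batch (P y).m (P y).ℓ} {adv : Y → List RoundView → Packet} {T : Y → ℕ}
    {c : Option Server}
    (hadv : ∀ w : Y → List RoundView, Computes Δ (fun y => encView (w y)) →
      PacketComputes Δ fun y => adv y (w y))
    (hpast : Computes Δ fun y => encView (advView c ((P y).run c (v y) (adv y) (T y))))
    (hhon : ∀ p, some p ≠ c → PacketComputes Δ fun y => (P y).roundAt c (v y) (adv y) (T y) p)
    (p : Server) : PacketComputes Δ fun y => (P y).roundAt c (v y) (adv y) (T y) p := by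
  by_cases hp : some p = c
  · exact (hadv _ (computes_advView_succ hpast hhon)).congr fun y => if_pos hp
  · exact hhon p hp

/-- The data of an execution are computable in polynomial time. -/
structure ExecutionComputes {X : Type} (Γ : List (X → Str)) (i j k : Server) (P : X → JmpParams)
    (v : (x : X) → Batch (P x).m (P x).ℓ) (adv : X → List RoundView → Packet) : Prop where
  hij : i ≠ j
  hik : i ≠ k
  hjk : j ≠ k
  eq_i : ∀ x, (P x).i = i
  eq_j : ∀ x, (P x).j = j
  eq_k : ∀ x, (P x).k = k
  one_le : ∀ x, 1 ≤ (P x).m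
  m : Computes Γ fun x => unary (P x).m
  ℓ : Computes Γ fun x => unary (P x).ℓ
  n : Computes Γ fun x => unary (P x).n
  hash : ∀ s, Computes Γ s → Computes Γ fun x => (P x).h (s x)
  input : Computes Γ fun x => (v x).toStr
  -- The quantification over `Y`, `φ` and `Δ` allows the adversary to be called inside a loop, where
  -- the context contains the state and the index contains the round.
  adv : ∀ (Y : Type) (φ : Y → X) (Δ : List (Y → Str)),
    (∀ g, Computes Γ g → Computes Δ fun y => g (φ y)) →
    ∀ w : Y → List RoundView, Computes Δ (fun y => encView (w y)) →
      PacketComputes Δ fun y => adv (φ y) (w y)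

namespace ExecutionComputes

variable {X : Type} {Γ : List (X → Str)} {i j k : Server} {P : X → JmpParams}
  {v : (x : X) → Batch (P x).m (P x).ℓ} {adv : X → List RoundView → Packet}
  (h : ExecutionComputes Γ i j k P v adv)

include h

theorem ij (x : X) : (P x).i ≠ (P x).j := by rw [h.eq_i, h.eq_j]; exact h.hij
theorem ik (x : X) : (P x).i ≠ (P x).k := by rw [h.eq_i, h.eq_k]; exact h.hik
theorem jk (x : X) : (P x).j ≠ (P x).k := by rw [h.eq_j, h.eq_k]; exact h.hjk

variable (c : Option Server)

/-- The send phases are the only part whose number of rounds varies, hence the only genuine loop.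
The context afterwards holds everything that the verification needs to know about them. -/
theorem send_phase :
    Computes Γ (fun x => encView (advView c ((P x).run c (v x) (adv x) (P x).m))) ∧
    Computes Γ (fun x => encOption (((P x).received c (v x) (adv x)).map Batch.toStr)) ∧
    Computes Γ (fun x => encOption
      (((P x).receivedHash c (v x) (adv x)).map List.Vector.toList)) := by
  have hv := h.hash _ h.input
  have loop := Computes.iterateList (Γ := Γ) (n := fun x => unary (P x).m) (N := fun x => (P x).m)
    -- The state: the adversary's view, the part of the input not yet sent, the number of rounds
    -- left, the values received so far, and the latest digest. The input is consumed and the rounds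
    -- are counted down so that no arithmetic on `t` is needed.
    (S := [fun t x => encView (advView c ((P x).run c (v x) (adv x) t)),
      fun t x => (v x).toStr.drop (t * (P x).ℓ), fun t x => unary ((P x).m - t),
      fun t x => encOption ((P x).recvPrefix c (v x) (adv x) t),
      fun t x => encOption (((P x).lastDigest c (v x) (adv x) t).map List.Vector.toList)])
    (B := fun x => (P x).m * (6 * ((P x).ℓ + ((P x).h (v x).toStr).length + 1) + 27) +
      (v x).toStr.length + (P x).m + ((P x).m * (P x).ℓ + 1) + ((P x).n + 1)) h.m
    (fun x => length_unary _)
    (by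
      have hm : PolyBounded (ctxSize Γ) fun x => (P x).m := h.m.polyBounded.mono fun x => by simp
      have hℓ : PolyBounded (ctxSize Γ) fun x => (P x).ℓ := h.ℓ.polyBounded.mono fun x => by simp
      have hn : PolyBounded (ctxSize Γ) fun x => (P x).n := h.n.polyBounded.mono fun x => by simp
      exact ((((hm.mul (((PolyBounded.const 6).mul ((hℓ.add hv.polyBounded).add (.const 1))).add
        (.const 27))).add h.input.polyBounded).add hm).add ((hm.mul hℓ).add (.const 1))).add
          (hn.add (.const 1)))
    (by
      intro s hs x t ht
      simp only [List.mem_cons, List.not_mem_nil, or_false] at hs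
      rcases hs with rfl | rfl | rfl | rfl | rfl
      · have := JmpParams.length_encView_send_le (c := c) (v := v x) (adv := adv x) (h.ij x)
          (h.ik x) (h.jk x) t ht
        have := Nat.mul_le_mul_right (6 * ((P x).ℓ + ((P x).h (v x).toStr).length + 1) + 27) ht
        dsimp only; omega
      · simp only [List.length_drop]; omega
      · simp only [length_unary]; omega
      · have := JmpParams.length_recvPrefix_le (P := P x) (c := c) (v := v x) (adv := adv x) t
        have := Nat.mul_le_mul_right (P x).ℓ ht
        dsimp only; omega
      · have : (encOption (((P x).lastDigest c (v x) (adv x) t).map List.Vector.toList)).length ≤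
            (P x).n + 1 := by
          cases (P x).lastDigest c (v x) (adv x) t <;> simp [encOption]
        dsimp only; omega)
    (by
      simp only [List.mem_cons, List.not_mem_nil, or_false, forall_eq_or_imp, forall_eq]
      exact ⟨.const [], h.input.congr fun x => by simp, h.m, .const [true], .const []⟩)
    (by
      intro Δ hΔ hΓ
      simp only [List.mem_cons, List.not_mem_nil, or_false, forall_eq_or_imp, forall_eq] at hΔ ⊢
      obtain ⟨h₁, h₂, h₃, h₄, h₅⟩ := hΔ
      have hℓ := hΓ _ h.ℓ
      have hhon : ∀ p, some p ≠ c → PacketComputes Δ fun q =>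
          (P q.1.2).roundAt c (v q.1.2) (adv q.1.2) q.1.1 p := fun p hp => by
        refine PacketComputes.congr (q := fun q => (P q.1.2).sendPacket (v q.1.2) q.1.1 p)
          ⟨fun d => ?_, fun d => .const [false], .nil⟩ fun q =>
            JmpParams.roundAt_send (h.ij _) (h.ik _) (h.jk _) hp q.2
        simp only [JmpParams.sendPacket, h.eq_i, h.eq_j, h.eq_k]
        by_cases hd : d = k
        · simp only [if_pos hd]
          by_cases hpi : p = i
          · simp only [if_pos hpi]
            exact (hℓ.take h₂).optionSome
          · simp only [if_neg hpi]
            by_cases hpj : p = j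
            · simp only [if_pos hpj]
              refine Computes.encOption_ite ?_ (hΓ _ hv).optionSome .nil
              -- The last send phase is recognized by exactly one round being left.
              refine (h₃.eq (.const (unary 1))).congr fun q => ?_
              have hq := q.2
              simp only [List.cons.injEq, and_true, decide_eq_decide, unary, List.replicate_inj,
                or_true]
              omega
            · simp only [if_neg hpj]
              exact .nil
        · simp only [if_neg hd]
          exact .nil
      have hall := packetComputes_roundAt (h.adv _ (fun q => q.1.2) Δ hΓ) h₁ hhon
      have hi := ((hall i).priv k).bind_ofLength hℓ
      have hj := ((hall j).priv k).bind_ofLength (hΓ _ h.n)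
      refine ⟨computes_advView_succ h₁ hhon, ?_, h₃.tail.congr fun q => ?_, ?_, ?_⟩
      · exact (hℓ.drop h₂).congr fun q => by rw [List.drop_drop, Nat.add_one_mul]
      · simp only [unary, List.tail_replicate]
        congr 1
      · refine ((h₄.isSome.and hi.isSome).bool_ite ((h₄.getD.append hi.getD).cons true)
          .nil).congr fun q => ?_
        simp only [JmpParams.recvPrefix, h.eq_i, h.eq_k]
        cases (P q.1.2).recvPrefix c (v q.1.2) (adv q.1.2) q.1.1 <;>
          cases (((P q.1.2).roundAt c (v q.1.2) (adv q.1.2) q.1.1 i).priv k).bind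
            (JmpParams.ofLength (P q.1.2).ℓ) <;> rfl
      · simp only [JmpParams.lastDigest, h.eq_j, h.eq_k]
        exact hj)
  simp only [List.mem_cons, List.not_mem_nil, or_false, forall_eq_or_imp, forall_eq] at loop
  obtain ⟨h₁, -, -, h₄, h₅⟩ := loop
  refine ⟨h₁, h₄.congr fun x => by rw [JmpParams.recvPrefix_m], h₅.congr fun x => by
    rw [JmpParams.lastDigest_m (h.one_le x)]⟩

/-- The transcript of the protocol, the TTP and the value received by `P_k` are computable in
polynomial time. -/
theorem transcript :
    Computes Γ (fun x => encView (advView c ((P x).transcript c (v x) (adv x)))) ∧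
    Computes Γ (fun x => encServer ((P x).ttpAll c (v x) (adv x))) ∧
    Computes Γ (fun x => encOption (((P x).received c (v x) (adv x)).map Batch.toStr)) := by
  obtain ⟨h₀, hX, hY⟩ := h.send_phase c
  have hv := h.hash _ h.input
  have hhX := h.hash _ hX.getD
  have hadv := h.adv X (fun x => x) Γ fun g hg => hg
  have hsplit : ∀ p, p = i ∨ p = j ∨ p = k := Server.eq_of_distinct h.hij h.hik h.hjk
  -- round `m`
  have hon₀ : ∀ p, some p ≠ c → PacketComputes Γ fun x =>
      (P x).roundAt c (v x) (adv x) (P x).m p := by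
    intro p hp
    rcases hsplit p with rfl | rfl | rfl
    · refine PacketComputes.empty.congr fun x => ?_
      rw [(P x).roundAt_honest hp, ← h.eq_i x, JmpParams.packet_i,
        JmpParams.senderPacket_silent ((P x).length_viewAt ..)]
    · refine PacketComputes.empty.congr fun x => ?_
      rw [(P x).roundAt_honest hp, ← h.eq_j x, JmpParams.packet_j (h.ij x),
        JmpParams.senderPacket_silent ((P x).length_viewAt ..)]
    · refine (PacketComputes.verifyPacket P i j h.eq_i h.eq_j hX hY hhX).congr fun x => ?_
      rw [← h.eq_k x] at hp ⊢
      exact JmpParams.roundAt_k_verify (h.ik x) (h.jk x) hp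
  have all₀ := packetComputes_roundAt hadv h₀ hon₀
  have h₁ := computes_advView_succ h₀ hon₀
  have ht₁ : Computes Γ fun x => encServer ((P x).ttp₁ c (v x) (adv x)) :=
    (Computes.ttpOfPair P i j h.eq_i h.eq_j ((all₀ k).accuse i) ((all₀ k).accuse j)).congr
      fun x => by rw [JmpParams.ttp₁, h.eq_i, h.eq_j, h.eq_k]
  have hbit₀ : ∀ s, Computes Γ fun x => encOption
      ((JmpParams.bitOf (((P x).roundAt c (v x) (adv x) (P x).m k).priv s)).map fun b => [b]) :=
    fun s => ((all₀ k).priv s).bitOf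
  -- round `m + 1`
  have hon₁ : ∀ p, some p ≠ c → PacketComputes Γ fun x =>
      (P x).roundAt c (v x) (adv x) ((P x).m + 1) p := by
    intro p hp
    rcases hsplit p with rfl | rfl | rfl
    · refine (PacketComputes.ite ht₁.eq_none (PacketComputes.exchangePacket P k h.eq_k (hbit₀ p)
        (other := j)) .empty).congr fun x => ?_
      rw [← h.eq_i x] at hp
      have := JmpParams.roundAt_i_exchange (v := v x) (adv := adv x) hp
      rwa [h.eq_i, h.eq_j, h.eq_k] at this
    · refine (PacketComputes.ite ht₁.eq_none (PacketComputes.exchangePacket P k h.eq_k (hbit₀ p)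
        (other := i)) .empty).congr fun x => ?_
      rw [← h.eq_j x] at hp
      have := JmpParams.roundAt_j_exchange (v := v x) (adv := adv x) (h.ij x) hp
      rwa [h.eq_i, h.eq_j, h.eq_k] at this
    · refine PacketComputes.empty.congr fun x => ?_
      rw [(P x).roundAt_honest hp, ← h.eq_k x, JmpParams.packet_k (h.ik x) (h.jk x),
        JmpParams.receiverPacket_silent (by rw [(P x).length_viewAt]; omega)
          (by rw [(P x).length_viewAt]; omega)]
  have all₁ := packetComputes_roundAt hadv h₁ hon₁
  have h₂ := computes_advView_succ h₁ hon₁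
  have ht₂ : Computes Γ fun x => encServer ((P x).ttp₂ c (v x) (adv x)) :=
    (Computes.ttpOfPair P i j h.eq_i h.eq_j ((all₁ i).accuse k) ((all₁ j).accuse k)).congr
      fun x => by rw [JmpParams.ttp₂, h.eq_i, h.eq_j, h.eq_k]
  have ht₁₂ := ht₁.option_or ht₂
  have hbit₁ : ∀ p s, Computes Γ fun x => encOption ((JmpParams.bitOf
      (((P x).roundAt c (v x) (adv x) ((P x).m + 1) p).priv s)).map fun b => [b]) :=
    fun p s => ((all₁ p).priv s).bitOf
  -- round `m + 2`
  have hon₂ : ∀ p, some p ≠ c → PacketComputes Γ fun x =>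
      (P x).roundAt c (v x) (adv x) ((P x).m + 2) p := by
    intro p hp
    rcases hsplit p with rfl | rfl | rfl
    · refine (PacketComputes.ite ht₁₂.eq_none (PacketComputes.digestPacket P (hbit₀ p)
        (other := j) v (hbit₁ j p) hv) .empty).congr fun x => ?_
      rw [← h.eq_i x] at hp
      have := JmpParams.roundAt_i_digest (v := v x) (adv := adv x) hp
      rwa [h.eq_i, h.eq_j, h.eq_k] at this
    · refine (PacketComputes.ite ht₁₂.eq_none (PacketComputes.digestPacket P (hbit₀ p)
        (other := i) v (hbit₁ i p) hv) .empty).congr fun x => ?_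
      rw [← h.eq_j x] at hp
      have := JmpParams.roundAt_j_digest (v := v x) (adv := adv x) (h.ij x) hp
      rwa [h.eq_i, h.eq_j, h.eq_k] at this
    · refine (PacketComputes.ite ht₁₂.eq_none (PacketComputes.announcePacket P hX hY hhX)
        .empty).congr fun x => ?_
      rw [← h.eq_k x] at hp ⊢
      exact JmpParams.roundAt_k_announce (h.ik x) (h.jk x) hp (h.one_le x)
  have all₂ := packetComputes_roundAt hadv h₂ hon₂
  have h₃ := computes_advView_succ h₂ hon₂
  have ht₃ : Computes Γ fun x => encServer ((P x).ttp₃ c (v x) (adv x)) := by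
    have hor := ((all₂ i).accuse j).or ((all₂ j).accuse i)
    refine (hor.bool_ite (.const (encServer (some k))) .nil).congr fun x => ?_
    rw [JmpParams.ttp₃, h.eq_i, h.eq_j, h.eq_k]
    cases (((P x).roundAt c (v x) (adv x) ((P x).m + 2) i).accuse j ||
      ((P x).roundAt c (v x) (adv x) ((P x).m + 2) j).accuse i) <;> rfl
  have hd : ∀ p, Computes Γ fun x =>
      encOption (((P x).digest c (v x) (adv x) p).map List.Vector.toList) :=
    fun p => (all₂ p).bcast.bind_ofLength h.n
  have ht₄ : Computes Γ fun x => encServer ((P x).ttp₄ c (v x) (adv x)) :=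
    (Computes.ttpOfDigests P i j k h.eq_i h.eq_j h.eq_k (hd i) (hd j) (hd k)).congr
      fun x => by rw [JmpParams.ttp₄, h.eq_i, h.eq_j, h.eq_k]
  exact ⟨h₃, (ht₁₂.option_or ht₃).option_or ht₄, hX⟩

end ExecutionComputes

/-! ## Probabilities -/

theorem prob_eq_card {Ω : Type} [Fintype Ω] (E : Ω → Prop) [DecidablePred E] :
    prob E = ((Finset.univ.filter E).card : ℝ) / Fintype.card Ω := by
  rw [prob, Nat.card_eq_fintype_card, Nat.card_eq_fintype_card, Fintype.card_subtype]

theorem prob_nonneg {Ω : Type} [Fintype Ω] (E : Ω → Prop) : 0 ≤ prob E := by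
  unfold prob; positivity

theorem prob_mono {Ω : Type} [Fintype Ω] {E B : Ω → Prop} (h : ∀ ω, E ω → B ω) :
    prob E ≤ prob B := by
  classical
  rw [prob_eq_card, prob_eq_card]
  gcongr with ω
  exact h ω

theorem prob_le_add {Ω : Type} [Fintype Ω] {E E' B : Ω → Prop} (h : ∀ ω, ¬ B ω → (E ω → E' ω)) :
    prob E ≤ prob E' + prob B := by
  classical
  rw [prob_eq_card, prob_eq_card, prob_eq_card, ← add_div]
  gcongr
  norm_cast
  refine (Finset.card_le_card fun ω hω => ?_).trans (Finset.card_union_le _ _)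
  simp only [Finset.mem_union, Finset.mem_filter, Finset.mem_univ, true_and] at hω ⊢
  by_cases hB : B ω
  · exact Or.inr hB
  · exact Or.inl (h ω hB hω)

/-- The difference lemma: events that coincide outside `B` differ in probability by at most that of
`B`. It requires both experiments to live on one sample space. -/
theorem abs_prob_sub_le {Ω : Type} [Fintype Ω] {E E' B : Ω → Prop}
    (h : ∀ ω, ¬ B ω → (E ω ↔ E' ω)) : |prob E - prob E'| ≤ prob B := by
  have h₁ := prob_le_add (B := B) fun ω hω => (h ω hω).1
  have h₂ := prob_le_add (B := B) fun ω hω => (h ω hω).2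
  rw [abs_le]
  constructor <;> linarith

theorem prob_congr {Ω Ω' : Type} [Fintype Ω] [Fintype Ω'] (e : Ω ≃ Ω') {E : Ω → Prop}
    {E' : Ω' → Prop} (h : ∀ ω, E ω ↔ E' (e ω)) : prob E = prob E' := by
  unfold prob
  rw [Nat.card_congr e, Nat.card_congr (e.subtypeEquiv h)]

theorem Negligible.of_le {f g : ℕ → ℝ} (hg : Negligible g) (h₀ : ∀ κ, 0 ≤ f κ)
    (h : ∀ κ, f κ ≤ g κ) : Negligible f :=
  Asymptotics.SuperpolynomialDecay.trans_abs_le hg fun κ => by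
    rw [abs_of_nonneg (h₀ κ)]
    exact (h κ).trans (le_abs_self _)

theorem str_append {a b : ℕ} (ω : Fin a → Bool) (ω' : Fin b → Bool) :
    str (Fin.append ω ω') = str ω ++ str ω' := List.ofFn_fin_append ω ω'

@[simp] theorem length_str {n : ℕ} (ω : Fin n → Bool) : (str ω).length = n := List.length_ofFn

/-- Without corruption, an observer of the broadcasts sees nothing. -/
theorem JmpParams.advView_run_none {P : JmpParams} {v : Batch P.m P.ℓ}
    {adv : List RoundView → Packet} (hij : P.i ≠ P.j) (hik : P.i ≠ P.k) (hjk : P.j ≠ P.k)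
    (hm : 1 ≤ P.m) (hP : ∀ x, (P.h x).length = P.n) (T : ℕ) (hT : T ≤ P.m + 3) :
    advView none (P.run none v adv T) = List.replicate T fun _ => {} := by
  induction T with
  | zero => rfl
  | succ T ih =>
    rw [advView_run_succ, ih (by omega), List.replicate_succ']
    congr 2
    funext p
    obtain ⟨h₁, h₂⟩ := honest_silent (v := v) (adv := adv) hij hik hjk hm hP T hT p
    simp only [see, honestPart, reduceCtorEq, if_false, h₁, h₂, Option.bind_none]

/-! ## The simulator -/

namespace JmpSetting

variable (E : JmpSetting) (c : Option Server) (A : Adversary)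

/-- The parameters of the protocol, with a digest length that can be computed for every key. -/
def simParams (κ : ℕ) (key : Str) : JmpParams where
  i := E.i
  j := E.j
  k := E.k
  m := E.m κ
  ℓ := E.ℓ κ
  n := (E.H.hash κ key []).length
  h := E.H.hash κ key

/-- The strategy of an adversary on given inputs and coins. -/
def advStrategy (κ : ℕ) (key aux : Str) (v : Batch (E.m κ) (E.ℓ κ)) (r : Str) :
    List RoundView → Packet :=
  fun w => A.next κ ![key, aux, E.corruptInput c v, r, encView w]

/-- The view of an adversary on given inputs and coins. -/
def runView (κ : ℕ) (key aux : Str) (v : Batch (E.m κ) (E.ℓ κ)) (r : Str) : List RoundView :=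
  advView c ((E.simParams κ key).transcript c v (E.advStrategy c A κ key aux v r))

/-- The TTP in the execution with an adversary on given inputs and coins. -/
def runTtp (κ : ℕ) (key aux : Str) (v : Batch (E.m κ) (E.ℓ κ)) (r : Str) : Option Server :=
  (E.simParams κ key).ttpAll c v (E.advStrategy c A κ key aux v r)

/-- The output of an adversary on given inputs and coins. -/
def runFinal (κ : ℕ) (key aux : Str) (v : Batch (E.m κ) (E.ℓ κ)) (r : Str) : Str :=
  A.final κ ![key, aux, E.corruptInput c v, r, encView (E.runView c A κ key aux v r)]

variable {E c A}

/-- The digest length of a `HashFamily` is not assumed to be computable, so the simulator reads it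
off the digest of the empty string. For keys of the correct length this is the same number, hence
the same protocol. -/
theorem ttpAll_simParams {κ : ℕ} {key : Str} (hkey : key.length = E.H.keyLen κ)
    (v : Batch (E.m κ) (E.ℓ κ)) (adv : List RoundView → Packet) :
    (E.simParams κ key).ttpAll c v adv = (E.params κ key).ttpAll c v adv := by
  have : ∀ n n', n = n' →
      (JmpParams.mk E.i E.j E.k (E.m κ) (E.ℓ κ) n (E.H.hash κ key)).ttpAll c v adv =
      (JmpParams.mk E.i E.j E.k (E.m κ) (E.ℓ κ) n' (E.H.hash κ key)).ttpAll c v adv := by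
    rintro n _ rfl; rfl
  exact this _ _ (E.H.length_hash κ key [] hkey)

theorem runTtp_eq {κ : ℕ} {key : Str} (hkey : key.length = E.H.keyLen κ) (aux : Str)
    (v : Batch (E.m κ) (E.ℓ κ)) (r : Str) : E.runTtp c A κ key aux v r =
      (E.params κ key).ttpAll c v (E.advStrategy c A κ key aux v r) :=
  ttpAll_simParams hkey _ _

theorem runView_eq {κ : ℕ} {key : Str} (hkey : key.length = E.H.keyLen κ) (aux : Str)
    (v : Batch (E.m κ) (E.ℓ κ)) (r : Str) : E.runView c A κ key aux v r =
      advView c ((E.params κ key).transcript c v (E.advStrategy c A κ key aux v r)) := by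
  have : ∀ n n', n = n' → ∀ adv,
      (JmpParams.mk E.i E.j E.k (E.m κ) (E.ℓ κ) n (E.H.hash κ key)).transcript c v adv =
      (JmpParams.mk E.i E.j E.k (E.m κ) (E.ℓ κ) n' (E.H.hash κ key)).transcript c v adv := by
    rintro n _ rfl _; rfl
  exact congrArg (advView c) (this _ _ (E.H.length_hash κ key [] hkey) _)

theorem received_simParams {κ : ℕ} {key : Str} (hkey : key.length = E.H.keyLen κ)
    (v : Batch (E.m κ) (E.ℓ κ)) (adv : List RoundView → Packet) :
    ((E.simParams κ key).received c v adv).map Batch.toStr =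
      ((E.params κ key).received c v adv).map Batch.toStr := by
  have : ∀ n n', n = n' →
      ((JmpParams.mk E.i E.j E.k (E.m κ) (E.ℓ κ) n (E.H.hash κ key)).received c v adv).map
        Batch.toStr =
      ((JmpParams.mk E.i E.j E.k (E.m κ) (E.ℓ κ) n' (E.H.hash κ key)).received c v adv).map
        Batch.toStr := by
    rintro n _ rfl; rfl
  exact this _ _ (E.H.length_hash κ key [] hkey)

section Computes

variable {X : Type} {Γ : List (X → Str)} {κ : X → ℕ} {key aux r : X → Str}
  {v : (x : X) → Batch (E.m (κ x)) (E.ℓ (κ x))}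

theorem computes_hash {s : X → Str} (hκ : Computes Γ fun x => unary (κ x)) (hkey : Computes Γ key)
    (hs : Computes Γ s) : Computes Γ fun x => E.H.hash (κ x) (key x) (s x) :=
  PolyTimeFamily.computes E.H.polyTime hκ (args := fun x => ![key x, s x])
    (fun r => by fin_cases r; exacts [hkey, hs]) 0

theorem computes_corruptInput (hv : Computes Γ fun x => (v x).toStr) :
    Computes Γ fun x => E.corruptInput c (v x) := by
  unfold corruptInput
  split_ifs
  · exact hv
  · exact .nil

theorem executionComputes (hij : E.i ≠ E.j) (hik : E.i ≠ E.k) (hjk : E.j ≠ E.k)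
    (hm : PolyLength E.m) (hℓ : PolyLength E.ℓ) (hm₁ : ∀ κ, 1 ≤ E.m κ)
    (hκ : Computes Γ fun x => unary (κ x)) (hkey : Computes Γ key) (haux : Computes Γ aux)
    (hv : Computes Γ fun x => (v x).toStr) (hr : Computes Γ r) :
    ExecutionComputes Γ E.i E.j E.k (fun x => E.simParams (κ x) (key x)) v
      (fun x => E.advStrategy c A (κ x) (key x) (aux x) (v x) (r x)) where
  hij := hij
  hik := hik
  hjk := hjk
  eq_i _ := rfl
  eq_j _ := rfl
  eq_k _ := rfl
  one_le x := hm₁ (κ x)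
  m := hm.computes hκ
  ℓ := hℓ.computes hκ
  n := (computes_hash hκ hkey .nil).unaryLength
  hash _ hs := computes_hash hκ hkey hs
  input := hv
  adv Y φ Δ hΔ w hw := .of_encPacket fun o =>
    A.next_polyTime.computes (hΔ _ hκ) (args := fun y => ![key (φ y), aux (φ y),
      E.corruptInput c (v (φ y)), r (φ y), encView (w y)]) (fun s => by
        fin_cases s
        exacts [hΔ _ hkey, hΔ _ haux, hΔ _ (computes_corruptInput hv), hΔ _ hr, hw]) o

theorem computes_ofStr {s : X → Str} (hm : PolyLength E.m) (hℓ : PolyLength E.ℓ)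
    (hκ : Computes Γ fun x => unary (κ x)) (hs : Computes Γ s) :
    Computes Γ fun x => (Batch.ofStr (E.m (κ x)) (E.ℓ (κ x)) (s x)).toStr := by
  have h := (hm.computes hκ).unaryMul (hℓ.computes hκ)
  exact (h.take (hs.append h.zeros)).congr fun x => Batch.toStr_ofStr _

end Computes

section Simulator

variable (hij : E.i ≠ E.j) (hik : E.i ≠ E.k) (hjk : E.j ≠ E.k)
    (hm : PolyLength E.m) (hℓ : PolyLength E.ℓ) (hm₁ : ∀ κ, 1 ≤ E.m κ)

/-- The simulator runs the protocol with the adversary on the common value. -/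
def simulator (c : Option Server) (A : Adversary) : Simulator E.m E.ℓ where
  coinLen := A.coinLen
  coinLen_poly := A.coinLen_poly
  -- Reading the batch by padding or cutting makes the simulator total on arbitrary strings. Without
  -- corruption the string is empty and the simulated input is the zero batch.
  input κ y := some (Batch.ofStr _ _ (y 2))
  select κ y := E.runTtp c A κ (y 0) (y 1) (Batch.ofStr _ _ (y 2)) (y 3)
  message_polyTime := polyTimeFamily_of_computes fun o => by
    have hκ := computes_familyInputs_unary 4
    have hin := computes_familyInputs (a := 4)
    have hv := computes_ofStr hm hℓ hκ (hin 2)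
    fin_cases o
    · exact hv.optionSome
    · exact ((executionComputes hij hik hjk hm hℓ hm₁ hκ (hin 0) (hin 1) hv
        (hin 3)).transcript c).2.1
  final κ y := E.runFinal c A κ (y 0) (y 1) (Batch.ofStr _ _ (y 2)) (y 3)
  final_polyTime := polyTimeFamily_of_computes fun o => by
    have hκ := computes_familyInputs_unary 5
    have hin := computes_familyInputs (a := 5)
    have hv := computes_ofStr hm hℓ hκ (hin 2)
    have ht := ((executionComputes (c := c) (A := A) hij hik hjk hm hℓ hm₁ hκ (hin 0) (hin 1) hv
      (hin 3)).transcript c).1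
    fin_cases o
    exact A.final_polyTime.computes hκ (fun s => by
      fin_cases s
      exacts [hin 0, hin 1, computes_corruptInput hv, hin 3, ht]) 0

/-- The algorithm that runs the environment and the protocol with the adversary and returns the
common value and the value received by `P_k`. -/
def finder (c : Option Server) (A : Adversary) (Z : Environment E.m E.ℓ) : CollisionFinder where
  coinLen κ := Z.coinLen κ + A.coinLen κ
  coinLen_poly := polyTimeFamily_of_computes fun o => by
    have hκ := computes_familyInputs_unary 0
    fin_cases o
    exact (Z.coinLen_poly.computes hκ).unaryAdd (A.coinLen_poly.computes hκ)
  attempt κ y :=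
    ((Z.input κ ![y 0, (y 1).take (Z.coinLen κ)]).toStr,
      -- The coins are split between environment and adversary. The default `[]` is used only if
      -- `P_k` received no complete batch, in which case there is no collision to be found.
      (((E.simParams κ (y 0)).received c (Z.input κ ![y 0, (y 1).take (Z.coinLen κ)])
        (E.advStrategy c A κ (y 0) (Z.aux κ ![y 0, (y 1).take (Z.coinLen κ)])
          (Z.input κ ![y 0, (y 1).take (Z.coinLen κ)])
          ((y 1).drop (Z.coinLen κ)))).map Batch.toStr).getD [])
  polyTime := polyTimeFamily_of_computes fun o => by
    have hκ := computes_familyInputs_unary 2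
    have hin := computes_familyInputs (a := 2)
    have hZ := Z.coinLen_poly.computes hκ
    have hargs : ∀ s, Computes (familyInputs 2)
        fun q => ![q.2 0, (q.2 1).take (Z.coinLen q.1)] s := fun s => by
      fin_cases s
      exacts [hin 0, hZ.take (hin 1)]
    have hv := Z.input_polyTime.computes hκ hargs 0
    have haux := Z.input_polyTime.computes hκ hargs 1
    fin_cases o
    · exact hv
    · exact ((executionComputes (A := A) hij hik hjk hm hℓ hm₁ hκ (hin 0) haux hv
        (hZ.drop (hin 1))).transcript c).2.2.getD

end Simulator

/-! ## Security -/

/-- `P_k` receives a value that differs from the common value but has the same digest. -/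
def Collides (E : JmpSetting) (c : Option Server) (A : Adversary) (Z : Environment E.m E.ℓ)
    (κ : ℕ) (key rZ rA : Str) : Prop :=
  ∃ x, (E.params κ key).received c (Z.input κ ![key, rZ]) (E.strategy c A Z κ key rZ rA) = some x ∧
    x ≠ Z.input κ ![key, rZ] ∧
    E.H.hash κ key x.toStr = E.H.hash κ key (Z.input κ ![key, rZ]).toStr

section Security

variable (hij : E.i ≠ E.j) (hik : E.i ≠ E.k) (hjk : E.j ≠ E.k) (hm₁ : ∀ κ, 1 ≤ E.m κ)
  {Z : Environment E.m E.ℓ} {κ : ℕ} {key rZ rA : Str} (hkey : key.length = E.H.keyLen κ)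

include hij hik hjk hm₁ hkey

/-- In the branch without a TTP an honest `P_k` holds a value with the digest of `v`; in the absence
of a collision this value is `v` itself, as in the ideal world. -/
theorem outcome_of_not_collides (h : ¬ E.Collides c A Z κ key rZ rA) :
    ((E.params κ key).ttpAll c (Z.input κ ![key, rZ]) (E.strategy c A Z κ key rZ rA) = none ∧
      ∀ s, some s ≠ c → E.realOutput c A Z κ key rZ rA s =
        if s = E.k then Output.val (Z.input κ ![key, rZ]) else Output.bot) ∨
    ∃ t, (E.params κ key).ttpAll c (Z.input κ ![key, rZ]) (E.strategy c A Z κ key rZ rA) = some t ∧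
      some t ≠ c ∧ ∀ s, E.realOutput c A Z κ key rZ rA s = Output.ttp t := by
  have hP : ∀ x, ((E.params κ key).h x).length = (E.params κ key).n := fun x =>
    E.H.length_hash κ key x hkey
  rcases JmpParams.outcome (P := E.params κ key) (v := Z.input κ ![key, rZ])
    (adv := E.strategy c A Z κ key rZ rA) hij hik hjk (hm₁ κ) hP c with ⟨h₁, h₂⟩ | ⟨t, h₁, h₂⟩
  · refine Or.inl ⟨h₁, fun s hs => JmpParams.result_of_ttpAll_eq_none h₁ fun hk => ?_⟩
    subst hk
    obtain ⟨x, hx, hh⟩ := h₂ hs.symm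
    by_cases hxv : x = Z.input κ ![key, rZ]
    · rw [hx, hxv]
    · exact absurd ⟨x, hx, hxv, hh⟩ h
  · exact Or.inr ⟨t, h₁, h₂, JmpParams.result_eq_ttp h₁⟩

theorem successful_of_not_collides (h : ¬ E.Collides c A Z κ key rZ rA) :
    E.Successful c (Z.input κ ![key, rZ]) (E.realOutput c A Z κ key rZ rA) := by
  rcases outcome_of_not_collides hij hik hjk hm₁ hkey h with ⟨-, h⟩ | ⟨t, -, ht, h⟩
  · exact Or.inl h
  · exact Or.inr ⟨t, ht, fun s _ => h s⟩

variable (hm : PolyLength E.m) (hℓ : PolyLength E.ℓ)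

/-- The view is the same for every input `v`, so a simulator that runs the protocol on the zero
batch is not noticed. -/
theorem runView_none (aux : Str) (v : Batch (E.m κ) (E.ℓ κ)) (r : Str) :
    E.runView none A κ key aux v r = List.replicate (E.m κ + 3) fun _ => {} :=
  (runView_eq hkey aux v r).trans (JmpParams.advView_run_none (P := E.params κ key) hij hik hjk
    (hm₁ κ) (fun x => E.H.length_hash κ key x hkey) _ le_rfl)

theorem runTtp_none (aux : Str) (v : Batch (E.m κ) (E.ℓ κ)) (r : Str) :
    E.runTtp none A κ key aux v r = none :=
  (runTtp_eq hkey aux v r).trans (JmpParams.outcome_none (P := E.params κ key) hij hik hjk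
    (hm₁ κ) (fun x => E.H.length_hash κ key x hkey))

theorem select_simulator : (simulator hij hik hjk hm hℓ hm₁ c A).select κ
    (E.simInput c Z κ key rZ rA) =
      (E.params κ key).ttpAll c (Z.input κ ![key, rZ]) (E.strategy c A Z κ key rZ rA) := by
  have h : (simulator hij hik hjk hm hℓ hm₁ c A).select κ (E.simInput c Z κ key rZ rA) =
      E.runTtp c A κ key (Z.aux κ ![key, rZ])
        (Batch.ofStr _ _ (if c = none then [] else (Z.input κ ![key, rZ]).toStr)) rA := rfl
  have h' : (E.params κ key).ttpAll c (Z.input κ ![key, rZ]) (E.strategy c A Z κ key rZ rA) =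
      E.runTtp c A κ key (Z.aux κ ![key, rZ]) (Z.input κ ![key, rZ]) rA :=
    (runTtp_eq hkey _ _ _).symm
  rw [h, h']
  -- Without corruption both sides are `none`, although the inputs differ. With corruption the
  -- simulator recovers the true input from its encoding.
  cases c with
  | none => rw [runTtp_none hij hik hjk hm₁ hkey, runTtp_none hij hik hjk hm₁ hkey]
  | some s => rw [if_neg (by simp), Batch.ofStr_toStr]

omit hij hik hjk hm₁ in
theorem realFinal_eq : E.realFinal c A Z κ key rZ rA =
    E.runFinal c A κ key (Z.aux κ ![key, rZ]) (Z.input κ ![key, rZ]) rA :=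
  congrArg (fun w => A.final κ ![key, Z.aux κ ![key, rZ],
    E.corruptInput c (Z.input κ ![key, rZ]), rA, encView w]) (runView_eq hkey _ _ _).symm

theorem final_simulator (x : Str) : (simulator hij hik hjk hm hℓ hm₁ c A).final κ
    ![key, Z.aux κ ![key, rZ], if c = none then [] else (Z.input κ ![key, rZ]).toStr, rA, x] =
      E.realFinal c A Z κ key rZ rA := by
  have h : (simulator hij hik hjk hm hℓ hm₁ c A).final κ
      ![key, Z.aux κ ![key, rZ], if c = none then [] else (Z.input κ ![key, rZ]).toStr, rA, x] =
      E.runFinal c A κ key (Z.aux κ ![key, rZ])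
        (Batch.ofStr _ _ (if c = none then [] else (Z.input κ ![key, rZ]).toStr)) rA := rfl
  rw [h, realFinal_eq hkey]
  cases c with
  | none =>
    unfold runFinal
    rw [runView_none hij hik hjk hm₁ hkey, runView_none hij hik hjk hm₁ hkey]
    rfl
  | some s => rw [if_neg (by simp), Batch.ofStr_toStr]

/-- In the name of a corrupt sender the simulator hands in `v`, so the functionality sees equal
inputs and its output depends only on the selection. That selection is the TTP of the real
execution, which is honest if it exists and is therefore not overridden. -/
theorem idealOutput_simulator (h : ¬ E.Collides c A Z κ key rZ rA) {s : Server}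
    (hs : some s ≠ c) : E.idealOutput c (simulator hij hik hjk hm hℓ hm₁ c A) Z κ key rZ rA s =
      E.realOutput c A Z κ key rZ rA s := by
  have hinput : ∀ t, (if c = some t then (simulator hij hik hjk hm hℓ hm₁ c A).input κ
      (E.simInput c Z κ key rZ rA) else some (Z.input κ ![key, rZ])) =
        some (Z.input κ ![key, rZ]) := by
    intro t
    split_ifs with hc
    · subst hc
      exact congrArg some (Batch.ofStr_toStr _)
    · rfl
  unfold idealOutput
  rw [hinput, hinput, select_simulator hij hik hjk hm₁ hkey hm hℓ]
  rcases outcome_of_not_collides hij hik hjk hm₁ hkey h with ⟨h₁, h₂⟩ | ⟨t, h₁, ht, h₂⟩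
  · rw [h₁, h₂ s hs]
    simp [idealJmp]
  · rw [h₁, h₂ s]
    simp [idealJmp, ht]

theorem verdict_simulator (h : ¬ E.Collides c A Z κ key rZ rA) :
    E.verdict c Z κ key rZ (E.realOutput c A Z κ key rZ rA) (E.realFinal c A Z κ key rZ rA) =
    E.verdict c Z κ key rZ
      (E.idealOutput c (simulator hij hik hjk hm hℓ hm₁ c A) Z κ key rZ rA)
      (E.idealFinal c (simulator hij hik hjk hm hℓ hm₁ c A) Z κ key rZ rA) := by
  have hf : E.idealFinal c (simulator hij hik hjk hm hℓ hm₁ c A) Z κ key rZ rA =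
      E.realFinal c A Z κ key rZ rA := final_simulator hij hik hjk hm₁ hkey hm hℓ _
  have ho : ∀ s, (if some s = c then [] else encOutput
      (E.idealOutput c (simulator hij hik hjk hm hℓ hm₁ c A) Z κ key rZ rA s)) =
      if some s = c then [] else encOutput (E.realOutput c A Z κ key rZ rA s) := fun s => by
    split_ifs with hs
    · rfl
    · rw [idealOutput_simulator hij hik hjk hm₁ hkey hm hℓ h hs]
  unfold verdict
  rw [hf, ho, ho, ho]

end Security

section Negligible

variable (hij : E.i ≠ E.j) (hik : E.i ≠ E.k) (hjk : E.j ≠ E.k) (hm₁ : ∀ κ, 1 ≤ E.m κ)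
  (hm : PolyLength E.m) (hℓ : PolyLength E.ℓ) (hH : E.H.CollisionResistant)
  (Z : Environment E.m E.ℓ)

include hij hik hjk hm₁ hm hℓ hH

/-- Whenever the event occurs, the finder on the same key and coins outputs the common value and the
value accepted by `P_k`: different strings with equal digests. -/
theorem negligible_collides (c : Option Server) (A : Adversary) : Negligible fun κ =>
    prob fun ω : (Fin (E.H.keyLen κ) → Bool) × (Fin (Z.coinLen κ) → Bool) ×
        (Fin (A.coinLen κ) → Bool) =>
      E.Collides c A Z κ (str ω.1) (str ω.2.1) (str ω.2.2) := by
  refine (hH (finder hij hik hjk hm hℓ hm₁ c A Z)).of_le (fun κ => prob_nonneg _) fun κ => ?_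
  -- Concatenating the coins of environment and adversary is a bijection onto the coins of the
  -- finder, so the uniform distributions correspond.
  set F : (Fin (E.H.keyLen κ) → Bool) × (Fin (Z.coinLen κ) → Bool) × (Fin (A.coinLen κ) → Bool) ≃
      (Fin (E.H.keyLen κ) → Bool) × (Fin (Z.coinLen κ + A.coinLen κ) → Bool) :=
    (Equiv.refl _).prodCongr (Fin.appendEquiv _ _)
  refine le_trans (prob_mono fun ω hω => ?_) (prob_congr F fun ω => Iff.rfl).le
  obtain ⟨x, hx, hne, hh⟩ := hω
  have h₁ : str (F ω).1 = str ω.1 := rfl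
  have h₂ : str (F ω).2 = str ω.2.1 ++ str ω.2.2 := str_append _ _
  have ht : (str ω.2.1 ++ str ω.2.2).take (Z.coinLen κ) = str ω.2.1 := by
    rw [List.take_append_of_le_length (by simp), List.take_of_length_le (by simp)]
  have hd : (str ω.2.1 ++ str ω.2.2).drop (Z.coinLen κ) = str ω.2.2 :=
    List.drop_left' (length_str _)
  have ha : (finder hij hik hjk hm hℓ hm₁ c A Z).attempt κ ![str (F ω).1, str (F ω).2] =
      ((Z.input κ ![str ω.1, str ω.2.1]).toStr, x.toStr) := by
    have hr := received_simParams (c := c) (length_str ω.1) (Z.input κ ![str ω.1, str ω.2.1])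
      (E.strategy c A Z κ (str ω.1) (str ω.2.1) (str ω.2.2))
    rw [hx] at hr
    rw [h₁, h₂]
    simp only [finder, Matrix.cons_val_zero, Matrix.cons_val_one]
    rw [ht, hd]
    exact congrArg (fun o => ((Z.input κ ![str ω.1, str ω.2.1]).toStr, Option.getD o [])) hr
  have key : ∀ r : Str × Str, r = ((Z.input κ ![str ω.1, str ω.2.1]).toStr, x.toStr) →
      r.1 ≠ r.2 ∧ E.H.hash κ (str ω.1) r.1 = E.H.hash κ (str ω.1) r.2 := by
    rintro _ rfl
    exact ⟨fun e => hne (Batch.toStr_injective e.symm), hh.symm⟩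
  exact key _ ha

/-- The sample spaces of the two worlds coincide because the simulator has the coins of the
adversary; the verdicts agree at every outcome without a collision. -/
theorem securelyRealizes : E.SecurelyRealizes := fun c A =>
  ⟨simulator hij hik hjk hm hℓ hm₁ c A, fun Z =>
    (negligible_collides hij hik hjk hm₁ hm hℓ hH Z c A).of_le (fun _ => abs_nonneg _) fun _ =>
      abs_prob_sub_le fun ω hω => iff_of_eq (congrArg (· = true)
        (verdict_simulator hij hik hjk hm₁ (length_str ω.1) hm hℓ hω))⟩

theorem negligible_failureProb (c : Option Server) (A : Adversary) :
    Negligible (E.failureProb c A Z) :=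
  (negligible_collides hij hik hjk hm₁ hm hℓ hH Z c A).of_le (fun _ => prob_nonneg _) fun _ =>
    prob_mono fun ω hω => not_not.1 fun h =>
      hω (successful_of_not_collides hij hik hjk hm₁ (length_str ω.1) h)

end Negligible

end JmpSetting

/-! ### The main theorem -/

open Filter Topology in
theorem mainTheorem2 (H : HashFamily) (i j k : Server) (hij : i ≠ j) (hik : i ≠ k) (hjk : j ≠ k) :
    -- security, for polynomially many messages of polynomial length
    (H.CollisionResistant → ∀ m ℓ : ℕ → ℕ, PolyLength m → PolyLength ℓ → (∀ κ, 1 ≤ m κ) →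
      (JmpSetting.mk H i j k m ℓ).SecurelyRealizes ∧
      ∀ (c : Option Server) (A : Adversary) (Z : Environment m ℓ),
        Negligible ((JmpSetting.mk H i j k m ℓ).failureProb c A Z)) ∧
    -- if no server is corrupt, the receiver obtains the values
    (∀ (κ : ℕ) (key : Str), key.length = H.keyLen κ → ∀ m ℓ : ℕ, 1 ≤ m →
      ∀ (v : Batch m ℓ) (adv : List RoundView → Packet) (s : Server),
        (JmpParams.mk i j k m ℓ (H.outLen κ) (H.hash κ key)).result none v adv s =
          if s = k then Output.val v else Output.bot) ∧
    -- a send phase takes one round and `ℓ` bits: the `t`-th value is sent in round `t`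
    (∀ (κ : ℕ) (key : Str), key.length = H.keyLen κ → ∀ (m ℓ : ℕ) (v : Batch m ℓ)
      (adv : List RoundView → Packet) (t : Fin m),
        (((JmpParams.mk i j k m ℓ (H.outLen κ) (H.hash κ key)).transcript none v adv)[(t : ℕ)]?.map
          fun ρ => (ρ i).priv k) = some (some (v t).toList)) ∧
    -- whatever one corrupt server does, `m` messages take `m + 3` rounds and `m ℓ` bits, up to an
    -- overhead that depends neither on `m` nor on `ℓ`
    (∃ C : ℕ, ∀ (κ : ℕ) (key : Str), key.length = H.keyLen κ → ∀ m ℓ : ℕ, 1 ≤ m →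
      ∀ (c : Option Server) (v : Batch m ℓ) (adv : List RoundView → Packet),
        ((JmpParams.mk i j k m ℓ (H.outLen κ) (H.hash κ key)).transcript c v adv).length = m + 3 ∧
        honestBits c ((JmpParams.mk i j k m ℓ (H.outLen κ) (H.hash κ key)).transcript c v adv) ≤
          m * ℓ + C * (H.outLen κ + 1)) ∧
    -- amortized: one round and `ℓ` bits per message, that is, rate one
    (∀ (κ : ℕ) (key : Str), key.length = H.keyLen κ → ∀ (ℓ : ℕ) (v : (m : ℕ) → Batch m ℓ)
      (adv : List RoundView → Packet),
        Tendsto (fun m : ℕ => (((JmpParams.mk i j k m ℓ (H.outLen κ)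
          (H.hash κ key)).transcript none (v m) adv).length : ℝ) / m) atTop (𝓝 1) ∧
        Tendsto (fun m : ℕ => (honestBits none ((JmpParams.mk i j k m ℓ (H.outLen κ)
          (H.hash κ key)).transcript none (v m) adv) : ℝ) / m) atTop (𝓝 ℓ) ∧
        (1 ≤ ℓ → Tendsto (fun m : ℕ => (m * ℓ : ℝ) / (honestBits none
          ((JmpParams.mk i j k m ℓ (H.outLen κ) (H.hash κ key)).transcript none (v m) adv) : ℝ))
          atTop (𝓝 1))) := by
  have hP : ∀ (κ : ℕ) (key : Str), key.length = H.keyLen κ →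
      ∀ x, (H.hash κ key x).length = H.outLen κ := fun κ key hkey x => H.length_hash κ key x hkey
  -- The constant `24` is the one of `JmpParams.honestBits_transcript_le`.
  refine ⟨fun hH m ℓ hm hℓ hm₁ => ⟨?_, fun c A Z => ?_⟩, fun κ key hkey m ℓ hm v adv s => ?_,
    fun κ key _ m ℓ v adv t => ?_, ⟨24, fun κ key hkey m ℓ hm c v adv => ⟨?_, ?_⟩⟩,
    fun κ key hkey ℓ v adv => ?_⟩
  · exact JmpSetting.securelyRealizes (E := .mk H i j k m ℓ) hij hik hjk hm₁ hm hℓ hH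
  · exact JmpSetting.negligible_failureProb (E := .mk H i j k m ℓ) hij hik hjk hm₁ hm hℓ hH Z c A
  · exact JmpParams.result_none (P := .mk i j k m ℓ (H.outLen κ) (H.hash κ key)) hij hik hjk
      (hP κ key hkey) hm s
  · have h := JmpParams.run_getElem? (.mk i j k m ℓ (H.outLen κ) (H.hash κ key)) none v adv
      (show (t : ℕ) < m + 3 by omega)
    refine (congrArg _ h).trans (congrArg some ?_)
    exact JmpParams.roundAt_i_send (P := .mk i j k m ℓ (H.outLen κ) (H.hash κ key)) (c := none)
      (by simp) t.2
  · exact JmpParams.length_run (.mk i j k m ℓ (H.outLen κ) (H.hash κ key)) c v adv (m + 3)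
  · exact JmpParams.honestBits_transcript_le (P := .mk i j k m ℓ (H.outLen κ) (H.hash κ key))
      hij hik hjk (hP κ key hkey) hm
  · have hlen : ∀ m, ((JmpParams.mk i j k m ℓ (H.outLen κ) (H.hash κ key)).transcript none
        (v m) adv).length = m + 3 := fun m =>
      JmpParams.length_run (.mk i j k m ℓ (H.outLen κ) (H.hash κ key)) none (v m) adv (m + 3)
    have h₁ := fun m => JmpParams.le_honestBits_transcript
      (P := .mk i j k m ℓ (H.outLen κ) (H.hash κ key)) (v := v m) (adv := adv) hij hik hjk
      (hP κ key hkey)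
    have h₂ := fun m => JmpParams.honestBits_transcript_le (c := none)
      (P := .mk i j k m ℓ (H.outLen κ) (H.hash κ key)) (v := v m) (adv := adv) hij hik hjk
      (hP κ key hkey)
    refine ⟨?_, tendsto_div_of_bounded (b := 24 * (H.outLen κ + 1)) h₁ h₂, fun hℓ =>
      tendsto_mul_div_of_bounded (b := 24 * (H.outLen κ + 1)) hℓ h₁ h₂⟩
    simpa [hlen] using tendsto_add_const_div 1 3
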